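/- **Conventions.** For a smooth immersion $h\colon M^n\to\mathbb{R}^N$ (with the induced metric) let $\alpha_h$ be its second fundamental form and $N_1^h(x)=\mathrm{span}\{\alpha_h(X,Y)\}$. For $k\ge 2$ let $N_k^h(x)$ be the span of the components orthogonal to $N_1^h(x)+\dots+N_{k-1}^h(x)$ of the normal vectors $\nabla^\perp_{X_{k+1}}\cdots\nabla^\perp_{X_3}\alpha_h(X_2,X_1)$. Let $\mathcal S(x)\subset N_1^h(x)$ be the span of the $N_1^h$-components of $\nabla^\perp_X\mu$, where $\mu$ is a local section of the orthogonal complement of $N_1^h$ in the normal bundle and $X\in T_xM$. Put $\mathcal N(\alpha_{\mathcal S})=\{Y: (\alpha_h(Y,X))_{\mathcal S}=0\ \forall X\}$; the relative nullity is $\{Y:\alpha_h(Y,X)=0\ \forall X\}$. The immersion is $D^d$-ruled if $D$ is an integrable distribution of rank $d$ whose leaves are mapped onto open subsets of affine subspaces. A map into $\mathbb{R}^N$ is substantial if its image lies in no proper affine subspace, and locally substantial if this holds for its restriction to every nonempty open subset. **Statement.** Let $m\ge 2$ be an integer. (A) Let $L^2$ be a connected smooth surface and $g\colon L^2\to\mathbb{R}^{2(m+3)}$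 a smooth substantial immersion that is elliptic, i.e. there is an almost complex structure $J$ on $L^2$ with $\alpha_g(Z,Z)+\alpha_g(JZ,JZ)=0$ for all $Z\in TL$. Assume that every $N_k^g$ has constant dimension along $L^2$. Then the normal bundle of $g$ is the orthogonal sum $N_1^g\oplus\dots\oplus N_{m+2}^g$ of bundles of rank two. The total space $E$ of $\pi\colon N_1^g\oplus\dots\oplus N_{m-1}^g\to L^2$ is a $2m$-dimensional submanifold of $L^2\times\mathbb{R}^{2(m+3)}$, and the map $f\colon E\to\mathbb{R}^{2(m+3)}$, $f(\xi)=g(\pi(\xi))+\xi$, is smooth and is an immersion on an open set that contains the zero section and the set $M^{2m}$ of all $\xi\in E$ whose component in $N_{m-1}^g$ is nonzero. The set $M^{2m}$ is open, connected and dense in $E$, the restriction $f|_M\colon M^{2m}\to\mathbb{R}^{2m+6}$ is locally substantial, and for every $\xi\in M$ and $x=\pi(\xi)$: 1. $f_*T_\xi M\oplus N_1^f(\xi)=g_*T_xL\oplus N_1^g(x)\oplus\dots\oplus N_{m+1}^g(x)$, and $N_1^f$ has rank $p=4$ on $M$; 2. $\mathcal S(\xi)=N_{m+1}^g(x)$,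 so $\mathcal S$ has rank $s=2$ on $M$; 3. $D=\mathcal N(\alpha_{\mathcal S})$ is the vertical distribution $\ker d\pi$, whose image under $f_*$ at $\xi$ is $N_1^g(x)\oplus\dots\oplus N_{m-1}^g(x)$; $f|_M$ is $D^d$-ruled with $d=2m-2=n-s$, where $n=2m$, and $\mathcal S$ is constant in $\mathbb{R}^{2m+6}$ along the rulings; 4. $D(\xi)$ is not contained in the relative nullity subspace of $f$ at $\xi$. (B) Surfaces $g$ as in (A) exist for every $m\ge2$. (C) Consequently, for every $m\ge 2$ there is a connected, locally substantial immersed submanifold $M^n\subset\mathbb{R}^{n+6}$, $n=2m$, with first normal spaces of constant dimension $p=4$ and $\mathcal S$ of constant rank $s=2$ (so $1<s<p$), which is $D^d$-ruled by $D=\mathcal N(\alpha_{\mathcal S})$ with $\mathcal S$ constant along the rulings, where the bound $d\ge n-s$ is attained, $d=n-s$, and whose rulings are at no point contained in the relative nullity. -/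

import Mathlib

open scoped Manifold ContDiff Topology

noncomputable section

namespace RuledImmersion

/-- The Euclidean space `ℝⁿ`. -/
abbrev Euc (n : ℕ) : Type := EuclideanSpace ℝ (Fin n)

section Coordinates

/-! Geometry of a parametrized immersion `G : ℝⁿ → ℝᴺ`. -/

variable {n N : ℕ}

/-- The orthogonal projection of `ℝᴺ` onto the normal space of `G` at `u`. -/
def coordNormalProj (G : Euc n → Euc N) (u : Euc n) : Euc N →L[ℝ] Euc N :=
  (LinearMap.range (fderiv ℝ G u).toLinearMap)ᗮ.starProjection

/-- The second fundamental form of `G`: the normal component of the second derivative. -/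
def coordSecondForm (G : Euc n → Euc N) (u : Euc n) (X Y : Euc n) : Euc N :=
  coordNormalProj G u (fderiv ℝ (fderiv ℝ G) u X Y)

/-- The vectors `Y` such that `α(Y, X)` has zero component in the subspace `U`, for all `X`. -/
def coordNullity (G : Euc n → Euc N) (u : Euc n) (U : Submodule ℝ (Euc N)) :
    Submodule ℝ (Euc n) where
  carrier := {Y | ∀ X : Euc n, U.starProjection (coordSecondForm G u Y X) = 0}
  zero_mem' X := by simp [coordSecondForm]
  add_mem' hY hZ X := by
    have h := congrArg₂ (· + ·) (hY X) (hZ X)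
    simpa [coordSecondForm] using h
  smul_mem' c Y hY X := by
    have h := congrArg (c • ·) (hY X)
    simpa [coordSecondForm] using h

/-- The iterated normal derivatives `∇^⊥_{X (k+1)} ⋯ ∇^⊥_{X 2} α(X 1, X 0)`, where the `X i` are
regarded as coordinate vector fields (fields with constant coefficients), and
`∇^⊥_X η` is the normal component of the derivative of `η` in the direction `X`. -/
def coordNormalDeriv (G : Euc n → Euc N) (X : ℕ → Euc n) : ℕ → Euc n → Euc N
  | 0 => fun u => coordSecondForm G u (X 1) (X 0)
  | k + 1 => fun u => coordNormalProj G u (fderiv ℝ (coordNormalDeriv G X k) u (X (k + 2)))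

end Coordinates

section Manifold

/-! Geometry of an immersion `f : Mⁿ → ℝᴺ` of a smooth manifold; `M` carries the induced metric. -/

variable (n : ℕ) {N : ℕ} {M : Type*} [TopologicalSpace M] [ChartedSpace (Euc n) M]

/-- The expression of `f` in the preferred chart at `x`. -/
def localRep (f : M → Euc N) (x : M) : Euc n → Euc N :=
  f ∘ (extChartAt (𝓡 n) x).symm

/-- The differential of a map `f : M → ℝᴺ` at `x`. -/
def diff (f : M → Euc N) (x : M) : TangentSpace (𝓡 n) x →L[ℝ] Euc N :=
  mfderiv (𝓡 n) 𝓘(ℝ, Euc N) f x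

/-- The subspace `f_* T_x M` of `ℝᴺ`. -/
def tangentImage (f : M → Euc N) (x : M) : Submodule ℝ (Euc N) :=
  LinearMap.range (diff n f x).toLinearMap

/-- The second fundamental form `α_f` at `x`. -/
def secondForm (f : M → Euc N) (x : M) (X Y : TangentSpace (𝓡 n) x) : Euc N :=
  coordSecondForm (localRep n f x) (extChartAt (𝓡 n) x x) X Y

/-- The first normal space `N_1^f(x)`. -/
def firstNormalSpace (f : M → Euc N) (x : M) : Submodule ℝ (Euc N) :=
  Submodule.span ℝ {v | ∃ X Y : TangentSpace (𝓡 n) x, v = secondForm n f x X Y}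

/-- For a subspace `W` of the normal space at `x`, the span of the components orthogonal to `W` of
the normal vectors `∇^⊥_{X_{k+2}} ⋯ ∇^⊥_{X_3} α(X_2, X_1)`. -/
def spanModulo (f : M → Euc N) (x : M) (k : ℕ) (W : Submodule ℝ (Euc N)) :
    Submodule ℝ (Euc N) :=
  Submodule.span ℝ {v | ∃ X : ℕ → TangentSpace (𝓡 n) x,
    v = (Wᗮ ⊓ (tangentImage n f x)ᗮ).starProjection
      (coordNormalDeriv (localRep n f x) X k (extChartAt (𝓡 n) x x))}

/-- `N_1^f(x) + ⋯ + N_k^f(x)`, the sum of the first `k` normal spaces of `f` at `x`. -/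
def normalSum (f : M → Euc N) (x : M) : ℕ → Submodule ℝ (Euc N)
  | 0 => ⊥
  | 1 => firstNormalSpace n f x
  | k + 2 => normalSum f x (k + 1) ⊔ spanModulo n f x (k + 1) (normalSum f x (k + 1))

/-- The `k`-th normal space `N_k^f(x)`, `k ≥ 1`: the span of the values of the `(k+1)`-st
fundamental form, which is the component orthogonal to `N_1^f(x) + ⋯ + N_{k-1}^f(x)` of
`∇^⊥_{X_{k+1}} ⋯ ∇^⊥_{X_3} α(X_2, X_1)`. -/
def normalSpace (f : M → Euc N) (x : M) : ℕ → Submodule ℝ (Euc N)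
  | 0 => ⊥
  | 1 => firstNormalSpace n f x
  | k + 2 => spanModulo n f x (k + 1) (normalSum n f x (k + 1))

/-- The subspace `𝒮(x)` of `N_1^f(x)` spanned by the vectors `(∇^⊥_X μ)_{N_1}`, where `μ` is a
smooth local section of the orthogonal complement of `N_1^f` in the normal bundle. -/
def nonparallelSpace (f : M → Euc N) (x : M) : Submodule ℝ (Euc N) :=
  Submodule.span ℝ {v | ∃ (μ : M → Euc N) (X : TangentSpace (𝓡 n) x),
    ContMDiffAt (𝓡 n) 𝓘(ℝ, Euc N) ∞ μ x ∧
    (∀ᶠ y in 𝓝 x, μ y ∈ (tangentImage n f y)ᗮ ⊓ (firstNormalSpace n f y)ᗮ) ∧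
    v = (firstNormalSpace n f x).starProjection
      ((tangentImage n f x)ᗮ.starProjection (diff n μ x X))}

/-- `𝒩(α_U)` at `x`: the tangent vectors `Y` with `α_U(Y, X) = 0` for all `X`, where `α_U` is the
component of the second fundamental form in the subspace `U`. -/
def nullity (f : M → Euc N) (x : M) (U : Submodule ℝ (Euc N)) :
    Submodule ℝ (TangentSpace (𝓡 n) x) :=
  coordNullity (localRep n f x) (extChartAt (𝓡 n) x x) U

theorem mem_nullity_iff (f : M → Euc N) (x : M) (U : Submodule ℝ (Euc N))
    (Y : TangentSpace (𝓡 n) x) :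
    Y ∈ nullity n f x U ↔
      ∀ X : TangentSpace (𝓡 n) x, U.starProjection (secondForm n f x Y X) = 0 :=
  Iff.rfl

/-- The relative nullity subspace of `f` at `x`. -/
def relativeNullity (f : M → Euc N) (x : M) : Submodule ℝ (TangentSpace (𝓡 n) x) :=
  nullity n f x (firstNormalSpace n f x)

/-- `f` is a smooth immersion on `U`. -/
def IsImmersionOn (f : M → Euc N) (U : Set M) : Prop :=
  ContMDiffOn (𝓡 n) 𝓘(ℝ, Euc N) ∞ f U ∧ ∀ x ∈ U, Function.Injective (diff n f x)

/-- The image of `f` lies in no proper affine subspace. -/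
def IsSubstantial (f : M → Euc N) : Prop :=
  ∀ A : AffineSubspace ℝ (Euc N), (∀ x, f x ∈ A) → A = ⊤

/-- No nonempty open subset of `U` is mapped by `f` into a proper affine subspace. -/
def IsLocallySubstantialOn (f : M → Euc N) (U : Set M) : Prop :=
  ∀ V : Set M, IsOpen V → V.Nonempty → V ⊆ U →
    ∀ A : AffineSubspace ℝ (Euc N), (∀ x ∈ V, f x ∈ A) → A = ⊤

/-- `σ` parametrizes, near `0`, an integral manifold of `D` through `x`, which `f` maps onto an
open piece of the affine subspace `f(x) + W`. -/
def IsRulingPatch (f : M → Euc N) (D : ∀ x : M, Submodule ℝ (TangentSpace (𝓡 n) x))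
    (U : Set M) (x : M) (W : Submodule ℝ (Euc N)) (σ : W → M) : Prop :=
  σ 0 = x ∧ ∀ᶠ w in 𝓝 (0 : W), σ w ∈ U ∧ ContMDiffAt 𝓘(ℝ, W) (𝓡 n) ∞ σ w ∧
    f (σ w) = f x + w ∧
    LinearMap.range (mfderiv 𝓘(ℝ, W) (𝓡 n) σ w).toLinearMap = D (σ w)

/-- The immersion `f` is `D`-ruled on the open set `U`, where `D` has rank `d`: `D` is a smooth
distribution of rank `d` on `U` (smoothness is expressed by local frames of `f_* D`), and through
each point there is an integral manifold of `D` that `f` maps onto an open subset of an affine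
subspace. Thus `D` is integrable and `f` maps its leaves into affine subspaces, as open sets. -/
def IsRuledOn (f : M → Euc N) (D : ∀ x : M, Submodule ℝ (TangentSpace (𝓡 n) x)) (d : ℕ)
    (U : Set M) : Prop :=
  ∀ x ∈ U, Module.finrank ℝ (D x) = d ∧
    (∃ e : Fin d → M → Euc N, (∀ i, ContMDiffAt (𝓡 n) 𝓘(ℝ, Euc N) ∞ (e i) x) ∧
      ∀ᶠ y in 𝓝 x, Submodule.span ℝ (Set.range fun i => e i y) =
        (D y).map (diff n f y).toLinearMap) ∧
    ∃ (W : Submodule ℝ (Euc N)) (σ : W → M), IsRulingPatch n f D U x W σ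

/-- The family of subspaces `S` of `ℝᴺ` is constant along the rulings of `f`: it is locally
constant, hence constant, on each leaf of `D`. -/
def IsConstantAlongRulingsOn (f : M → Euc N)
    (D : ∀ x : M, Submodule ℝ (TangentSpace (𝓡 n) x))
    (S : M → Submodule ℝ (Euc N)) (U : Set M) : Prop :=
  ∀ x ∈ U, ∀ (W : Submodule ℝ (Euc N)) (σ : W → M), IsRulingPatch n f D U x W σ →
    ∀ᶠ w in 𝓝 (0 : W), S (σ w) = S x

/-- The restriction of `f` to the connected open set `U` is a locally substantial `1`-regular
immersion with first normal bundle of rank `p`, the subspaces `𝒮` have constant rank `s` with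
`1 < s < p`, `f` is ruled by the distribution `D = 𝒩(α_𝒮)` of rank `d`, and `𝒮` is constant in
`ℝᴺ` along the rulings. -/
structure IsNonparallelRuledOn (f : M → Euc N) (U : Set M) (p s d : ℕ) : Prop where
  isOpen : IsOpen U
  isConnected : IsConnected U
  immersion : IsImmersionOn n f U
  locallySubstantial : IsLocallySubstantialOn f U
  rank_firstNormal : ∀ x ∈ U, Module.finrank ℝ (firstNormalSpace n f x) = p
  rank_nonparallel : ∀ x ∈ U, Module.finrank ℝ (nonparallelSpace n f x) = s
  one_lt : 1 < s
  lt_rank : s < p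
  ruled : IsRuledOn n f (fun x => nullity n f x (nonparallelSpace n f x)) d U
  constant : IsConstantAlongRulingsOn n f (fun x => nullity n f x (nonparallelSpace n f x))
    (nonparallelSpace n f) U

end Manifold

section Elliptic

variable {N : ℕ} {L : Type*} [TopologicalSpace L] [ChartedSpace (Euc 2) L]

/-- `J` is a (smooth) almost complex structure on the surface `L`. -/
def IsAlmostComplex [IsManifold (𝓡 2) ∞ L]
    (J : ∀ x : L, TangentSpace (𝓡 2) x →L[ℝ] TangentSpace (𝓡 2) x) : Prop :=
  (∀ x Z, J x (J x Z) = -Z) ∧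
  ∀ x₀ : L, ContMDiffAt (𝓡 2) 𝓘(ℝ, Euc 2 →L[ℝ] Euc 2) ∞
    (inTangentCoordinates (𝓡 2) (𝓡 2) id id J x₀) x₀

/-- `g` is an elliptic surface: a smooth immersion such that `α_g(Z,Z) + α_g(JZ,JZ) = 0` for some
almost complex structure `J`. -/
def IsElliptic [IsManifold (𝓡 2) ∞ L] (g : L → Euc N) : Prop :=
  IsImmersionOn 2 g Set.univ ∧
  ∃ J : ∀ x : L, TangentSpace (𝓡 2) x →L[ℝ] TangentSpace (𝓡 2) x, IsAlmostComplex J ∧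
    ∀ x Z, secondForm 2 g x Z Z + secondForm 2 g x (J x Z) (J x Z) = 0

/-- The normal spaces of `g` have constant dimension, so that they can form vector bundles. -/
def IsRegularSurface (g : L → Euc N) : Prop :=
  ∀ k : ℕ, ∀ x y : L,
    Module.finrank ℝ (normalSpace 2 g x k) = Module.finrank ℝ (normalSpace 2 g y k)

/-- The total space of `N_1^g ⊕ ⋯ ⊕ N_k^g`, as a subspace of `L × ℝᴺ`. -/
abbrev NormalTotal (g : L → Euc N) (k : ℕ) : Type _ :=
  {q : L × Euc N // q.2 ∈ normalSum 2 g q.1 k}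

/-- The bundle projection `π`. -/
def bundleProj (g : L → Euc N) (k : ℕ) (q : NormalTotal g k) : L := q.1.1

/-- The fibre component, a vector in `ℝᴺ`. -/
def fibreVec (g : L → Euc N) (k : ℕ) (q : NormalTotal g k) : Euc N := q.1.2

/-- The map `ξ ↦ g(π(ξ)) + ξ` on the total space of `N_1^g ⊕ ⋯ ⊕ N_k^g`. -/
def ruledMap (g : L → Euc N) (k : ℕ) (q : NormalTotal g k) : Euc N :=
  g (bundleProj g k q) + fibreVec g k q

/-- The set of `ξ ∈ N_1^g ⊕ ⋯ ⊕ N_k^g` whose component in `N_k^g` is nonzero. -/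
def regularPart (g : L → Euc N) (k : ℕ) : Set (NormalTotal g k) :=
  {q | (normalSpace 2 g (bundleProj g k q) k).starProjection (fibreVec g k q) ≠ 0}

/-- The vertical subspace `ker dπ` of the tangent space at `q`, for a manifold structure of
dimension `n` on the total space. -/
def verticalSpace {n : ℕ} (g : L → Euc N) (k : ℕ) [ChartedSpace (Euc n) (NormalTotal g k)]
    (q : NormalTotal g k) : Submodule ℝ (TangentSpace (𝓡 n) q) :=
  LinearMap.ker (mfderiv (𝓡 n) (𝓡 2) (bundleProj g k) q).toLinearMap

/-- The total space, with the given charts, is a smooth submanifold of `L × ℝᴺ`: both components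
of the inclusion are smooth and the inclusion is an immersion (it is a topological embedding by
definition of the topology). -/
def IsSubmanifoldStructure (n : ℕ) (g : L → Euc N) (k : ℕ)
    [ChartedSpace (Euc n) (NormalTotal g k)] : Prop :=
  IsManifold (𝓡 n) ∞ (NormalTotal g k) ∧
  ContMDiff (𝓡 n) (𝓡 2) ∞ (bundleProj g k) ∧
  ContMDiff (𝓡 n) 𝓘(ℝ, Euc N) ∞ (fibreVec g k) ∧
  ∀ (q : NormalTotal g k) (X : TangentSpace (𝓡 n) q),
    mfderiv (𝓡 n) (𝓡 2) (bundleProj g k) q X = 0 → diff n (fibreVec g k) q X = 0 → X = 0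

end Elliptic

end RuledImmersion

end

open RuledImmersion

/-! Everything is read off the osculating spaces `osc` of `g`, the spans O_j of its partial
derivatives of orders 1, …, j. Taking normal components changes an iterated derivative only by terms
of lower order, so N_1 + ⋯ + N_k is the orthogonal complement of O_1 in O_{k+1}, and N_k that of O_k
in O_{k+1} (`normalSum_eq`, `normalSpace_succ_eq`). Germs of smooth combinations of derivatives of
order at most j form a module `jetSec`, and differentiation maps it into the one for j + 1.

In a chart, ellipticity says ∂₁∂₁G + A ∂₀∂₀G + B ∂₀∂₁G ≡ 0 modulo first derivatives, with B² < 4A.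
Hence a section of order j + 1 is p ∂₀ʲ∂₀G + q ∂₀ʲ∂₁G modulo order j (`exists_lead`). Encode its
leading part by ζ = p + qθ, where θ² + Bθ + A = 0. Then the derivative along X has leading part (X₀
+ X₁θ)ζ (`Lead.fderiv`). As θ is not real, this is multiplication in a copy of ℂ, which has no zero
divisors; nearly every nondegeneracy claim below comes from this.

Ranks (`IsElliptic.finrank_oscAt`): each O_{j+1} exceeds O_j by at most two dimensions. If the
growth stops, O_j is constant in space and `g` lies in an affine subspace with that direction, so
O_j is everything. If it is one, the relation between the two leading terms, once differentiated,
stops the growth at the next order, at an odd dimension, which is impossible. Thus dim O_j = 2j up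
to j = m + 3.

Now let k = m − 1 and write `f` locally as G(u) + E(u)t, with E a frame of N_1 ⊕ ⋯ ⊕ N_k. Where ξ =
E(u)t has a nonzero component in N_k, its leading number ζ at order k + 1 is nonzero. A horizontal X
contributes Xζ at order k + 2 to the differential, so `f` is an immersion. Mixed second derivatives
are derivatives of E, and with E itself they span O_{k+2}; the delicate point is that the tangent
plane of `g`, to which E is orthogonal, is recovered (`IsNormalFrame.osc_two_le`). Horizontal second
derivatives have leading part XYζ and fill O_{k+3}. So tangent and first normal spaces of `f`
together give O_{k+3}, and p = 2(k + 3) − (2k + 2) = 4.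

Sections orthogonal to O_{k+3} have derivatives orthogonal to O_{k+2}, and by duality the resulting
components fill N_{k+2} = 𝒮. The 𝒮-component of the second fundamental form is XYζ, so its nullity
is the vertical space. That space is not in the relative nullity, since otherwise O_{k+2}, of
dimension 2k + 4, would lie in the tangent space of `f`. For existence, the curve z ↦ (exp(λ_j z))_j
with distinct λ_j is holomorphic, homogeneous under diagonal linear maps, and substantial by
interpolation. -/

open scoped Manifold ContDiff Topology

noncomputable section

namespace RuledImmersion

/-! ### Modules of germs with smooth coefficients -/

section Germs

variable {E F : Type*} [NormedAddCommGroup E] [NormedSpace ℝ E]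
  [NormedAddCommGroup F] [NormedSpace ℝ F]

/-- The ring of real functions that are smooth at `u`. -/
def smoothRing (u : E) : Subring (E → ℝ) where
  carrier := {c | ContDiffAt ℝ ∞ c u}
  mul_mem' {a b} (ha : ContDiffAt ℝ ∞ a u) (hb : ContDiffAt ℝ ∞ b u) :=
    show ContDiffAt ℝ ∞ (a * b) u from ha.mul hb
  one_mem' := show ContDiffAt ℝ ∞ (fun _ => (1 : ℝ)) u from contDiffAt_const
  add_mem' {a b} (ha : ContDiffAt ℝ ∞ a u) (hb : ContDiffAt ℝ ∞ b u) :=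
    show ContDiffAt ℝ ∞ (a + b) u from ha.add hb
  zero_mem' := show ContDiffAt ℝ ∞ (fun _ => (0 : ℝ)) u from contDiffAt_const
  neg_mem' {a} (ha : ContDiffAt ℝ ∞ a u) := show ContDiffAt ℝ ∞ (-a) u from ha.neg

/-- The functions that agree near `u` with a combination of members of `S` with coefficients
smooth at `u`. -/
def germSpan (u : E) (S : Set (E → F)) : Submodule (smoothRing u) (E → F) :=
  Submodule.span (smoothRing u) (S ∪ {s | s =ᶠ[𝓝 u] 0})

variable {u : E} {S T : Set (E → F)} {s t : E → F}

theorem germSpan_of_mem (h : s ∈ S) : s ∈ germSpan u S :=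
  Submodule.subset_span (Or.inl h)

theorem germSpan_of_eventuallyEq_zero (h : s =ᶠ[𝓝 u] 0) : s ∈ germSpan u S :=
  Submodule.subset_span (Or.inr h)

/-- Functions vanishing near `u` are among the generators exactly so that membership depends only on
the germ. -/
theorem germSpan_congr (hs : s ∈ germSpan u S) (h : t =ᶠ[𝓝 u] s) : t ∈ germSpan u S := by
  have : t - s ∈ germSpan u S := germSpan_of_eventuallyEq_zero (by
    filter_upwards [h] with x hx
    simp [hx])
  simpa using add_mem this hs

theorem germSpan_smul {c : E → ℝ} (hc : ContDiffAt ℝ ∞ c u) (hs : s ∈ germSpan u S) :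
    (fun x => c x • s x) ∈ germSpan u S :=
  (germSpan u S).smul_mem (⟨c, hc⟩ : smoothRing u) hs

theorem germSpan_le (h : ∀ s ∈ S, s ∈ germSpan u T) : germSpan u S ≤ germSpan u T := by
  refine Submodule.span_le.2 ?_
  rintro s (hs | hs)
  · exact h s hs
  · exact germSpan_of_eventuallyEq_zero hs

theorem germSpan_mono (h : S ⊆ T) : germSpan u S ≤ germSpan u T :=
  germSpan_le fun _ hs => germSpan_of_mem (h hs)

theorem contDiffAt_of_mem_germSpan (hS : ∀ s ∈ S, ContDiffAt ℝ ∞ s u) (hs : s ∈ germSpan u S) :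
    ContDiffAt ℝ ∞ s u := by
  induction hs using Submodule.span_induction with
  | mem s hs =>
    rcases hs with hs | hs
    · exact hS s hs
    · exact (contDiffAt_const (c := (0 : F))).congr_of_eventuallyEq hs
  | zero => exact contDiffAt_const
  | add s t _ _ hs ht => exact hs.add ht
  | smul c s _ hs => exact ContDiffAt.smul c.2 hs

theorem eventually_mem_of_mem_germSpan (hs : s ∈ germSpan u S) :
    ∀ᶠ x in 𝓝 u, s x ∈ Submodule.span ℝ ((fun v : E → F => v x) '' S) := by
  induction hs using Submodule.span_induction with
  | mem s hs =>
    rcases hs with hs | hs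
    · exact .of_forall fun x => Submodule.subset_span ⟨s, hs, rfl⟩
    · filter_upwards [hs] with x hx
      simp [hx]
  | zero => exact .of_forall fun x => by simp
  | add s t _ _ hs ht =>
    filter_upwards [hs, ht] with x hx hx'
    exact add_mem hx hx'
  | smul c s _ hs =>
    filter_upwards [hs] with x hx
    exact Submodule.smul_mem _ (c.1 x) hx

theorem _root_.ContDiffAt.eventually_differentiableAt (hs : ContDiffAt ℝ ∞ s u) :
    ∀ᶠ x in 𝓝 u, DifferentiableAt ℝ s x := by
  have h := (hs.of_le (m := 1) (by exact_mod_cast le_top)).eventually (by simp)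
  filter_upwards [h] with x hx
  exact hx.differentiableAt (by simp)

theorem _root_.ContDiffAt.fderiv_infty (hs : ContDiffAt ℝ ∞ s u) :
    ContDiffAt ℝ ∞ (fderiv ℝ s) u :=
  hs.fderiv_right (m := ∞) (by simp)

/-- By the Leibniz rule the derivative of c • s is c • ∂s + ∂c • s, so control is needed both of the
generators and of their derivatives. -/
theorem fderiv_mem_germSpan (hS : ∀ s ∈ S, ContDiffAt ℝ ∞ s u) (X : E)
    (h₀ : ∀ s ∈ S, s ∈ germSpan u T)
    (h₁ : ∀ s ∈ S, (fun x => fderiv ℝ s x X) ∈ germSpan u T) (hs : s ∈ germSpan u S) :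
    (fun x => fderiv ℝ s x X) ∈ germSpan u T := by
  induction hs using Submodule.span_induction with
  | mem s hs =>
    rcases hs with hs | hs
    · exact h₁ s hs
    · refine germSpan_of_eventuallyEq_zero ?_
      filter_upwards [Filter.EventuallyEq.fderiv (𝕜 := ℝ) hs] with x hx
      rw [hx]
      have : fderiv ℝ (0 : E → F) = 0 := by
        ext x; simp
      simp [this]
  | zero =>
    refine germSpan_of_eventuallyEq_zero (.of_forall fun x => ?_)
    have : fderiv ℝ (0 : E → F) = 0 := by
      ext x; simp
    simp [this]
  | add s t hs ht hs' ht' =>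
    have hs₁ := contDiffAt_of_mem_germSpan hS hs
    have ht₁ := contDiffAt_of_mem_germSpan hS ht
    refine germSpan_congr (add_mem hs' ht') ?_
    filter_upwards [hs₁.eventually_differentiableAt, ht₁.eventually_differentiableAt] with x hx hx'
    simp [fderiv_add hx hx']
  | smul c s hs hs' =>
    have hs₁ := contDiffAt_of_mem_germSpan hS hs
    have hc : ContDiffAt ℝ ∞ c.1 u := c.2
    have h₂ : (fun x => fderiv ℝ c.1 x X • s x) ∈ germSpan u T :=
      germSpan_smul (hc.fderiv_infty.clm_apply contDiffAt_const) (germSpan_le h₀ hs)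
    refine germSpan_congr (add_mem (germSpan_smul hc hs') h₂) ?_
    filter_upwards [hs₁.eventually_differentiableAt, hc.eventually_differentiableAt] with x hx hx'
    have : fderiv ℝ (c • s) x = c.1 x • fderiv ℝ s x + (fderiv ℝ c.1 x).smulRight (s x) :=
      fderiv_smul hx' hx
    simp [this]

/-- If `s` is smooth at `u`, its values near `u` lie in the span of a family of smooth functions
that are independent at `u`, then the coefficients are smooth. -/
theorem exists_smooth_coeff {ι : Type*} [Fintype ι] [FiniteDimensional ℝ F] {v : ι → E → F}
    (hv : ∀ i, ContDiffAt ℝ ∞ (v i) u) (hi : LinearIndependent ℝ fun i => v i u)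
    (hs : ContDiffAt ℝ ∞ s u)
    (hmem : ∀ᶠ x in 𝓝 u, s x ∈ Submodule.span ℝ (Set.range fun i => v i x)) :
    ∃ c : ι → E → ℝ, (∀ i, ContDiffAt ℝ ∞ (c i) u) ∧ s =ᶠ[𝓝 u] fun x => ∑ i, c i x • v i x := by
  classical
  let A : E → (ι → ℝ) →L[ℝ] F := fun x =>
    ∑ i, (ContinuousLinearMap.proj (R := ℝ) (φ := fun _ : ι => ℝ) i).smulRight (v i x)
  have hA : ∀ x c, A x c = ∑ i, c i • v i x := fun x c => by simp [A]
  have hAs : ContDiffAt ℝ ∞ A u := by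
    refine ContDiffAt.sum fun i _ => ?_
    exact ((ContinuousLinearMap.smulRightL ℝ (ι → ℝ) F
      (ContinuousLinearMap.proj (R := ℝ) (φ := fun _ : ι => ℝ) i)).contDiff.contDiffAt).comp u (hv i)
  have hinj : Function.Injective (A u) := by
    rw [injective_iff_map_eq_zero]
    intro c hc
    rw [hA] at hc
    ext i
    exact Fintype.linearIndependent_iff.1 hi c hc i
  -- A fixed left inverse `L` of `A u` suffices: `L ∘ A x` is the identity at `u`, hence invertible
  -- nearby, and the coefficients of `s x` are its inverse applied to `L (s x)`.
  obtain ⟨L, hL⟩ := (A u).toLinearMap.exists_leftInverse_of_injective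
    (LinearMap.ker_eq_bot.2 hinj)
  let L' : F →L[ℝ] (ι → ℝ) := L.toContinuousLinearMap
  let K : E → (ι → ℝ) →L[ℝ] (ι → ℝ) := fun x => L'.comp (A x)
  have hK : ContDiffAt ℝ ∞ K u := contDiffAt_const.clm_comp hAs
  have hK0 : K u = (ContinuousLinearEquiv.refl ℝ (ι → ℝ) : (ι → ℝ) →L[ℝ] (ι → ℝ)) := by
    ext1 c
    exact LinearMap.congr_fun hL c
  have hKi : ContDiffAt ℝ ∞ (fun x => (K x).inverse) u := by
    have h := contDiffAt_map_inverse (𝕜 := ℝ) (n := ∞) (ContinuousLinearEquiv.refl ℝ (ι → ℝ))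
    rw [← hK0] at h
    exact h.comp u hK
  have hev : ∀ᶠ x in 𝓝 u, K x ∈ Set.range
      ((↑) : ((ι → ℝ) ≃L[ℝ] (ι → ℝ)) → (ι → ℝ) →L[ℝ] (ι → ℝ)) := by
    refine hK.continuousAt.eventually_mem (ContinuousLinearEquiv.nhds (ContinuousLinearEquiv.refl ℝ (ι → ℝ)) |> fun h => ?_)
    rwa [hK0]
  refine ⟨fun i x => (K x).inverse (L' (s x)) i, fun i => ?_, ?_⟩
  · have h1 : ContDiffAt ℝ ∞ (fun x => (K x).inverse (L' (s x))) u :=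
      hKi.clm_apply (L'.contDiff.contDiffAt.comp u hs)
    exact contDiffAt_pi.1 h1 i
  · filter_upwards [hmem, hev] with x hx hx'
    obtain ⟨c, hc⟩ := (Submodule.mem_span_range_iff_exists_fun ℝ).1 hx
    obtain ⟨e, he⟩ := hx'
    have h1 : (K x).inverse (L' (s x)) = c := by
      have : L' (s x) = e c := by
        rw [← hc, ← hA]
        exact (congrArg (fun f : (ι → ℝ) →L[ℝ] (ι → ℝ) => f c) he).symm
      rw [this, ← he, ContinuousLinearMap.inverse_equiv]
      simp
    simp only [h1]
    exact hc.symm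

end Germs

/-! ### Smoothness of orthogonal projections -/

section Projection

theorem eventually_linearIndependent {E F ι : Type*} [TopologicalSpace E] [Fintype ι]
    [NormedAddCommGroup F] [NormedSpace ℝ F] {v : ι → E → F} {u : E}
    (hv : ∀ i, ContinuousAt (v i) u) (hi : LinearIndependent ℝ fun i => v i u) :
    ∀ᶠ x in 𝓝 u, LinearIndependent ℝ fun i => v i x := by
  have h := (hi.eventually : ∀ᶠ f in 𝓝 (fun i => v i u), LinearIndependent ℝ f)
  exact (continuousAt_pi.2 hv).eventually h

variable {E F ι : Type*} [NormedAddCommGroup E] [NormedSpace ℝ E] [Fintype ι]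
  [NormedAddCommGroup F] [InnerProductSpace ℝ F] [FiniteDimensional ℝ F]

/-- The orthogonal projection onto the span of a smooth family of independent vectors is smooth. -/
theorem contDiffAt_starProjection_span {v : ι → E → F} {u : E}
    (hv : ∀ i, ContDiffAt ℝ ∞ (v i) u) (hi : LinearIndependent ℝ fun i => v i u)
    {V : E → Submodule ℝ F}
    (hV : ∀ᶠ x in 𝓝 u, V x = Submodule.span ℝ (Set.range fun i => v i x)) :
    ContDiffAt ℝ ∞ (fun x => (V x).starProjection) u := by
  classical
  let b := Module.finBasis ℝ F
  let B : E → F →L[ℝ] (ι → ℝ) := fun x => ContinuousLinearMap.pi fun i => innerSL ℝ (v i x)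
  let A : E → (ι → ℝ) →L[ℝ] F := fun x =>
    ∑ i, (ContinuousLinearMap.proj (R := ℝ) (φ := fun _ : ι => ℝ) i).smulRight (v i x)
  have hA : ∀ x c, A x c = ∑ i, c i • v i x := fun x c => by simp [A]
  have hAs : ContDiffAt ℝ ∞ A u := by
    refine ContDiffAt.sum fun i _ => ?_
    exact ((ContinuousLinearMap.smulRightL ℝ (ι → ℝ) F
      (ContinuousLinearMap.proj (R := ℝ) (φ := fun _ : ι => ℝ) i)).contDiff.contDiffAt).comp u (hv i)
  have hB : ContDiffAt ℝ ∞ B u := by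
    have : ContDiffAt ℝ ∞ (fun x => ∑ i, (ContinuousLinearMap.toSpanSingleton ℝ
        (Pi.single i (1 : ℝ) : ι → ℝ)).comp (innerSL ℝ (v i x))) u :=
      ContDiffAt.sum fun i _ => contDiffAt_const.clm_comp ((innerSL ℝ).contDiff.contDiffAt.comp u (hv i))
    refine this.congr_of_eventuallyEq (.of_forall fun x => ?_)
    ext y i
    simp [B, Pi.single_apply]
  -- `B x` is the transpose of `A x`, so `K x` is the Gram matrix of the family. The projection is A
  -- K⁻¹ B, visibly smooth where the family is independent.
  let K : E → (ι → ℝ) →L[ℝ] (ι → ℝ) := fun x => (B x).comp (A x)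
  have hK : ContDiffAt ℝ ∞ K u := hB.clm_comp hAs
  have key : ∀ x, LinearIndependent ℝ (fun i => v i x) →
      ∃ e : (ι → ℝ) ≃L[ℝ] (ι → ℝ), (e : (ι → ℝ) →L[ℝ] (ι → ℝ)) = K x := by
    intro x hx
    have hinj : Function.Injective (K x).toLinearMap := by
      rw [injective_iff_map_eq_zero]
      intro c hc
      have h1 : ∀ i, inner ℝ (v i x) (A x c) = 0 := fun i => congrFun hc i
      have h2 : inner ℝ (A x c) (A x c) = 0 := by
        conv_lhs => rw [hA x c, sum_inner]
        refine Finset.sum_eq_zero fun i _ => ?_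
        rw [← hA x c, inner_smul_left, h1 i, mul_zero]
      rw [inner_self_eq_zero, hA] at h2
      ext i
      exact Fintype.linearIndependent_iff.1 hx c h2 i
    refine ⟨(LinearEquiv.ofInjectiveEndo _ hinj).toContinuousLinearEquiv, ?_⟩
    ext1 c
    rfl
  obtain ⟨e, he⟩ := key u hi
  have hKi : ContDiffAt ℝ ∞ (fun x => (K x).inverse) u := by
    have h := contDiffAt_map_inverse (𝕜 := ℝ) (n := ∞) e
    rw [he] at h
    exact h.comp u hK
  have hP : ContDiffAt ℝ ∞ (fun x => (A x).comp ((K x).inverse.comp (B x))) u :=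
    hAs.clm_comp (hKi.clm_comp hB)
  refine hP.congr_of_eventuallyEq ?_
  filter_upwards [hV, eventually_linearIndependent (fun i => (hv i).continuousAt) hi] with x hx hx'
  obtain ⟨e, he⟩ := key x hx'
  ext1 y
  refine (Submodule.eq_starProjection_of_mem_orthogonal (K := V x) ?_ ?_)
  · rw [hx]
    change A x _ ∈ _
    rw [hA]
    exact Submodule.sum_mem _ fun i _ => Submodule.smul_mem _ _ (Submodule.subset_span ⟨i, rfl⟩)
  · rw [hx, Submodule.mem_orthogonal]
    intro w hw
    have h1 : B x (y - (A x) ((K x).inverse (B x y))) = 0 := by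
      have : B x (A x ((K x).inverse (B x y))) = K x ((K x).inverse (B x y)) := rfl
      rw [map_sub, this, ← he, ContinuousLinearMap.inverse_equiv]
      simp
    refine Submodule.span_induction (p := fun w _ => inner ℝ w (y - (A x) ((K x).inverse (B x y))) = 0)
      ?_ ?_ ?_ ?_ hw
    · rintro _ ⟨i, rfl⟩
      exact congrFun h1 i
    · simp
    · intro a b _ _ ha hb
      rw [inner_add_left, ha, hb, add_zero]
    · intro r a _ ha
      rw [inner_smul_left, ha, mul_zero]

/-- Normal spaces are differences of nested osculating spaces. This turns their projections into
differences of projections, which are easy to differentiate and to evaluate. -/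
theorem starProjection_inf_orthogonal {U V : Submodule ℝ F}
    (h : U ≤ V) :
    (V ⊓ Uᗮ).starProjection = V.starProjection - U.starProjection := by
  ext1 y
  refine (Submodule.eq_starProjection_of_mem_orthogonal (K := V ⊓ Uᗮ) ?_ ?_)
  · refine ⟨sub_mem (V.starProjection_apply_mem y) (h (U.starProjection_apply_mem y)), ?_⟩
    have : V.starProjection y - U.starProjection y
        = (y - U.starProjection y) - (y - V.starProjection y) := by abel
    change V.starProjection y - U.starProjection y ∈ _
    rw [this]
    exact sub_mem (U.sub_starProjection_mem_orthogonal y)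
      (Submodule.orthogonal_le h (V.sub_starProjection_mem_orthogonal y))
  · have : y - (V.starProjection - U.starProjection) y
        = (y - V.starProjection y) + U.starProjection y := by
      simp only [sub_apply]
      abel
    rw [this]
    refine add_mem (Submodule.orthogonal_le inf_le_left (V.sub_starProjection_mem_orthogonal y)) ?_
    exact Submodule.orthogonal_le inf_le_right
      (Submodule.le_orthogonal_orthogonal _ (U.starProjection_apply_mem y))

theorem sup_inf_orthogonal {U V : Submodule ℝ F} (h : U ≤ V) :
    U ⊔ (V ⊓ Uᗮ) = V := by
  refine le_antisymm (sup_le h inf_le_left) fun y hy => ?_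
  have : y = U.starProjection y + (y - U.starProjection y) := by abel
  rw [this]
  exact Submodule.add_mem_sup (U.starProjection_apply_mem y)
    ⟨sub_mem hy (h (U.starProjection_apply_mem y)), U.sub_starProjection_mem_orthogonal y⟩

end Projection

/-! ### Osculating spaces and sections of bounded order -/

section Jets

variable {E F : Type*} [NormedAddCommGroup E] [NormedSpace ℝ E]
  [NormedAddCommGroup F] [NormedSpace ℝ F]

/-- The partial derivatives of `G` of order `1, …, j`, as functions. -/
def jetGens (G : E → F) (j : ℕ) : Set (E → F) :=
  {s | ∃ i, 1 ≤ i ∧ i ≤ j ∧ ∃ v : Fin i → E, s = fun x => iteratedFDeriv ℝ i G x v}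

/-- Germs at `u` of smooth combinations of the partial derivatives of `G` of order `1, …, j`. -/
def jetSec (G : E → F) (u : E) (j : ℕ) : Submodule (smoothRing u) (E → F) :=
  germSpan u (jetGens G j)

/-- The osculating space: the span of the partial derivatives of `G` at `u` of order `1, …, j`. -/
def osc (G : E → F) (u : E) (j : ℕ) : Submodule ℝ F :=
  Submodule.span ℝ {w | ∃ i, 1 ≤ i ∧ i ≤ j ∧ ∃ v : Fin i → E, w = iteratedFDeriv ℝ i G u v}

variable {G : E → F} {u : E} {i j k : ℕ} {s t : E → F}

theorem contDiffAt_iteratedFDeriv (hG : ContDiffAt ℝ ∞ G u) (i : ℕ) :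
    ContDiffAt ℝ ∞ (iteratedFDeriv ℝ i G) u :=
  hG.iteratedFDeriv_right (m := ∞) (by
    have : (⊤ : ℕ∞) + i ≤ ⊤ := le_top
    exact_mod_cast this)

theorem contDiffAt_iteratedFDeriv_apply (hG : ContDiffAt ℝ ∞ G u) (i : ℕ) (v : Fin i → E) :
    ContDiffAt ℝ ∞ (fun x => iteratedFDeriv ℝ i G x v) u :=
  (ContinuousMultilinearMap.apply ℝ (fun _ : Fin i => E) F v).contDiff.contDiffAt.comp u
    (contDiffAt_iteratedFDeriv hG i)

theorem fderiv_iteratedFDeriv_apply {x : E} (h : DifferentiableAt ℝ (iteratedFDeriv ℝ i G) x)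
    (v : Fin i → E) (X : E) :
    fderiv ℝ (fun y => iteratedFDeriv ℝ i G y v) x X =
      iteratedFDeriv ℝ (i + 1) G x (Fin.cons X v : Fin (i + 1) → E) := by
  have h1 := ((ContinuousMultilinearMap.apply ℝ (fun _ : Fin i => E) F v).hasFDerivAt.comp x
    h.hasFDerivAt).fderiv
  have h2 : ((ContinuousMultilinearMap.apply ℝ (fun _ : Fin i => E) F v) ∘ iteratedFDeriv ℝ i G) =
    fun y => iteratedFDeriv ℝ i G y v := rfl
  rw [← h2, h1, iteratedFDeriv_succ_apply_left]
  simp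

theorem jetSec_congr (hs : s ∈ jetSec G u j) (h : t =ᶠ[𝓝 u] s) : t ∈ jetSec G u j :=
  germSpan_congr hs h

theorem jetSec_smul {c : E → ℝ} (hc : ContDiffAt ℝ ∞ c u) (hs : s ∈ jetSec G u j) :
    (fun x => c x • s x) ∈ jetSec G u j :=
  germSpan_smul hc hs

theorem jetSec_mono (h : i ≤ j) : jetSec G u i ≤ jetSec G u j := by
  refine germSpan_mono ?_
  rintro s ⟨k, h1, h2, v, rfl⟩
  exact ⟨k, h1, h2.trans h, v, rfl⟩

theorem osc_mono (h : i ≤ j) : osc G u i ≤ osc G u j := by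
  refine Submodule.span_mono ?_
  rintro s ⟨k, h1, h2, v, rfl⟩
  exact ⟨k, h1, h2.trans h, v, rfl⟩

theorem iteratedFDeriv_mem_osc (h1 : 1 ≤ i) (h : i ≤ j) (v : Fin i → E) :
    iteratedFDeriv ℝ i G u v ∈ osc G u j :=
  Submodule.subset_span ⟨i, h1, h, v, rfl⟩

theorem iteratedFDeriv_mem_jetSec (h1 : 1 ≤ i) (h : i ≤ j) (v : Fin i → E) :
    (fun x => iteratedFDeriv ℝ i G x v) ∈ jetSec G u j :=
  germSpan_of_mem ⟨i, h1, h, v, rfl⟩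

theorem contDiffAt_of_mem_jetSec (hG : ContDiffAt ℝ ∞ G u) (hs : s ∈ jetSec G u j) :
    ContDiffAt ℝ ∞ s u := by
  refine contDiffAt_of_mem_germSpan ?_ hs
  rintro s ⟨k, h1, h2, v, rfl⟩
  exact contDiffAt_iteratedFDeriv_apply hG k v

theorem eventually_mem_osc (hs : s ∈ jetSec G u j) : ∀ᶠ x in 𝓝 u, s x ∈ osc G x j := by
  filter_upwards [eventually_mem_of_mem_germSpan hs] with x hx
  refine Submodule.span_mono ?_ hx
  rintro _ ⟨_, ⟨k, h1, h2, v, rfl⟩, rfl⟩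
  exact ⟨k, h1, h2, v, rfl⟩

theorem mem_osc_of_mem_jetSec (hs : s ∈ jetSec G u j) : s u ∈ osc G u j :=
  (eventually_mem_osc hs).self_of_nhds

/-- The grading behind all later arguments: one derivative costs one order, the derivatives of the
coefficients costing nothing. -/
theorem fderiv_mem_jetSec (hG : ContDiffAt ℝ ∞ G u) (hs : s ∈ jetSec G u j) (X : E) :
    (fun x => fderiv ℝ s x X) ∈ jetSec G u (j + 1) := by
  refine fderiv_mem_germSpan ?_ X ?_ ?_ hs
  · rintro s ⟨k, h1, h2, v, rfl⟩
    exact contDiffAt_iteratedFDeriv_apply hG k v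
  · rintro s ⟨k, h1, h2, v, rfl⟩
    exact iteratedFDeriv_mem_jetSec h1 (by omega) v
  · rintro s ⟨k, h1, h2, v, rfl⟩
    refine jetSec_congr (iteratedFDeriv_mem_jetSec (i := k + 1) (by omega) (by omega)
      (Fin.cons X v : Fin (k + 1) → E)) ?_
    filter_upwards [(contDiffAt_iteratedFDeriv hG k).eventually_differentiableAt] with x hx
    exact fderiv_iteratedFDeriv_apply hx v X

theorem jetSec_sum {ι : Type*} {A : Finset ι} {c : ι → E → ℝ} {v : ι → E → F}
    (hc : ∀ i ∈ A, ContDiffAt ℝ ∞ (c i) u) (hv : ∀ i ∈ A, v i ∈ jetSec G u j) :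
    (fun x => ∑ i ∈ A, c i x • v i x) ∈ jetSec G u j := by
  have : (fun x => ∑ i ∈ A, c i x • v i x) = ∑ i ∈ A, fun x => c i x • v i x := by
    ext x
    simp
  rw [this]
  exact Submodule.sum_mem _ fun i hi => jetSec_smul (hc i hi) (hv i hi)

theorem fderiv_self_mem_jetSec (X : E) : (fun x => fderiv ℝ G x X) ∈ jetSec G u 1 := by
  have h := iteratedFDeriv_mem_jetSec (G := G) (u := u) le_rfl le_rfl (fun _ : Fin 1 => X)
  simpa [iteratedFDeriv_one_apply] using h

theorem osc_one : osc G u 1 = LinearMap.range (fderiv ℝ G u).toLinearMap := by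
  refine le_antisymm (Submodule.span_le.2 ?_) ?_
  · rintro _ ⟨i, h1, h2, v, rfl⟩
    obtain rfl : i = 1 := le_antisymm h2 h1
    exact ⟨v 0, by simp [iteratedFDeriv_one_apply]⟩
  · rintro _ ⟨X, rfl⟩
    have := iteratedFDeriv_mem_osc (G := G) (u := u) le_rfl le_rfl (fun _ : Fin 1 => X)
    simpa [iteratedFDeriv_one_apply] using this

theorem osc_zero : osc G u 0 = ⊥ := by
  rw [eq_bot_iff]
  refine Submodule.span_le.2 ?_
  rintro _ ⟨i, h1, h2, v, rfl⟩
  omega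

/-- Constant coefficients extend any vector of the osculating space, so no rank assumption is
needed. -/
theorem exists_mem_jetSec {w : F} (hw : w ∈ osc G u j) : ∃ s ∈ jetSec G u j, s u = w := by
  induction hw using Submodule.span_induction with
  | mem w hw =>
    obtain ⟨i, h1, h2, v, rfl⟩ := hw
    exact ⟨_, iteratedFDeriv_mem_jetSec h1 h2 v, rfl⟩
  | zero => exact ⟨0, zero_mem _, rfl⟩
  | add a b _ _ ha hb =>
    obtain ⟨s, hs, rfl⟩ := ha
    obtain ⟨t, ht, rfl⟩ := hb
    exact ⟨s + t, add_mem hs ht, rfl⟩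
  | smul c a _ ha =>
    obtain ⟨s, hs, rfl⟩ := ha
    exact ⟨_, jetSec_smul (c := fun _ => c) contDiffAt_const hs, rfl⟩

theorem osc_succ : osc G u (j + 1) = osc G u j ⊔
    Submodule.span ℝ (Set.range fun v : Fin (j + 1) → E => iteratedFDeriv ℝ (j + 1) G u v) := by
  refine le_antisymm (Submodule.span_le.2 ?_) (sup_le (osc_mono (by omega)) ?_)
  · rintro _ ⟨i, h1, h2, v, rfl⟩
    rcases Nat.lt_or_ge i (j + 1) with h | h
    · exact Submodule.mem_sup_left (iteratedFDeriv_mem_osc h1 (by omega) v)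
    · obtain rfl : i = j + 1 := le_antisymm h2 h
      exact Submodule.mem_sup_right (Submodule.subset_span ⟨v, rfl⟩)
  · refine Submodule.span_le.2 ?_
    rintro _ ⟨v, rfl⟩
    exact iteratedFDeriv_mem_osc (by omega) le_rfl v

theorem osc_congr {H : E → F} (h : G =ᶠ[𝓝 u] H) : osc G u j = osc H u j := by
  unfold osc
  congr 1
  ext w
  have h1 : ∀ i, iteratedFDeriv ℝ i G u = iteratedFDeriv ℝ i H u := fun i =>
    (Filter.EventuallyEq.iteratedFDeriv (𝕜 := ℝ) h i).self_of_nhds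
  simp only [h1]

/-- Faà di Bruno: an i-th derivative of a composition is a sum over partitions of terms in which `G`
is differentiated as many times as there are parts, between 1 and i. Hence osculating spaces do not
depend on the chart. -/
theorem osc_comp_le {E' : Type*} [NormedAddCommGroup E'] [NormedSpace ℝ E'] {ψ : E' → E} {x : E'}
    (hG : ContDiffAt ℝ ∞ G (ψ x)) (hψ : ContDiffAt ℝ ∞ ψ x) :
    osc (G ∘ ψ) x j ≤ osc G (ψ x) j := by
  refine Submodule.span_le.2 ?_
  rintro _ ⟨i, h1, h2, v, rfl⟩
  have h := iteratedFDeriv_comp hG hψ (i := i) (by exact_mod_cast le_top)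
  rw [h]
  rw [FormalMultilinearSeries.taylorComp, sum_apply]
  refine Submodule.sum_mem _ fun c _ => ?_
  rw [FormalMultilinearSeries.compAlongOrderedFinpartition_apply]
  exact iteratedFDeriv_mem_osc (c.length_pos h1) (c.length_le.trans h2) _

/-- If a germ of smooth functions takes values in the span of independent members of `jetSec`,
it belongs to `jetSec`. -/
theorem mem_jetSec_of_mem_span {ι : Type*} [Fintype ι] [FiniteDimensional ℝ F]
    (hG : ContDiffAt ℝ ∞ G u) {v : ι → E → F}
    (hv : ∀ i, v i ∈ jetSec G u j) (hi : LinearIndependent ℝ fun i => v i u)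
    (hs : ContDiffAt ℝ ∞ s u)
    (hmem : ∀ᶠ x in 𝓝 u, s x ∈ Submodule.span ℝ (Set.range fun i => v i x)) :
    s ∈ jetSec G u j := by
  obtain ⟨c, hc, h⟩ := exists_smooth_coeff (fun i => contDiffAt_of_mem_jetSec hG (hv i)) hi hs hmem
  exact jetSec_congr (jetSec_sum (A := Finset.univ) (fun i _ => hc i) fun i _ => hv i) h

end Jets

/-! ### Normal derivatives compared with partial derivatives -/

section CoordinateNormalSpaces

variable {n N : ℕ} {G : Euc n → Euc N} {u : Euc n}

theorem range_fderiv_eq_span (A : Euc n →L[ℝ] Euc N) :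
    LinearMap.range A.toLinearMap =
      Submodule.span ℝ (Set.range fun i => A (EuclideanSpace.basisFun (Fin n) ℝ i)) := by
  have h := (EuclideanSpace.basisFun (Fin n) ℝ).toBasis.span_eq
  rw [LinearMap.range_eq_map, ← h, Submodule.map_span, ← Set.range_comp]
  congr 2

theorem linearIndependent_fderiv (hi : Function.Injective (fderiv ℝ G u)) :
    LinearIndependent ℝ fun i => fderiv ℝ G u (EuclideanSpace.basisFun (Fin n) ℝ i) := by
  have h := (EuclideanSpace.basisFun (Fin n) ℝ).toBasis.linearIndependent
  have h2 := h.map' (fderiv ℝ G u).toLinearMap (LinearMap.ker_eq_bot.2 hi)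
  have h3 : (fun i => fderiv ℝ G u (EuclideanSpace.basisFun (Fin n) ℝ i)) =
      (fderiv ℝ G u).toLinearMap ∘ (EuclideanSpace.basisFun (Fin n) ℝ).toBasis := by
    ext1 i
    simp
  rw [h3]
  exact h2

theorem contDiffAt_tangentProj (hG : ContDiffAt ℝ ∞ G u)
    (hi : Function.Injective (fderiv ℝ G u)) :
    ContDiffAt ℝ ∞ (fun x => (LinearMap.range (fderiv ℝ G x).toLinearMap).starProjection) u :=
  contDiffAt_starProjection_span
    (v := fun i x => fderiv ℝ G x (EuclideanSpace.basisFun (Fin n) ℝ i))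
    (fun _ => hG.fderiv_infty.clm_apply contDiffAt_const) (linearIndependent_fderiv hi)
    (.of_forall fun _ => range_fderiv_eq_span _)

theorem tangentProj_mem_jetSec (hG : ContDiffAt ℝ ∞ G u)
    (hi : Function.Injective (fderiv ℝ G u)) {s : Euc n → Euc N} (hs : ContDiffAt ℝ ∞ s u) :
    (fun x => (LinearMap.range (fderiv ℝ G x).toLinearMap).starProjection (s x))
      ∈ jetSec G u 1 := by
  refine mem_jetSec_of_mem_span hG
    (v := fun i x => fderiv ℝ G x (EuclideanSpace.basisFun (Fin n) ℝ i))
    (fun i => fderiv_self_mem_jetSec _) (linearIndependent_fderiv hi)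
    ((contDiffAt_tangentProj hG hi).clm_apply hs) (.of_forall fun x => ?_)
  rw [← range_fderiv_eq_span]
  exact Submodule.starProjection_apply_mem _ _

theorem coordNormalProj_apply (x : Euc n) (y : Euc N) :
    coordNormalProj G x y
      = y - (LinearMap.range (fderiv ℝ G x).toLinearMap).starProjection y := by
  simp [coordNormalProj, Submodule.starProjection_orthogonal_val]

theorem coordNormalProj_sub_mem_jetSec (hG : ContDiffAt ℝ ∞ G u)
    (hi : Function.Injective (fderiv ℝ G u)) {s : Euc n → Euc N} (hs : ContDiffAt ℝ ∞ s u) :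
    (fun x => coordNormalProj G x (s x)) - s ∈ jetSec G u 1 := by
  have h := neg_mem (tangentProj_mem_jetSec hG hi hs)
  convert h using 1
  ext1 x
  simp [coordNormalProj_apply]

/-- Each normal projection removes only a section of order 1, and differentiating the error
accumulated so far raises its order by one. The order of the directions is reversed because the last
differentiation occupies slot 0 of `iteratedFDeriv`. -/
theorem coordNormalDeriv_sub_mem_jetSec (hG : ContDiffAt ℝ ∞ G u)
    (hi : Function.Injective (fderiv ℝ G u)) (X : ℕ → Euc n) (k : ℕ) :
    coordNormalDeriv G X k -
      (fun x => iteratedFDeriv ℝ (k + 2) G x fun i => X (k + 1 - i)) ∈ jetSec G u (k + 1) := by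
  induction k with
  | zero =>
    have h := coordNormalProj_sub_mem_jetSec hG hi
      (contDiffAt_iteratedFDeriv_apply hG 2 fun i => X (0 + 1 - i))
    convert h using 2
    ext1 x
    simp [coordNormalDeriv, coordSecondForm, iteratedFDeriv_two_apply]
  | succ k ih =>
    have hI := contDiffAt_iteratedFDeriv_apply hG (k + 2) fun i => X (k + 1 - i)
    have hγ := contDiffAt_of_mem_jetSec hG ih
    have hD : ContDiffAt ℝ ∞ (coordNormalDeriv G X k) u := by
      simpa using hγ.add hI
    have h1 := coordNormalProj_sub_mem_jetSec hG hi
      (hD.fderiv_infty.clm_apply (contDiffAt_const (c := X (k + 2))))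
    have h2 := fderiv_mem_jetSec hG ih (X (k + 2))
    refine jetSec_congr (add_mem (jetSec_mono (by omega) h1) h2) ?_
    filter_upwards [hI.eventually_differentiableAt, hD.eventually_differentiableAt,
      (contDiffAt_iteratedFDeriv hG (k + 2)).eventually_differentiableAt] with x hx hx' hx''
    have h3 := fderiv_iteratedFDeriv_apply hx'' (fun i => X (k + 1 - i)) (X (k + 2))
    have h4 : (Fin.cons (X (k + 2)) fun i : Fin (k + 2) => X (k + 1 - i) : Fin (k + 3) → Euc n)
        = fun i : Fin (k + 3) => X (k + 1 + 1 - i) := by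
      ext1 i
      refine Fin.cases ?_ (fun i => ?_) i
      · simp
      · simp only [Fin.cons_succ, Fin.val_succ]
        congr 1
        omega
    rw [h4] at h3
    have h5 := fderiv_sub hx' hx
    simp only [Pi.sub_apply, Pi.add_apply, h5, coordNormalDeriv, sub_apply, h3]
    abel

end CoordinateNormalSpaces

/-! ### Subspaces modulo a fixed subspace -/

section LinearAlgebra

variable {F : Type*} [NormedAddCommGroup F] [InnerProductSpace ℝ F] [FiniteDimensional ℝ F]

omit [FiniteDimensional ℝ F] in
theorem starProjection_congr {U V : Submodule ℝ F} [U.HasOrthogonalProjection]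
    [V.HasOrthogonalProjection] (h : U = V) (y : F) :
    U.starProjection y = V.starProjection y := by
  subst h
  rfl

/-- Projecting to the complement of `U` changes a vector by an element of `U`, so both families
coincide modulo `U`. It lets fundamental forms be replaced by plain derivatives. -/
theorem sup_span_starProjection {ι : Sort*} (U : Submodule ℝ F) {D I : ι → F}
    (h : ∀ i, D i - I i ∈ U) :
    U ⊔ Submodule.span ℝ {w | ∃ i, w = Uᗮ.starProjection (D i)} =
      U ⊔ Submodule.span ℝ (Set.range I) := by
  have key : ∀ i, Uᗮ.starProjection (D i) - I i ∈ U := fun i => by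
    rw [Submodule.starProjection_orthogonal_val]
    have : D i - U.starProjection (D i) - I i = (D i - I i) - U.starProjection (D i) := by abel
    rw [this]
    exact sub_mem (h i) (U.starProjection_apply_mem _)
  refine le_antisymm (sup_le le_sup_left (Submodule.span_le.2 ?_))
    (sup_le le_sup_left (Submodule.span_le.2 ?_))
  · rintro _ ⟨i, rfl⟩
    have : Uᗮ.starProjection (D i) = (Uᗮ.starProjection (D i) - I i) + I i := by abel
    rw [this]
    exact Submodule.add_mem_sup (key i) (Submodule.subset_span ⟨i, rfl⟩)
  · rintro _ ⟨i, rfl⟩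
    have : I i = -(Uᗮ.starProjection (D i) - I i) + Uᗮ.starProjection (D i) := by abel
    rw [this]
    exact Submodule.add_mem_sup (neg_mem (key i)) (Submodule.subset_span ⟨i, rfl⟩)

omit [FiniteDimensional ℝ F] in
theorem eq_inf_orthogonal {U V W : Submodule ℝ F} (h : U ⊔ W = V) (hW : W ≤ Uᗮ) :
    W = V ⊓ Uᗮ := by
  refine le_antisymm (le_inf (h ▸ le_sup_right) hW) ?_
  rintro y ⟨hy, hy'⟩
  rw [← h] at hy
  obtain ⟨a, ha, b, hb, rfl⟩ := Submodule.mem_sup.1 hy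
  have h1 : a ∈ Uᗮ := by simpa using sub_mem hy' (hW hb)
  have h2 : a = 0 := by
    have := U.inf_orthogonal_eq_bot
    have h3 : a ∈ U ⊓ Uᗮ := ⟨ha, h1⟩
    rwa [this, Submodule.mem_bot] at h3
  simpa [h2] using hb

end LinearAlgebra

/-! ### Normal spaces as differences of osculating spaces -/

section ManifoldNormalSpaces

variable {n N : ℕ} {M : Type*} [TopologicalSpace M] [ChartedSpace (Euc n) M]
  {f : M → Euc N} {x : M} {k : ℕ}

/-- The osculating space of `f` at `x`, spanned by the derivatives of order `1, …, j`. -/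
def oscAt (n : ℕ) {N : ℕ} {M : Type*} [TopologicalSpace M] [ChartedSpace (Euc n) M]
    (f : M → Euc N) (x : M) (j : ℕ) : Submodule ℝ (Euc N) :=
  osc (localRep n f x) (extChartAt (𝓡 n) x x) j

theorem contDiffAt_localRep (h : ContMDiffAt (𝓡 n) 𝓘(ℝ, Euc N) ∞ f x) :
    ContDiffAt ℝ ∞ (localRep n f x) (extChartAt (𝓡 n) x x) := by
  have h2 := (contMDiffAt_iff.1 h).2
  rw [ModelWithCorners.range_eq_univ, contDiffWithinAt_univ] at h2
  exact h2

theorem diff_eq_fderiv (h : MDifferentiableAt (𝓡 n) 𝓘(ℝ, Euc N) f x) :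
    diff n f x = fderiv ℝ (localRep n f x) (extChartAt (𝓡 n) x x) := by
  refine h.mfderiv.trans ?_
  rw [ModelWithCorners.range_eq_univ, fderivWithin_univ]
  rfl

theorem tangentImage_eq_osc (h : MDifferentiableAt (𝓡 n) 𝓘(ℝ, Euc N) f x) :
    tangentImage n f x = oscAt n f x 1 := by
  rw [oscAt, osc_one, tangentImage, diff_eq_fderiv h]
  rfl

theorem tangentImage_sup_firstNormalSpace (h : MDifferentiableAt (𝓡 n) 𝓘(ℝ, Euc N) f x) :
    tangentImage n f x ⊔ firstNormalSpace n f x = tangentImage n f x ⊔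
      Submodule.span ℝ (Set.range fun X : Euc n × Euc n =>
        fderiv ℝ (fderiv ℝ (localRep n f x)) (extChartAt (𝓡 n) x x) X.1 X.2) := by
  rw [← sup_span_starProjection (tangentImage n f x) (D := fun X : Euc n × Euc n =>
        fderiv ℝ (fderiv ℝ (localRep n f x)) (extChartAt (𝓡 n) x x) X.1 X.2) (fun i => by simp)]
  congr 1
  refine congrArg (Submodule.span ℝ) (Set.ext fun w => ?_)
  simp only [secondForm, coordSecondForm, coordNormalProj, tangentImage, diff_eq_fderiv h]
  constructor
  · rintro ⟨X, Y, rfl⟩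
    exact ⟨(X, Y), rfl⟩
  · rintro ⟨X, rfl⟩
    exact ⟨X.1, X.2, rfl⟩

theorem firstNormalSpace_le_orthogonal (h : MDifferentiableAt (𝓡 n) 𝓘(ℝ, Euc N) f x) :
    firstNormalSpace n f x ≤ (tangentImage n f x)ᗮ := by
  refine Submodule.span_le.2 ?_
  rintro _ ⟨X, Y, rfl⟩
  simp only [secondForm, coordSecondForm, coordNormalProj, tangentImage, diff_eq_fderiv h]
  exact Submodule.starProjection_apply_mem _ _

theorem spanModulo_le (W : Submodule ℝ (Euc N)) :
    spanModulo n f x k W ≤ (tangentImage n f x ⊔ W)ᗮ := by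
  refine Submodule.span_le.2 ?_
  rintro _ ⟨X, rfl⟩
  have := Submodule.starProjection_apply_mem (Wᗮ ⊓ (tangentImage n f x)ᗮ)
      (coordNormalDeriv (localRep n f x) X k (extChartAt (𝓡 n) x x))
  rw [← Submodule.inf_orthogonal]
  exact ⟨this.2, this.1⟩

theorem normalSum_le_orthogonal (h : MDifferentiableAt (𝓡 n) 𝓘(ℝ, Euc N) f x) (k : ℕ) :
    normalSum n f x k ≤ (tangentImage n f x)ᗮ := by
  match k with
  | 0 => exact bot_le
  | 1 => exact firstNormalSpace_le_orthogonal h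
  | k + 2 =>
    exact sup_le (normalSum_le_orthogonal h (k + 1))
      ((spanModulo_le _).trans (Submodule.orthogonal_le le_sup_left))

/-- The generators of the next normal space agree with the partial derivatives of the next order
modulo the osculating space already reached, so each step adds exactly one order. -/
theorem tangentImage_sup_normalSum (h : ContMDiffAt (𝓡 n) 𝓘(ℝ, Euc N) ∞ f x)
    (hi : Function.Injective (diff n f x)) (k : ℕ) :
    tangentImage n f x ⊔ normalSum n f x k = oscAt n f x (k + 1) := by
  have hd : MDifferentiableAt (𝓡 n) 𝓘(ℝ, Euc N) f x := h.mdifferentiableAt (by simp)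
  rw [diff_eq_fderiv hd] at hi
  have hG := contDiffAt_localRep h
  match k with
  | 0 =>
    rw [tangentImage_eq_osc hd]
    simp [normalSum]
  | 1 =>
    have h1 := tangentImage_sup_firstNormalSpace hd
    rw [normalSum, h1, tangentImage_eq_osc hd]
    unfold oscAt
    rw [osc_succ (j := 1)]
    congr 1
    refine congrArg (Submodule.span ℝ) (Set.ext fun w => ?_)
    constructor
    · rintro ⟨X, rfl⟩
      exact ⟨![X.1, X.2], by simp [iteratedFDeriv_two_apply]⟩
    · rintro ⟨v, rfl⟩
      exact ⟨(v 0, v 1), by simp [iteratedFDeriv_two_apply]⟩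
  | k + 2 =>
    have ih := tangentImage_sup_normalSum h (by rw [diff_eq_fderiv hd]; exact hi) (k + 1)
    have h1 : tangentImage n f x ⊔ normalSum n f x (k + 2) =
        (tangentImage n f x ⊔ normalSum n f x (k + 1)) ⊔
          spanModulo n f x (k + 1) (normalSum n f x (k + 1)) := by
      rw [normalSum, sup_assoc]
    have h2 : spanModulo n f x (k + 1) (normalSum n f x (k + 1)) =
        Submodule.span ℝ {w | ∃ X : ℕ → Euc n, w = (oscAt n f x (k + 1 + 1))ᗮ.starProjection
          (coordNormalDeriv (localRep n f x) X (k + 1) (extChartAt (𝓡 n) x x))} := by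
      refine congrArg (Submodule.span ℝ) (Set.ext fun w => exists_congr fun X => ?_)
      rw [starProjection_congr (V := (oscAt n f x (k + 1 + 1))ᗮ)
        (by rw [← ih, ← Submodule.inf_orthogonal, inf_comm])]
    have h3 := sup_span_starProjection (oscAt n f x (k + 1 + 1))
      (D := fun X => coordNormalDeriv (localRep n f x) X (k + 1) (extChartAt (𝓡 n) x x))
      (I := fun X => iteratedFDeriv ℝ (k + 1 + 2) (localRep n f x) (extChartAt (𝓡 n) x x)
        fun i => X (k + 1 + 1 - i))
      (fun X => mem_osc_of_mem_jetSec (coordNormalDeriv_sub_mem_jetSec hG hi X (k + 1)))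
    rw [h1, ih, h2, h3]
    unfold oscAt
    rw [osc_succ (j := k + 2)]
    congr 1
    refine congrArg (Submodule.span ℝ) (Set.ext fun w => ?_)
    constructor
    · rintro ⟨X, rfl⟩
      exact ⟨_, rfl⟩
    · rintro ⟨v, rfl⟩
      -- The reversal of indices is undone here; for `l > k + 2` the truncated subtraction gives `v
      -- 0`, a value never used.
      refine ⟨fun l => v ⟨k + 2 - l, by omega⟩, ?_⟩
      dsimp only
      congr 1
      ext1 i
      congr 1
      ext
      simp only
      omega

theorem normalSum_eq (h : ContMDiffAt (𝓡 n) 𝓘(ℝ, Euc N) ∞ f x)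
    (hi : Function.Injective (diff n f x)) (k : ℕ) :
    normalSum n f x k = oscAt n f x (k + 1) ⊓ (oscAt n f x 1)ᗮ := by
  have hd : MDifferentiableAt (𝓡 n) 𝓘(ℝ, Euc N) f x := h.mdifferentiableAt (by simp)
  rw [← tangentImage_eq_osc hd]
  exact eq_inf_orthogonal (tangentImage_sup_normalSum h hi k) (normalSum_le_orthogonal hd k)

theorem normalSpace_succ_eq (h : ContMDiffAt (𝓡 n) 𝓘(ℝ, Euc N) ∞ f x)
    (hi : Function.Injective (diff n f x)) (k : ℕ) :
    normalSpace n f x (k + 1) = oscAt n f x (k + 2) ⊓ (oscAt n f x (k + 1))ᗮ := by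
  have hd : MDifferentiableAt (𝓡 n) 𝓘(ℝ, Euc N) f x := h.mdifferentiableAt (by simp)
  match k with
  | 0 => exact normalSum_eq h hi 1
  | k + 1 =>
    refine eq_inf_orthogonal (W := normalSpace n f x (k + 1 + 1)) ?_ ?_
    · rw [← tangentImage_sup_normalSum h hi (k + 1), ← tangentImage_sup_normalSum h hi (k + 2),
        sup_assoc]
      rfl
    · rw [← tangentImage_sup_normalSum h hi (k + 1)]
      exact spanModulo_le _

end ManifoldNormalSpaces

/-! ### Independence of the chart -/

section ChartChange

variable {n N : ℕ} {M : Type*} [TopologicalSpace M] [ChartedSpace (Euc n) M]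
  {V : Type*} [NormedAddCommGroup V] [NormedSpace ℝ V]

theorem contDiffAt_comp_extChartAt_symm {h : M → V} {x : M}
    (hh : ContMDiffAt (𝓡 n) 𝓘(ℝ, V) ∞ h x) :
    ContDiffAt ℝ ∞ (h ∘ (extChartAt (𝓡 n) x).symm) (extChartAt (𝓡 n) x x) := by
  have h2 := (contMDiffAt_iff.1 hh).2
  rw [ModelWithCorners.range_eq_univ, contDiffWithinAt_univ] at h2
  exact h2

variable [IsManifold (𝓡 n) ∞ M] {f : M → Euc N} {a b x : M}

theorem contDiffAt_coordChange (ha : x ∈ (extChartAt (𝓡 n) a).source)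
    (hb : x ∈ (extChartAt (𝓡 n) b).source) :
    ContDiffAt ℝ ∞ (extChartAt (𝓡 n) b ∘ (extChartAt (𝓡 n) a).symm) (extChartAt (𝓡 n) a x) := by
  have h' : extChartAt (𝓡 n) a x ∈
      ((extChartAt (𝓡 n) a).symm ≫ (extChartAt (𝓡 n) b)).source := by
    rw [PartialEquiv.trans_source'', PartialEquiv.symm_symm, PartialEquiv.symm_target]
    exact Set.mem_image_of_mem _ ⟨ha, hb⟩
  have := contDiffWithinAt_ext_coord_change (I := 𝓡 n) (n := ∞) b a h'
  rwa [ModelWithCorners.range_eq_univ, contDiffWithinAt_univ] at this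

omit [IsManifold (𝓡 n) ∞ M] in
theorem eventually_symm_mem_source (ha : x ∈ (extChartAt (𝓡 n) a).source)
    (hb : x ∈ (extChartAt (𝓡 n) b).source) :
    ∀ᶠ u in 𝓝 (extChartAt (𝓡 n) a x), (extChartAt (𝓡 n) a).symm u ∈
      (extChartAt (𝓡 n) b).source := by
  have h1 : ContinuousAt (extChartAt (𝓡 n) a).symm (extChartAt (𝓡 n) a x) :=
    continuousAt_extChartAt_symm' ha
  refine h1.eventually_mem ?_
  rw [(extChartAt (𝓡 n) a).left_inv ha]
  exact (isOpen_extChartAt_source b).mem_nhds hb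

omit [IsManifold (𝓡 n) ∞ M] in
theorem localRep_eventuallyEq (ha : x ∈ (extChartAt (𝓡 n) a).source)
    (hb : x ∈ (extChartAt (𝓡 n) b).source) :
    localRep n f a =ᶠ[𝓝 (extChartAt (𝓡 n) a x)]
      localRep n f b ∘ (extChartAt (𝓡 n) b ∘ (extChartAt (𝓡 n) a).symm) := by
  filter_upwards [eventually_symm_mem_source ha hb] with u hu
  simp only [localRep, Function.comp_apply]
  rw [(extChartAt (𝓡 n) b).left_inv hu]

theorem contDiffAt_localRep' (hb : x ∈ (extChartAt (𝓡 n) b).source)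
    (h : ContMDiffAt (𝓡 n) 𝓘(ℝ, Euc N) ∞ f x) :
    ContDiffAt ℝ ∞ (localRep n f b) (extChartAt (𝓡 n) b x) := by
  have hx := mem_extChartAt_source (I := 𝓡 n) x
  have h1 := contDiffAt_coordChange (n := n) hb hx
  refine ContDiffAt.congr_of_eventuallyEq ?_ (localRep_eventuallyEq (f := f) hb hx)
  refine ContDiffAt.comp _ ?_ h1
  simp only [Function.comp_apply]
  rw [(extChartAt (𝓡 n) b).left_inv hb]
  exact contDiffAt_localRep h

theorem osc_localRep_le (ha : x ∈ (extChartAt (𝓡 n) a).source)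
    (hb : x ∈ (extChartAt (𝓡 n) b).source) (h : ContMDiffAt (𝓡 n) 𝓘(ℝ, Euc N) ∞ f x) (j : ℕ) :
    osc (localRep n f a) (extChartAt (𝓡 n) a x) j ≤
      osc (localRep n f b) (extChartAt (𝓡 n) b x) j := by
  rw [osc_congr (localRep_eventuallyEq (f := f) ha hb)]
  have e : (extChartAt (𝓡 n) b ∘ (extChartAt (𝓡 n) a).symm) (extChartAt (𝓡 n) a x) =
      extChartAt (𝓡 n) b x := by
    simp only [Function.comp_apply]
    rw [(extChartAt (𝓡 n) a).left_inv ha]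
  refine (osc_comp_le ?_ (contDiffAt_coordChange ha hb)).trans_eq (by rw [e])
  rw [e]
  exact contDiffAt_localRep' hb h

theorem oscAt_eq (hb : x ∈ (extChartAt (𝓡 n) b).source)
    (h : ContMDiffAt (𝓡 n) 𝓘(ℝ, Euc N) ∞ f x) (j : ℕ) :
    oscAt n f x j = osc (localRep n f b) (extChartAt (𝓡 n) b x) j :=
  le_antisymm (osc_localRep_le (mem_extChartAt_source x) hb h j)
    (osc_localRep_le hb (mem_extChartAt_source x) h j)

/-- The chain rule leaves the extra term dH(D²ψ(X, Y)), which is tangential; the second derivative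
is therefore tensorial modulo the tangent space. -/
theorem fderiv_fderiv_comp_sub_mem {E E' F : Type*} [NormedAddCommGroup E] [NormedSpace ℝ E]
    [NormedAddCommGroup E'] [NormedSpace ℝ E'] [NormedAddCommGroup F] [NormedSpace ℝ F]
    {H : E → F} {ψ : E' → E} {u : E'} (hH : ContDiffAt ℝ ∞ H (ψ u)) (hψ : ContDiffAt ℝ ∞ ψ u)
    (X Y : E') :
    fderiv ℝ (fderiv ℝ (H ∘ ψ)) u X Y -
      fderiv ℝ (fderiv ℝ H) (ψ u) (fderiv ℝ ψ u X) (fderiv ℝ ψ u Y) ∈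
        LinearMap.range (fderiv ℝ H (ψ u)).toLinearMap := by
  have h1 : fderiv ℝ (H ∘ ψ) =ᶠ[𝓝 u] fun y => (fderiv ℝ H (ψ y)).comp (fderiv ℝ ψ y) := by
    filter_upwards [hψ.eventually_differentiableAt,
      hψ.continuousAt.eventually hH.eventually_differentiableAt] with y hy hy'
    exact fderiv_comp y hy' hy
  have d1 : DifferentiableAt ℝ (fderiv ℝ ψ) u := hψ.fderiv_infty.differentiableAt (by simp)
  have d2 : DifferentiableAt ℝ (fun y => fderiv ℝ H (ψ y)) u :=
    (hH.fderiv_infty.differentiableAt (by simp)).comp u (hψ.differentiableAt (by simp))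
  have d3 : fderiv ℝ (fun y => fderiv ℝ H (ψ y)) u =
      (fderiv ℝ (fderiv ℝ H) (ψ u)).comp (fderiv ℝ ψ u) :=
    fderiv_comp u (hH.fderiv_infty.differentiableAt (by simp)) (hψ.differentiableAt (by simp))
  rw [h1.fderiv_eq, fderiv_clm_comp d2 d1, d3]
  refine ⟨fderiv ℝ (fderiv ℝ ψ) u X Y, ?_⟩
  simp

end ChartChange

/-! ### The elliptic condition in a fixed chart -/

section Elliptic

variable {N : ℕ} {L : Type*} [TopologicalSpace L] [ChartedSpace (Euc 2) L]
  [IsManifold (𝓡 2) ∞ L] {g : L → Euc N}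

theorem IsElliptic.contMDiffAt (hg : IsElliptic g) (x : L) :
    ContMDiffAt (𝓡 2) 𝓘(ℝ, Euc N) ∞ g x :=
  (hg.1.1 x (Set.mem_univ x)).contMDiffAt Filter.univ_mem

theorem IsElliptic.mdifferentiableAt (hg : IsElliptic g) (x : L) :
    MDifferentiableAt (𝓡 2) 𝓘(ℝ, Euc N) g x :=
  (hg.contMDiffAt x).mdifferentiableAt (by simp)

theorem IsElliptic.injective (hg : IsElliptic g) (x : L) : Function.Injective (diff 2 g x) :=
  hg.1.2 x (Set.mem_univ x)

/-- The complex structure and the elliptic equation in the preferred chart at `x₀`. -/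
theorem IsElliptic.exists_coord_complexStructure (hg : IsElliptic g) (x₀ : L) :
    ∃ J : Euc 2 → Euc 2 →L[ℝ] Euc 2,
      ContDiffAt ℝ ∞ J (extChartAt (𝓡 2) x₀ x₀) ∧
      ∀ᶠ u in 𝓝 (extChartAt (𝓡 2) x₀ x₀), (∀ Z, J u (J u Z) = -Z) ∧
        ∀ Z, fderiv ℝ (fderiv ℝ (localRep 2 g x₀)) u Z Z +
          fderiv ℝ (fderiv ℝ (localRep 2 g x₀)) u (J u Z) (J u Z) ∈
            osc (localRep 2 g x₀) u 1 := by
  obtain ⟨J, ⟨hJ, hJs⟩, hα⟩ := hg.2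
  refine ⟨inTangentCoordinates (𝓡 2) (𝓡 2) id id J x₀ ∘ (extChartAt (𝓡 2) x₀).symm,
    contDiffAt_comp_extChartAt_symm (hJs x₀), ?_⟩
  filter_upwards [extChartAt_target_mem_nhds (I := 𝓡 2) x₀] with u hu
  set x := (extChartAt (𝓡 2) x₀).symm u with hx
  have hxs : x ∈ (extChartAt (𝓡 2) x₀).source := (extChartAt (𝓡 2) x₀).map_target hu
  have hxs' : x ∈ (chartAt (Euc 2) x₀).source := by rwa [extChartAt_source] at hxs
  have hxx := mem_extChartAt_source (I := 𝓡 2) x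
  have hux : extChartAt (𝓡 2) x₀ x = u := (extChartAt (𝓡 2) x₀).right_inv hu
  have h1 : ∀ Z, tangentCoordChange (𝓡 2) x₀ x x (tangentCoordChange (𝓡 2) x x₀ x Z) = Z := by
    intro Z
    rw [tangentCoordChange_comp ⟨⟨hxx, hxs⟩, hxx⟩, tangentCoordChange_self hxx]
  have h2 : ∀ Z, tangentCoordChange (𝓡 2) x x₀ x (tangentCoordChange (𝓡 2) x₀ x x Z) = Z := by
    intro Z
    rw [tangentCoordChange_comp ⟨⟨hxs, hxx⟩, hxs⟩, tangentCoordChange_self hxs]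
  -- In the preferred chart at `x` the tangent space is the plane, so `J x` becomes a plain
  -- endomorphism `K`. In the chart at `x₀` it reads Q K P, with P and Q the mutually inverse
  -- coordinate changes.
  obtain ⟨K, hJK, hK, hKα⟩ : ∃ K : Euc 2 →L[ℝ] Euc 2,
      inTangentCoordinates (𝓡 2) (𝓡 2) id id J x₀ x =
        (tangentCoordChange (𝓡 2) x x₀ x).comp (K.comp (tangentCoordChange (𝓡 2) x₀ x x)) ∧
      (∀ Z, K (K Z) = -Z) ∧
      ∀ Z, coordSecondForm (localRep 2 g x) (extChartAt (𝓡 2) x x) Z Z +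
        coordSecondForm (localRep 2 g x) (extChartAt (𝓡 2) x x) (K Z) (K Z) = 0 :=
    ⟨J x, inTangentCoordinates_eq (I := 𝓡 2) (I' := 𝓡 2) (M := L) (M' := L) id id J hxs' hxs',
      hJ x, hα x⟩
  set P := tangentCoordChange (𝓡 2) x₀ x x with hP
  set Q := tangentCoordChange (𝓡 2) x x₀ x with hQ
  simp only [Function.comp_apply, ← hx, hJK, ContinuousLinearMap.comp_apply, h1]
  refine ⟨fun Z => by rw [hK, map_neg, h2], fun Z => ?_⟩
  set ψ := extChartAt (𝓡 2) x ∘ (extChartAt (𝓡 2) x₀).symm with hψ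
  have hψu : ψ u = extChartAt (𝓡 2) x x := by simp [hψ, hx]
  have hψs : ContDiffAt ℝ ∞ ψ u := by
    have := contDiffAt_coordChange (n := 2) hxs hxx
    rwa [hux] at this
  have hPψ : fderiv ℝ ψ u = P := by
    rw [hP, tangentCoordChange_def, ModelWithCorners.range_eq_univ, fderivWithin_univ, hux]
  have hGx : ContDiffAt ℝ ∞ (localRep 2 g x) (ψ u) := by
    rw [hψu]
    exact contDiffAt_localRep (hg.contMDiffAt x)
  have hcongr : localRep 2 g x₀ =ᶠ[𝓝 u] localRep 2 g x ∘ ψ := by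
    have := localRep_eventuallyEq (f := g) (n := 2) hxs hxx
    rwa [hux] at this
  have hosc : osc (localRep 2 g x₀) u 1 =
      LinearMap.range (fderiv ℝ (localRep 2 g x) (ψ u)).toLinearMap := by
    rw [← osc_one, hψu, ← hux, ← oscAt_eq hxs (hg.contMDiffAt x), oscAt]
  have hd : fderiv ℝ (fderiv ℝ (localRep 2 g x₀)) u =
      fderiv ℝ (fderiv ℝ (localRep 2 g x ∘ ψ)) u := hcongr.fderiv.fderiv_eq
  rw [hosc, hd]
  have k1 := fderiv_fderiv_comp_sub_mem hGx hψs Z Z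
  have k2 := fderiv_fderiv_comp_sub_mem hGx hψs (Q (K (P Z))) (Q (K (P Z)))
  rw [hPψ] at k1 k2
  rw [h1] at k2
  have k3 := hKα (P Z)
  have k4 : fderiv ℝ (fderiv ℝ (localRep 2 g x)) (ψ u) (P Z) (P Z) +
      fderiv ℝ (fderiv ℝ (localRep 2 g x)) (ψ u) (K (P Z)) (K (P Z)) ∈
        LinearMap.range (fderiv ℝ (localRep 2 g x) (ψ u)).toLinearMap := by
    simp only [coordSecondForm, coordNormalProj] at k3
    rw [← map_add, Submodule.starProjection_apply_eq_zero_iff,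
      Submodule.orthogonal_orthogonal, ← hψu] at k3
    exact k3
  have := add_mem (add_mem k1 k2) k4
  convert this using 1
  abel

end Elliptic

/-! ### The elliptic equation with real coefficients -/

section EllipticCoefficients

variable {N : ℕ} {G : Euc 2 → Euc N} {u : Euc 2}

/-- The first coordinate vector. -/
abbrev e₀ : Euc 2 := EuclideanSpace.single 0 1

/-- The second coordinate vector. -/
abbrev e₁ : Euc 2 := EuclideanSpace.single 1 1

theorem euc_two_eq (X : Euc 2) : X = X 0 • e₀ + X 1 • e₁ := by
  ext i
  fin_cases i <;> simp

theorem eventually_isSymmSndFDerivAt {E F : Type*} [NormedAddCommGroup E] [NormedSpace ℝ E]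
    [NormedAddCommGroup F] [NormedSpace ℝ F] {s : E → F} {u : E} (hs : ContDiffAt ℝ ∞ s u) :
    ∀ᶠ x in 𝓝 u, IsSymmSndFDerivAt ℝ s x := by
  have h := (hs.of_le (m := 2) (WithTop.coe_le_coe.2 le_top :
    ((2 : ℕ∞) : ℕ∞ω) ≤ ((⊤ : ℕ∞) : ℕ∞ω))).eventually (by simp)
  filter_upwards [h] with x hx
  exact hx.isSymmSndFDerivAt (by simp)

/-- In coordinates `G` solves an elliptic equation `G₁₁ + A G₀₀ + B G₀₁ ≡ 0` modulo first order
terms. -/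
def IsEllipticWith (G : Euc 2 → Euc N) (u : Euc 2) (A B : Euc 2 → ℝ) : Prop :=
  ContDiffAt ℝ ∞ A u ∧ ContDiffAt ℝ ∞ B u ∧ B u ^ 2 < 4 * A u ∧
    (fun x => fderiv ℝ (fderiv ℝ G) x e₁ e₁ + A x • fderiv ℝ (fderiv ℝ G) x e₀ e₀ +
      B x • fderiv ℝ (fderiv ℝ G) x e₀ e₁) ∈ jetSec G u 1

/-- Put J e₀ = p e₀ + q e₁. Here q ≠ 0, because J² = −1 has no real eigenvector. The condition on
the single vector e₀, divided by q², is the equation with A = (1 + p²)/q² and B = 2p/q, whence 4A −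
B² = 4/q² > 0. -/
theorem exists_isEllipticWith (hG : ContDiffAt ℝ ∞ G u) (hi : Function.Injective (fderiv ℝ G u))
    {J : Euc 2 → Euc 2 →L[ℝ] Euc 2} (hJ : ContDiffAt ℝ ∞ J u)
    (h : ∀ᶠ x in 𝓝 u, (∀ Z, J x (J x Z) = -Z) ∧
        ∀ Z, fderiv ℝ (fderiv ℝ G) x Z Z + fderiv ℝ (fderiv ℝ G) x (J x Z) (J x Z) ∈ osc G x 1) :
    ∃ A B, IsEllipticWith G u A B := by
  have hq : ∀ x, (∀ Z, J x (J x Z) = -Z) → J x e₀ 1 ≠ 0 := by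
    intro x hx h0
    have h1 := hx e₀
    have h2 : J x e₀ = J x e₀ 0 • e₀ := by
      conv_lhs => rw [euc_two_eq (J x e₀), h0]
      simp
    rw [h2, map_smul, h2] at h1
    have h3 := congrArg (fun v : Euc 2 => v 0) h1
    simp at h3
    nlinarith [mul_self_nonneg ((J x e₀) 0)]
  have hJe : ∀ i, ContDiffAt ℝ ∞ (fun x => J x e₀ i) u := fun i =>
    (EuclideanSpace.proj (𝕜 := ℝ) i).contDiff.contDiffAt.comp u (hJ.clm_apply contDiffAt_const)
  have hqu := hq u h.self_of_nhds.1
  have hA : ContDiffAt ℝ ∞ (fun x => (1 + J x e₀ 0 ^ 2) / J x e₀ 1 ^ 2) u :=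
    (contDiffAt_const.add ((hJe 0).pow 2)).div ((hJe 1).pow 2) (pow_ne_zero 2 hqu)
  have hB : ContDiffAt ℝ ∞ (fun x => 2 * J x e₀ 0 / J x e₀ 1) u :=
    (contDiffAt_const.mul (hJe 0)).div (hJe 1) hqu
  refine ⟨_, _, hA, hB, ?_, ?_⟩
  · have : 0 < J u e₀ 1 ^ 2 := by positivity
    have e : 4 * ((1 + J u e₀ 0 ^ 2) / J u e₀ 1 ^ 2) - (2 * J u e₀ 0 / J u e₀ 1) ^ 2
        = 4 / J u e₀ 1 ^ 2 := by
      field_simp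
      ring
    have : 0 < 4 / J u e₀ 1 ^ 2 := by positivity
    linarith
  · have hd := hG.fderiv_infty.fderiv_infty
    refine mem_jetSec_of_mem_span hG
      (v := fun i x => fderiv ℝ G x (EuclideanSpace.basisFun (Fin 2) ℝ i))
      (fun i => fderiv_self_mem_jetSec _) (linearIndependent_fderiv hi) ?_ ?_
    · have hc : ∀ a b : Euc 2, ContDiffAt ℝ ∞ (fun x => fderiv ℝ (fderiv ℝ G) x a b) u :=
        fun a b => (hd.clm_apply contDiffAt_const).clm_apply contDiffAt_const
      exact ((hc _ _).add (hA.smul (hc _ _))).add (hB.smul (hc _ _))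
    · filter_upwards [h, eventually_isSymmSndFDerivAt hG] with x hx hsymm
      rw [← range_fderiv_eq_span, ← osc_one]
      have h1 := hx.2 e₀
      have hqx := hq x hx.1
      set p := J x e₀ 0 with hp
      set q := J x e₀ 1 with hq'
      have h2 : J x e₀ = p • e₀ + q • e₁ := euc_two_eq _
      have h3 := Submodule.smul_mem _ (q ^ 2)⁻¹ h1
      convert h3 using 1
      rw [h2]
      simp only [map_add, map_smul, add_apply, smul_apply, smul_add, smul_smul]
      rw [hsymm e₁ e₀]
      match_scalars <;> field_simp
      ring

end EllipticCoefficients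

/-! ### Osculating bundles of constant rank -/

section ConstantRank

variable {E F : Type*} [NormedAddCommGroup E] [NormedSpace ℝ E]
  [NormedAddCommGroup F] [InnerProductSpace ℝ F] [FiniteDimensional ℝ F]
  {G : E → F} {u : E} {j : ℕ}

theorem eventually_osc_eq_span {ι : Type*} [Fintype ι] (hG : ContDiffAt ℝ ∞ G u) {v : ι → E → F}
    (hv : ∀ i, v i ∈ jetSec G u j) (hi : LinearIndependent ℝ fun i => v i u)
    (hr : ∀ᶠ x in 𝓝 u, Module.finrank ℝ (osc G x j) = Fintype.card ι) :
    ∀ᶠ x in 𝓝 u, osc G x j = Submodule.span ℝ (Set.range fun i => v i x) := by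
  filter_upwards [hr, eventually_linearIndependent
    (fun i => (contDiffAt_of_mem_jetSec hG (hv i)).continuousAt) hi,
    Filter.eventually_all.2 fun i => eventually_mem_osc (hv i)] with x h1 h2 h3
  symm
  refine Submodule.eq_of_le_of_finrank_eq (Submodule.span_le.2 ?_) ?_
  · rintro _ ⟨i, rfl⟩
    exact h3 i
  · rw [finrank_span_eq_card h2, h1]

theorem exists_sections_basis (G : E → F) (u : E) (j : ℕ) :
    ∃ v : Fin (Module.finrank ℝ (osc G u j)) → E → F, (∀ i, v i ∈ jetSec G u j) ∧
      LinearIndependent ℝ fun i => v i u := by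
  let b := Module.finBasis ℝ (osc G u j)
  choose v hv hvu using fun i => exists_mem_jetSec (b i).2
  refine ⟨v, hv, ?_⟩
  simp only [hvu]
  exact b.linearIndependent.map' (osc G u j).subtype (Submodule.ker_subtype _)

/-- If the osculating spaces of order `j` have constant dimension near `u`, they form a smooth
subbundle. -/
theorem contDiffAt_starProjection_osc (hG : ContDiffAt ℝ ∞ G u)
    (hr : ∀ᶠ x in 𝓝 u, Module.finrank ℝ (osc G x j) = Module.finrank ℝ (osc G u j)) :
    ContDiffAt ℝ ∞ (fun x => (osc G x j).starProjection) u := by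
  obtain ⟨v, hv, hi⟩ := exists_sections_basis G u j
  exact contDiffAt_starProjection_span (fun i => contDiffAt_of_mem_jetSec hG (hv i)) hi
    (eventually_osc_eq_span hG hv hi (by simpa using hr))

theorem mem_jetSec_of_eventually_mem_osc (hG : ContDiffAt ℝ ∞ G u)
    (hr : ∀ᶠ x in 𝓝 u, Module.finrank ℝ (osc G x j) = Module.finrank ℝ (osc G u j))
    {s : E → F} (hs : ContDiffAt ℝ ∞ s u) (hmem : ∀ᶠ x in 𝓝 u, s x ∈ osc G x j) :
    s ∈ jetSec G u j := by
  obtain ⟨v, hv, hi⟩ := exists_sections_basis G u j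
  refine mem_jetSec_of_mem_span hG hv hi hs ?_
  filter_upwards [hmem, eventually_osc_eq_span hG hv hi (by simpa using hr)] with x h1 h2
  rwa [← h2]

/-- If the osculating space grows only by one dimension, any two sections of the larger one
satisfy a nontrivial relation modulo the smaller one. -/
theorem exists_relation (hG : ContDiffAt ℝ ∞ G u) {k : ℕ} (hjk : j ≤ k)
    (hr : ∀ᶠ x in 𝓝 u, Module.finrank ℝ (osc G x k) = Module.finrank ℝ (osc G u j) + 1)
    {a b : E → F} (ha : a ∈ jetSec G u k) (hb : b ∈ jetSec G u k)
    (hab : osc G u k = osc G u j ⊔ Submodule.span ℝ {a u, b u}) :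
    ∃ p q : E → ℝ, ContDiffAt ℝ ∞ p u ∧ ContDiffAt ℝ ∞ q u ∧ (p u ≠ 0 ∨ q u ≠ 0) ∧
      (fun x => p x • a x + q x • b x) ∈ jetSec G u j := by
  obtain ⟨v, hv, hi⟩ := exists_sections_basis G u j
  have hsp : Submodule.span ℝ (Set.range fun i => v i u) = osc G u j := by
    refine Submodule.eq_of_le_of_finrank_eq (Submodule.span_le.2 ?_) ?_
    · rintro _ ⟨i, rfl⟩
      exact mem_osc_of_mem_jetSec (hv i)
    · rw [finrank_span_eq_card hi, Fintype.card_fin]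
  -- If `a u` lies outside the smaller space, then `a` together with a basis of it is a frame of the
  -- larger one, by the rank hypothesis. Expanding `b` in this frame, minus the coefficient of `a`
  -- is the sought `p`. The case where neither `a u` nor `b u` lies outside contradicts the growth
  -- of the rank.
  have key : ∀ a b : E → F, a ∈ jetSec G u k → b ∈ jetSec G u k → a u ∉ osc G u j →
      ∃ p : E → ℝ, ContDiffAt ℝ ∞ p u ∧ (fun x => p x • a x + b x) ∈ jetSec G u j := by
    intro a b ha hb hau
    let w : Option (Fin (Module.finrank ℝ (osc G u j))) → E → F := fun o => o.elim a v
    have hw : ∀ o, w o ∈ jetSec G u k := fun o => by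
      cases o with
      | none => exact ha
      | some i => exact jetSec_mono hjk (hv i)
    have hwi : LinearIndependent ℝ fun o => w o u := by
      rw [linearIndependent_option]
      refine ⟨hi, ?_⟩
      change a u ∉ Submodule.span ℝ (Set.range fun i => v i u)
      rwa [hsp]
    have hev := eventually_osc_eq_span hG hw hwi (by simpa using hr)
    obtain ⟨c, hc, hbc⟩ := exists_smooth_coeff (fun i => contDiffAt_of_mem_jetSec hG (hw i)) hwi
      (contDiffAt_of_mem_jetSec hG hb) (by
        filter_upwards [hev, eventually_mem_osc hb] with x h1 h2
        rwa [← h1])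
    refine ⟨fun x => -c none x, (hc none).neg, ?_⟩
    refine jetSec_congr (jetSec_sum (A := Finset.univ) (fun i _ => hc (some i)) fun i _ => hv i) ?_
    filter_upwards [hbc] with x hx
    rw [hx, Fintype.sum_option]
    simp [w]
  by_cases hau : a u ∈ osc G u j
  · by_cases hbu : b u ∈ osc G u j
    · have h1 : osc G u k = osc G u j := by
        rw [hab, sup_eq_left, Submodule.span_le]
        rintro w (rfl | rfl)
        exacts [hau, hbu]
      have h2 := hr.self_of_nhds
      rw [h1] at h2
      omega
    · obtain ⟨p, hp, h⟩ := key b a hb ha hbu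
      refine ⟨fun _ => 1, p, contDiffAt_const, hp, Or.inl one_ne_zero, ?_⟩
      convert h using 2 with x
      simp [add_comm]
  · obtain ⟨p, hp, h⟩ := key a b ha hb hau
    refine ⟨p, fun _ => 1, hp, contDiffAt_const, Or.inr one_ne_zero, ?_⟩
    simpa using h

end ConstantRank

/-- This is the norm p² − bpq + aq² of p + qθ, where θ² + bθ + a = 0; it is positive definite as the
discriminant is negative. -/
theorem elliptic_det_ne_zero {a b p q : ℝ} (h : b ^ 2 < 4 * a) (h0 : p ≠ 0 ∨ q ≠ 0) :
    p * (p - b * q) + a * q ^ 2 ≠ 0 := by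
  rcases eq_or_ne q 0 with h2 | h2
  · have h3 : p ≠ 0 := by simpa [h2] using h0
    simpa [h2] using h3
  · have h3 : 0 < q ^ 2 := by positivity
    nlinarith [sq_nonneg (p - b * q / 2), mul_pos h3 (sub_pos.2 h)]

/-- Cramer's rule: the two given combinations encode p + qθ and θ(p + qθ), which are independent
over ℝ. -/
theorem mem_of_elliptic {F : Type*} [AddCommGroup F] [Module ℝ F] {S : Submodule ℝ F} {v w : F}
    {a b p q : ℝ} (h : b ^ 2 < 4 * a) (h0 : p ≠ 0 ∨ q ≠ 0) (k0 : p • v + q • w ∈ S)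
    (k1 : (-(a * q)) • v + (p - b * q) • w ∈ S) : v ∈ S ∧ w ∈ S := by
  have hdet := elliptic_det_ne_zero h h0
  constructor
  · have := sub_mem (Submodule.smul_mem _ (p - b * q) k0) (Submodule.smul_mem _ q k1)
    refine (Submodule.smul_mem_iff _ hdet).1 ?_
    convert this using 1
    module
  · have := add_mem (Submodule.smul_mem _ (a * q) k0) (Submodule.smul_mem _ p k1)
    refine (Submodule.smul_mem_iff _ hdet).1 ?_
    convert this using 1
    module

/-! ### Leading terms and their multiplication rule -/

section EllipticFrame

variable {N : ℕ}

/-- The functions `∂₀ⁱ ∂_c G`, for `i ≥ 0` and `c = 0, 1`. -/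
def frame (G : Euc 2 → Euc N) : ℕ → Fin 2 → Euc 2 → Euc N
  | 0, c => fun x => fderiv ℝ G x (EuclideanSpace.single c 1)
  | i + 1, c => fun x => fderiv ℝ (frame G i c) x e₀

/-- `s ≡ p ∂₀ʲ∂₀G + q ∂₀ʲ∂₁G` modulo derivatives of order at most `j`. -/
def Lead (G : Euc 2 → Euc N) (u : Euc 2) (j : ℕ) (s : Euc 2 → Euc N) (p q : Euc 2 → ℝ) : Prop :=
  ContDiffAt ℝ ∞ p u ∧ ContDiffAt ℝ ∞ q u ∧
    s - (fun x => p x • frame G j 0 x + q x • frame G j 1 x) ∈ jetSec G u j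

variable {G : Euc 2 → Euc N} {u : Euc 2} {A B : Euc 2 → ℝ} {i j k : ℕ} {s : Euc 2 → Euc N}
  {p q : Euc 2 → ℝ}

theorem frame_mem_jetSec (hG : ContDiffAt ℝ ∞ G u) (i : ℕ) (c : Fin 2) :
    frame G i c ∈ jetSec G u (i + 1) := by
  induction i with
  | zero => exact fderiv_self_mem_jetSec _
  | succ i ih => exact fderiv_mem_jetSec hG ih _

theorem contDiffAt_frame (hG : ContDiffAt ℝ ∞ G u) (i : ℕ) (c : Fin 2) :
    ContDiffAt ℝ ∞ (frame G i c) u :=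
  contDiffAt_of_mem_jetSec hG (frame_mem_jetSec hG i c)

theorem fderiv_fderiv_swap {E F : Type*} [NormedAddCommGroup E] [NormedSpace ℝ E]
    [NormedAddCommGroup F] [NormedSpace ℝ F] {s : E → F} {u : E} (hs : ContDiffAt ℝ ∞ s u)
    (X Y : E) :
    (fun x => fderiv ℝ (fun y => fderiv ℝ s y X) x Y) =ᶠ[𝓝 u]
      fun x => fderiv ℝ (fun y => fderiv ℝ s y Y) x X := by
  filter_upwards [eventually_isSymmSndFDerivAt hs,
    hs.fderiv_infty.eventually_differentiableAt] with x h1 h2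
  rw [fderiv_clm_apply h2 (differentiableAt_const _), fderiv_clm_apply h2 (differentiableAt_const _)]
  simpa using h1 Y X

theorem fderiv_frame_zero (hG : ContDiffAt ℝ ∞ G u) (i : ℕ) :
    (fun x => fderiv ℝ (frame G i 0) x e₁) =ᶠ[𝓝 u] frame G (i + 1) 1 := by
  induction i with
  | zero => exact fderiv_fderiv_swap hG _ _
  | succ i ih =>
    refine (fderiv_fderiv_swap (contDiffAt_frame hG i 0) _ _).trans ?_
    filter_upwards [ih.fderiv (𝕜 := ℝ)] with x hx
    rw [hx]
    rfl

/-- The elliptic equation is differentiated repeatedly along e₀. The terms in which A or B is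
differentiated involve one derivative of `G` less and are absorbed. -/
theorem fderiv_frame_one (hG : ContDiffAt ℝ ∞ G u) (he : IsEllipticWith G u A B) (i : ℕ) :
    (fun x => fderiv ℝ (frame G i 1) x e₁ + A x • frame G (i + 1) 0 x +
      B x • frame G (i + 1) 1 x) ∈ jetSec G u (i + 1) := by
  induction i with
  | zero =>
    refine jetSec_congr he.2.2.2 ?_
    filter_upwards [hG.fderiv_infty.eventually_differentiableAt] with x h2
    simp only [frame]
    rw [fderiv_clm_apply h2 (differentiableAt_const _),
      fderiv_clm_apply h2 (differentiableAt_const _)]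
    simp
  | succ i ih =>
    have hA := he.1
    have hB := he.2.1
    have ha := contDiffAt_frame hG (i + 1) 0
    have hb := contDiffAt_frame hG (i + 1) 1
    have hb' : ContDiffAt ℝ ∞ (fun x => fderiv ℝ (frame G i 1) x e₁) u :=
      (contDiffAt_frame hG i 1).fderiv_infty.clm_apply contDiffAt_const
    have h1 := fderiv_mem_jetSec hG ih e₀
    have h2 : (fun x => fderiv ℝ A x e₀ • frame G (i + 1) 0 x) ∈ jetSec G u (i + 2) :=
      jetSec_smul (hA.fderiv_infty.clm_apply contDiffAt_const) (frame_mem_jetSec hG _ _)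
    have h3 : (fun x => fderiv ℝ B x e₀ • frame G (i + 1) 1 x) ∈ jetSec G u (i + 2) :=
      jetSec_smul (hB.fderiv_infty.clm_apply contDiffAt_const) (frame_mem_jetSec hG _ _)
    refine jetSec_congr (sub_mem (sub_mem h1 h2) h3) ?_
    filter_upwards [fderiv_fderiv_swap (contDiffAt_frame hG i 1) e₀ e₁,
      hA.eventually_differentiableAt, hB.eventually_differentiableAt,
      ha.eventually_differentiableAt, hb.eventually_differentiableAt,
      hb'.eventually_differentiableAt] with x h4 dA dB da db db'
    have h5 : HasFDerivAt (fun x => fderiv ℝ (frame G i 1) x e₁ + A x • frame G (i + 1) 0 x +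
      B x • frame G (i + 1) 1 x) _ x :=
      (db'.hasFDerivAt.add (dA.hasFDerivAt.smul da.hasFDerivAt)).add
        (dB.hasFDerivAt.smul db.hasFDerivAt)
    have h6 : fderiv ℝ (frame G (i + 1) 1) x e₁ =
      fderiv ℝ (fun x => fderiv ℝ (frame G i 1) x e₁) x e₀ := h4
    simp only [Pi.sub_apply, h5.fderiv, h6]
    simp only [add_apply, smul_apply, ContinuousLinearMap.smulRight_apply]
    simp only [frame]
    abel

theorem Lead.contDiffAt (hG : ContDiffAt ℝ ∞ G u) (h : Lead G u j s p q) :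
    ContDiffAt ℝ ∞ s u := by
  have h1 := (contDiffAt_of_mem_jetSec hG h.2.2).add
    ((h.1.smul (contDiffAt_frame hG j 0)).add (h.2.1.smul (contDiffAt_frame hG j 1)))
  convert h1 using 1
  ext1 x
  simp

theorem Lead.congr {t : Euc 2 → Euc N} (h : Lead G u j s p q) (hst : t =ᶠ[𝓝 u] s) :
    Lead G u j t p q := by
  refine ⟨h.1, h.2.1, jetSec_congr h.2.2 ?_⟩
  filter_upwards [hst] with x hx
  simp [hx]

theorem Lead.add_jetSec {γ : Euc 2 → Euc N} (h : Lead G u j s p q) (hγ : γ ∈ jetSec G u j) :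
    Lead G u j (s + γ) p q := by
  refine ⟨h.1, h.2.1, ?_⟩
  convert add_mem h.2.2 hγ using 1
  abel

/-- With (p, q) read as p + qθ and θ² + Bθ + A = 0, the new coefficients are those of (X₀ + X₁θ)(p +
qθ): ∂₀ keeps the pair, and ∂₁ sends it to (−Aq, p − Bq) by the elliptic equation. -/
theorem Lead.fderiv (hG : ContDiffAt ℝ ∞ G u) (he : IsEllipticWith G u A B)
    (h : Lead G u j s p q) (X : Euc 2) :
    Lead G u (j + 1) (fun x => fderiv ℝ s x X)
      (fun x => X 0 * p x - X 1 * (A x * q x))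
      (fun x => X 0 * q x + X 1 * (p x - B x * q x)) := by
  obtain ⟨hp, hq, hs⟩ := id h
  have hA := he.1
  have hB := he.2.1
  have hss := h.contDiffAt hG
  refine ⟨(contDiffAt_const.mul hp).sub (contDiffAt_const.mul (hA.mul hq)),
    (contDiffAt_const.mul hq).add (contDiffAt_const.mul (hp.sub (hB.mul hq))), ?_⟩
  have ha := contDiffAt_frame hG j 0
  have hb := contDiffAt_frame hG j 1
  have h1 := fderiv_mem_jetSec hG hs X
  have h2 : (fun x => _root_.fderiv ℝ p x X • frame G j 0 x) ∈ jetSec G u (j + 1) :=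
    jetSec_smul (hp.fderiv_infty.clm_apply contDiffAt_const) (frame_mem_jetSec hG _ _)
  have h3 : (fun x => _root_.fderiv ℝ q x X • frame G j 1 x) ∈ jetSec G u (j + 1) :=
    jetSec_smul (hq.fderiv_infty.clm_apply contDiffAt_const) (frame_mem_jetSec hG _ _)
  have h4 := jetSec_smul (contDiffAt_const.mul hq : ContDiffAt ℝ ∞ (fun x => X 1 * q x) u)
    (fderiv_frame_one hG he j)
  refine jetSec_congr (add_mem (add_mem (add_mem h1 h2) h3) h4) ?_
  filter_upwards [hp.eventually_differentiableAt, hq.eventually_differentiableAt,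
    ha.eventually_differentiableAt, hb.eventually_differentiableAt,
    hss.eventually_differentiableAt, fderiv_frame_zero hG j] with x dp dq da db ds h5
  have h6 : HasFDerivAt (s - fun x => p x • frame G j 0 x + q x • frame G j 1 x) _ x :=
    ds.hasFDerivAt.sub ((dp.hasFDerivAt.smul da.hasFDerivAt).add
        (dq.hasFDerivAt.smul db.hasFDerivAt))
  have h7 : ∀ c, _root_.fderiv ℝ (frame G j c) x X =
      X 0 • frame G (j + 1) c x + X 1 • _root_.fderiv ℝ (frame G j c) x e₁ := by
    intro c
    conv_lhs => rw [euc_two_eq X]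
    rw [map_add, map_smul, map_smul]
    rfl
  simp only [Pi.sub_apply, Pi.add_apply, h6.fderiv]
  simp only [add_apply, sub_apply, smul_apply, ContinuousLinearMap.smulRight_apply, h7]
  rw [h5]
  module

theorem exists_lead_iteratedFDeriv (hG : ContDiffAt ℝ ∞ G u) (he : IsEllipticWith G u A B)
    (v : Fin (j + 1) → Euc 2) :
    ∃ p q, Lead G u j (fun x => iteratedFDeriv ℝ (j + 1) G x v) p q := by
  induction j with
  | zero =>
    refine ⟨fun _ => v 0 0, fun _ => v 0 1, contDiffAt_const, contDiffAt_const, ?_⟩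
    convert zero_mem (jetSec G u 0) using 1
    ext1 x
    have h1 : iteratedFDeriv ℝ (0 + 1) G x v = _root_.fderiv ℝ G x (v 0) :=
      iteratedFDeriv_one_apply v
    have h2 := congrArg (_root_.fderiv ℝ G x) (euc_two_eq (v 0))
    rw [map_add, map_smul, map_smul] at h2
    simp only [frame, Pi.sub_apply, Pi.zero_apply]
    rw [h1, h2, sub_self]
  | succ j ih =>
    obtain ⟨p, q, h⟩ := ih (Fin.tail v)
    refine ⟨_, _, (h.fderiv hG he (v 0)).congr ?_⟩
    filter_upwards [(contDiffAt_iteratedFDeriv hG (j + 1)).eventually_differentiableAt] with x hx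
    rw [fderiv_iteratedFDeriv_apply hx, Fin.cons_self_tail]

/-- Every ∂₁ beyond the first can be traded for ∂₀, so two leading terms per order suffice;
generators of lower order receive the pair (0, 0). -/
theorem exists_lead (hG : ContDiffAt ℝ ∞ G u) (he : IsEllipticWith G u A B)
    (hs : s ∈ jetSec G u (j + 1)) : ∃ p q, Lead G u j s p q := by
  have h0 : ∀ s ∈ jetSec G u j, Lead G u j s 0 0 := fun s hs =>
    ⟨contDiffAt_const, contDiffAt_const, by
      convert hs using 1
      ext1 x
      simp⟩
  induction hs using Submodule.span_induction with
  | mem s hs =>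
    rcases hs with ⟨i, h1, h2, v, rfl⟩ | hs
    · rcases Nat.lt_or_ge i (j + 1) with h | h
      · exact ⟨_, _, h0 _ (iteratedFDeriv_mem_jetSec h1 (by omega) v)⟩
      · obtain rfl : i = j + 1 := le_antisymm h2 h
        exact exists_lead_iteratedFDeriv hG he v
    · exact ⟨_, _, h0 _ (germSpan_of_eventuallyEq_zero hs)⟩
  | zero => exact ⟨_, _, h0 _ (zero_mem _)⟩
  | add s t _ _ hs ht =>
    obtain ⟨p, q, hp, hq, h⟩ := hs
    obtain ⟨p', q', hp', hq', h'⟩ := ht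
    refine ⟨p + p', q + q', hp.add hp', hq.add hq', ?_⟩
    convert add_mem h h' using 1
    ext1 x
    simp only [Pi.sub_apply, Pi.add_apply]
    module
  | smul c s _ hs =>
    obtain ⟨p, q, hp, hq, h⟩ := hs
    have hc : ContDiffAt ℝ ∞ c.1 u := c.2
    refine ⟨c.1 * p, c.1 * q, hc.mul hp, hc.mul hq, ?_⟩
    convert jetSec_smul hc h using 1
    ext1 x
    change c.1 x • s x - _ = c.1 x • (s x - _)
    simp only [Pi.mul_apply]
    module

theorem osc_succ_eq_frame (hG : ContDiffAt ℝ ∞ G u) (he : IsEllipticWith G u A B) (j : ℕ) :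
    osc G u (j + 1) = osc G u j ⊔ Submodule.span ℝ {frame G j 0 u, frame G j 1 u} := by
  refine le_antisymm ?_ (sup_le (osc_mono (Nat.le_succ j)) (Submodule.span_le.2 ?_))
  · intro w hw
    obtain ⟨s, hs, rfl⟩ := exists_mem_jetSec hw
    obtain ⟨p, q, -, -, h⟩ := exists_lead hG he hs
    have h1 := mem_osc_of_mem_jetSec h
    have h2 : s u = (s - fun x => p x • frame G j 0 x + q x • frame G j 1 x) u +
      (p u • frame G j 0 u + q u • frame G j 1 u) := by simp
    rw [h2]
    refine Submodule.add_mem_sup h1 (add_mem ?_ ?_)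
    · exact Submodule.smul_mem _ _ (Submodule.subset_span (by simp))
    · exact Submodule.smul_mem _ _ (Submodule.subset_span (by simp))
  · rintro w (rfl | rfl)
    · exact mem_osc_of_mem_jetSec (frame_mem_jetSec hG j 0)
    · exact mem_osc_of_mem_jetSec (frame_mem_jetSec hG j 1)

theorem finrank_osc_succ_le (hG : ContDiffAt ℝ ∞ G u) (he : IsEllipticWith G u A B) (j : ℕ) :
    Module.finrank ℝ (osc G u (j + 1)) ≤ Module.finrank ℝ (osc G u j) + 2 := by
  rw [osc_succ_eq_frame hG he]
  refine (Submodule.finrank_add_le_finrank_add_finrank _ _).trans ?_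
  have h : Module.finrank ℝ (Submodule.span ℝ {frame G j 0 u, frame G j 1 u}) ≤ 2 := by
    have := finrank_span_finset_le_card (R := ℝ)
      ({frame G j 0 u, frame G j 1 u} : Finset (Euc N))
    rw [Finset.coe_pair] at this
    exact this.trans Finset.card_le_two
  omega

/-- A relation between the leading terms of order `j` kills the leading terms of the next order. -/
theorem osc_eq_of_relation (hG : ContDiffAt ℝ ∞ G u) (he : IsEllipticWith G u A B)
    (hp : ContDiffAt ℝ ∞ p u) (hq : ContDiffAt ℝ ∞ q u) (h0 : p u ≠ 0 ∨ q u ≠ 0)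
    (h : (fun x => p x • frame G j 0 x + q x • frame G j 1 x) ∈ jetSec G u j) :
    osc G u (j + 2) = osc G u (j + 1) := by
  have hL : Lead G u j (fun x => p x • frame G j 0 x + q x • frame G j 1 x) p q :=
    ⟨hp, hq, by simp⟩
  -- The derivative of the relation has order at most j + 1, yet its leading part is (X₀ + X₁θ)(p +
  -- qθ). Thus for each X that part already lies in the osculating space of order j + 1; X = e₀ and
  -- X = e₁ give two independent combinations.
  have key : ∀ X : Euc 2,
      (X 0 * p u - X 1 * (A u * q u)) • frame G (j + 1) 0 u +
        (X 0 * q u + X 1 * (p u - B u * q u)) • frame G (j + 1) 1 u ∈ osc G u (j + 1) := by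
    intro X
    have h1 := sub_mem (fderiv_mem_jetSec hG h X) (hL.fderiv hG he X).2.2
    have h2 := mem_osc_of_mem_jetSec h1
    simpa using h2
  have k0 := key e₀
  have k1 := key e₁
  simp only [PiLp.single_apply] at k0 k1
  simp only [if_true, one_mul, zero_mul, sub_zero, add_zero, zero_sub, zero_add, zero_ne_one,
    one_ne_zero, if_false] at k0 k1
  have hm := mem_of_elliptic he.2.2.1 h0 k0 k1
  rw [osc_succ_eq_frame hG he (j + 1), sup_eq_left, Submodule.span_le]
  rintro w (rfl | rfl)
  exacts [hm.1, hm.2]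

end EllipticFrame

/-! ### Maps with vanishing differential -/

section LocallyConstant

variable {n : ℕ} {M : Type*} [TopologicalSpace M] [ChartedSpace (Euc n) M]
  [IsManifold (𝓡 n) ∞ M] {V : Type*} [NormedAddCommGroup V] [NormedSpace ℝ V]

theorem eventually_eq_of_mfderiv_eq_zero {h : M → V} {x : M}
    (hh : ∀ y, MDifferentiableAt (𝓡 n) 𝓘(ℝ, V) h y)
    (h0 : ∀ y, mfderiv (𝓡 n) 𝓘(ℝ, V) h y = 0) : ∀ᶠ y in 𝓝 x, h y = h x := by
  set φ := extChartAt (𝓡 n) x with hφ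
  obtain ⟨ε, hε, hball⟩ := Metric.mem_nhds_iff.1 (extChartAt_target_mem_nhds (I := 𝓡 n) x)
  have key : ∀ u ∈ φ.target, HasFDerivAt (h ∘ φ.symm) (0 : Euc n →L[ℝ] V) u := by
    intro u hu
    have h1 : MDifferentiableAt 𝓘(ℝ, Euc n) (𝓡 n) φ.symm u :=
      ((contMDiffOn_extChartAt_symm (I := 𝓡 n) (n := ∞) x).contMDiffAt
        ((isOpen_extChartAt_target x).mem_nhds hu)).mdifferentiableAt (by simp)
    have h2 := (hh (φ.symm u)).hasMFDerivAt.comp u h1.hasMFDerivAt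
    rw [h0, ContinuousLinearMap.zero_comp] at h2
    exact h2.hasFDerivAt
  have h3 : ∀ u ∈ Metric.ball (φ x) ε, (h ∘ φ.symm) u = (h ∘ φ.symm) (φ x) := by
    intro u hu
    refine (convex_ball (φ x) ε).is_const_of_fderivWithin_eq_zero (𝕜 := ℝ)
      (fun v hv => (key v (hball hv)).differentiableAt.differentiableWithinAt) (fun v hv => ?_) hu
      (Metric.mem_ball_self hε)
    rw [fderivWithin_of_isOpen Metric.isOpen_ball hv]
    exact (key v (hball hv)).fderiv
  filter_upwards [extChartAt_source_mem_nhds (I := 𝓡 n) x,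
    (continuousAt_extChartAt (I := 𝓡 n) x).eventually_mem (Metric.ball_mem_nhds _ hε)] with y hy hy'
  have h4 := h3 _ hy'
  simp only [Function.comp_apply] at h4
  rwa [φ.left_inv hy, φ.left_inv (mem_extChartAt_source x)] at h4

theorem eq_of_mfderiv_eq_zero [ConnectedSpace M] {h : M → V}
    (hh : ∀ y, MDifferentiableAt (𝓡 n) 𝓘(ℝ, V) h y)
    (h0 : ∀ y, mfderiv (𝓡 n) 𝓘(ℝ, V) h y = 0) (x y : M) : h x = h y :=
  ((IsLocallyConstant.iff_eventually_eq h).2 fun _ =>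
    eventually_eq_of_mfderiv_eq_zero hh h0).apply_eq_of_preconnectedSpace x y

end LocallyConstant

/-! ### Parallel osculating bundles are constant -/

section Projections

variable {E F : Type*} [NormedAddCommGroup E] [NormedSpace ℝ E]
  [NormedAddCommGroup F] [InnerProductSpace ℝ F] [FiniteDimensional ℝ F]
  {G : E → F} {u : E} {j : ℕ}

/-- A smooth family of orthogonal projections whose images are preserved by differentiation
has vanishing derivative. -/
theorem fderiv_starProjection_osc_eq_zero (hG : ContDiffAt ℝ ∞ G u)
    (hr : ∀ᶠ x in 𝓝 u, Module.finrank ℝ (osc G x j) = Module.finrank ℝ (osc G u j))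
    (h : osc G u (j + 1) = osc G u j) :
    fderiv ℝ (fun x => (osc G x j).starProjection) u = 0 := by
  have hP := contDiffAt_starProjection_osc hG hr
  set P : E → F →L[ℝ] F := fun x => (osc G x j).starProjection with hPdef
  have hPd : DifferentiableAt ℝ P u := hP.differentiableAt (by simp)
  have hPP : ∀ x, (P x).comp (P x) = P x := fun x => by
    ext1 y
    exact Submodule.starProjection_eq_self_iff.2 (Submodule.starProjection_apply_mem _ _)
  have hsymm : ∀ x a b, inner ℝ (P x a) b = inner ℝ a (P x b) := fun x a b =>
    Submodule.inner_starProjection_left_eq_right _ _ _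
  ext X a
  set D := fderiv ℝ P u X with hD
  -- Let D = ∂_X P. Differentiating P s = s for sections s, whose derivatives stay in the image,
  -- gives D P = 0; then P² = P gives D = P D. As D is symmetric, |D a|² = ⟨a, D P D a⟩ = 0.
  have d1 : ∀ y ∈ osc G u j, D y = 0 := by
    intro y hy
    obtain ⟨s, hs, rfl⟩ := exists_mem_jetSec hy
    have hsd : DifferentiableAt ℝ s u := (contDiffAt_of_mem_jetSec hG hs).differentiableAt (by simp)
    have h1 : (fun x => P x (s x)) =ᶠ[𝓝 u] s := by
      filter_upwards [eventually_mem_osc hs] with x hx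
      exact Submodule.starProjection_eq_self_iff.2 hx
    have h2 := h1.fderiv_eq (𝕜 := ℝ)
    rw [fderiv_clm_apply hPd hsd] at h2
    have h3 := congrArg (fun A : E →L[ℝ] F => A X) h2
    have h4 : P u (fderiv ℝ s u X) = fderiv ℝ s u X := by
      refine Submodule.starProjection_eq_self_iff.2 ?_
      rw [← h]
      exact mem_osc_of_mem_jetSec (fderiv_mem_jetSec hG hs X)
    simpa [h4] using h3
  have d2 : ∀ y, D y = P u (D y) := by
    intro y
    have h1 : fderiv ℝ (fun x => (P x).comp (P x)) u = fderiv ℝ P u := by simp only [hPP]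
    rw [fderiv_clm_comp hPd hPd] at h1
    have h2 := congrArg (fun A : E →L[ℝ] F →L[ℝ] F => A X y) h1
    have h3 : D (P u y) = 0 := d1 _ (Submodule.starProjection_apply_mem _ _)
    simp only [add_apply, ContinuousLinearMap.comp_apply, ContinuousLinearMap.compL_apply,
      ContinuousLinearMap.flip_apply] at h2
    rw [← hD, h3, add_zero] at h2
    exact h2.symm
  have d3 : ∀ a b, inner ℝ (D a) b = inner ℝ a (D b) := by
    intro a b
    have h1 : fderiv ℝ (fun x => inner ℝ (P x a) b) u = fderiv ℝ (fun x => inner ℝ a (P x b)) u := by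
      simp only [hsymm]
    have e1 : HasFDerivAt (fun x => P x a) ((fderiv ℝ P u).flip a) u := by
      simpa using hPd.hasFDerivAt.clm_apply (hasFDerivAt_const a u)
    have e2 : HasFDerivAt (fun x => P x b) ((fderiv ℝ P u).flip b) u := by
      simpa using hPd.hasFDerivAt.clm_apply (hasFDerivAt_const b u)
    rw [(e1.inner ℝ (hasFDerivAt_const b u)).fderiv,
      ((hasFDerivAt_const a u).inner ℝ e2).fderiv] at h1
    have h2 := congrArg (fun A : E →L[ℝ] ℝ => A X) h1
    simpa using h2
  have h1 : inner ℝ (D a) (D a) = 0 := by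
    conv_lhs => rw [d2 a]
    rw [hsymm, d3, d1 _ (Submodule.starProjection_apply_mem _ _), inner_zero_right]
  simpa using inner_self_eq_zero.1 h1

end Projections

/-! ### The dimensions of the osculating spaces -/

section Ranks

variable {N : ℕ} {L : Type*} [TopologicalSpace L] [ChartedSpace (Euc 2) L]
  [IsManifold (𝓡 2) ∞ L] {g : L → Euc N}

omit [IsManifold (𝓡 2) ∞ L] in
theorem oscAt_zero (g : L → Euc N) (x : L) : oscAt 2 g x 0 = ⊥ := osc_zero

theorem IsElliptic.injective_fderiv (hg : IsElliptic g) (x : L) :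
    Function.Injective (fderiv ℝ (localRep 2 g x) (extChartAt (𝓡 2) x x)) := by
  have := hg.injective x
  rwa [diff_eq_fderiv (hg.mdifferentiableAt x)] at this

theorem IsElliptic.contDiffAt_localRep (hg : IsElliptic g) (x : L) :
    ContDiffAt ℝ ∞ (localRep 2 g x) (extChartAt (𝓡 2) x x) :=
  RuledImmersion.contDiffAt_localRep (hg.contMDiffAt x)

theorem IsElliptic.exists_isEllipticWith (hg : IsElliptic g) (x : L) :
    ∃ A B, IsEllipticWith (localRep 2 g x) (extChartAt (𝓡 2) x x) A B := by
  obtain ⟨J, hJ, h⟩ := hg.exists_coord_complexStructure x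
  exact RuledImmersion.exists_isEllipticWith (hg.contDiffAt_localRep x) (hg.injective_fderiv x) hJ h

theorem IsElliptic.finrank_oscAt_one (hg : IsElliptic g) (x : L) :
    Module.finrank ℝ (oscAt 2 g x 1) = 2 := by
  rw [oscAt, osc_one, LinearMap.finrank_range_of_inj (hg.injective_fderiv x)]
  simp

theorem IsElliptic.finrank_oscAt_succ (hg : IsElliptic g) (x : L) (j : ℕ) :
    Module.finrank ℝ (oscAt 2 g x (j + 2)) =
      Module.finrank ℝ (oscAt 2 g x (j + 1)) + Module.finrank ℝ (normalSpace 2 g x (j + 1)) := by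
  rw [normalSpace_succ_eq (hg.contMDiffAt x) (hg.injective x), inf_comm]
  exact (Submodule.finrank_add_inf_finrank_orthogonal (osc_mono (by omega))).symm

theorem IsElliptic.finrank_oscAt_eq (hg : IsElliptic g) (hr : IsRegularSurface g) (j : ℕ)
    (x y : L) : Module.finrank ℝ (oscAt 2 g x j) = Module.finrank ℝ (oscAt 2 g y j) := by
  match j with
  | 0 => rw [oscAt_zero, oscAt_zero]
  | 1 => rw [hg.finrank_oscAt_one, hg.finrank_oscAt_one]
  | j + 2 =>
    rw [hg.finrank_oscAt_succ, hg.finrank_oscAt_succ, hr (j + 1) x y,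
      IsElliptic.finrank_oscAt_eq hg hr (j + 1) x y]

theorem IsElliptic.osc_localRep (hg : IsElliptic g) (x : L) :
    ∀ᶠ u in 𝓝 (extChartAt (𝓡 2) x x), ∀ j,
      osc (localRep 2 g x) u j = oscAt 2 g ((extChartAt (𝓡 2) x).symm u) j := by
  filter_upwards [extChartAt_target_mem_nhds (I := 𝓡 2) x] with u hu j
  rw [oscAt_eq ((extChartAt (𝓡 2) x).map_target hu) (hg.contMDiffAt _),
    (extChartAt (𝓡 2) x).right_inv hu]

theorem IsElliptic.eventually_finrank (hg : IsElliptic g) (hr : IsRegularSurface g) (j : ℕ)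
    (x y : L) :
    ∀ᶠ u in 𝓝 (extChartAt (𝓡 2) x x), Module.finrank ℝ (osc (localRep 2 g x) u j) =
      Module.finrank ℝ (oscAt 2 g y j) := by
  filter_upwards [hg.osc_localRep x] with u hu
  rw [hu, hg.finrank_oscAt_eq hr j _ y]

theorem IsElliptic.starProjection_eventuallyEq (hg : IsElliptic g) (x : L) (j : ℕ) :
    (fun y => (oscAt 2 g y j).starProjection) =ᶠ[𝓝 x]
      (fun u => (osc (localRep 2 g x) u j).starProjection) ∘ extChartAt (𝓡 2) x := by
  filter_upwards [extChartAt_source_mem_nhds (I := 𝓡 2) x] with y hy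
  ext1 z
  exact starProjection_congr (oscAt_eq hy (hg.contMDiffAt _) j) z

theorem IsElliptic.contMDiff_starProjection (hg : IsElliptic g) (hr : IsRegularSurface g) (j : ℕ) :
    ContMDiff (𝓡 2) 𝓘(ℝ, Euc N →L[ℝ] Euc N) ∞ fun x => (oscAt 2 g x j).starProjection := by
  intro x
  refine ContMDiffAt.congr_of_eventuallyEq ?_ (hg.starProjection_eventuallyEq x j)
  exact (contDiffAt_starProjection_osc (hg.contDiffAt_localRep x)
    (hg.eventually_finrank hr j x x)).contMDiffAt.comp x contMDiffAt_extChartAt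

/-- If the osculating spaces of some order stabilize, they are constant and contain all of `g`. -/
theorem IsElliptic.oscAt_eq_top [ConnectedSpace L] (hg : IsElliptic g) (hr : IsRegularSurface g)
    (hs : IsSubstantial g) {j : ℕ} (hj : 1 ≤ j) {x₀ : L}
    (h : Module.finrank ℝ (oscAt 2 g x₀ (j + 1)) = Module.finrank ℝ (oscAt 2 g x₀ j)) :
    oscAt 2 g x₀ j = ⊤ := by
  -- Constant ranks spread the stabilization from `x₀` to all of `L`; the projection is then
  -- parallel everywhere, hence constant by connectedness.
  have hstab : ∀ x, oscAt 2 g x (j + 1) = oscAt 2 g x j := fun x => by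
    symm
    refine Submodule.eq_of_le_of_finrank_eq (osc_mono (Nat.le_succ j)) ?_
    rw [hg.finrank_oscAt_eq hr j x x₀, hg.finrank_oscAt_eq hr (j + 1) x x₀, h]
  have hP := hg.contMDiff_starProjection hr j
  have hPd : ∀ y, MDifferentiableAt (𝓡 2) 𝓘(ℝ, Euc N →L[ℝ] Euc N)
      (fun x => (oscAt 2 g x j).starProjection) y := fun y => (hP y).mdifferentiableAt (by simp)
  have hP0 : ∀ y, mfderiv (𝓡 2) 𝓘(ℝ, Euc N →L[ℝ] Euc N)
      (fun x => (oscAt 2 g x j).starProjection) y = 0 := by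
    intro y
    have h1 := ((contDiffAt_starProjection_osc (hg.contDiffAt_localRep y)
        (hg.eventually_finrank hr j y y)).differentiableAt (by simp)).hasFDerivAt
    rw [fderiv_starProjection_osc_eq_zero (hg.contDiffAt_localRep y)
          (hg.eventually_finrank hr j y y) (hstab y)] at h1
    have h2 := h1.hasMFDerivAt.comp y (mdifferentiableAt_extChartAt
      (I := 𝓡 2) (ChartedSpace.mem_chart_source y)).hasMFDerivAt
    have h3 : (0 : Euc 2 →L[ℝ] Euc N →L[ℝ] Euc N).comp
        (mfderiv (𝓡 2) 𝓘(ℝ, Euc 2) (extChartAt (𝓡 2) y) y : Euc 2 →L[ℝ] Euc 2) = 0 :=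
      ContinuousLinearMap.zero_comp _
    have h4 := (congrArg (fun D : Euc 2 →L[ℝ] Euc N →L[ℝ] Euc N => HasMFDerivAt (𝓡 2)
      𝓘(ℝ, Euc N →L[ℝ] Euc N) ((fun x => (osc (localRep 2 g y) x j).starProjection) ∘
        extChartAt (𝓡 2) y) y D) h3).mp h2
    exact (h4.congr_of_eventuallyEq (hg.starProjection_eventuallyEq y j)).mfderiv
  have hconst : ∀ x, oscAt 2 g x j = oscAt 2 g x₀ j := fun x => by
    have := eq_of_mfderiv_eq_zero hPd hP0 x x₀
    exact Submodule.starProjection_inj.1 this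
  set V := oscAt 2 g x₀ j with hV
  -- Since tangent planes lie in V, the component of `g` orthogonal to V is constant, so `g` stays
  -- in the affine subspace through `g x₀` with direction V.
  have hgc : ∀ x, Vᗮ.starProjection (g x) = Vᗮ.starProjection (g x₀) := by
    intro x
    have hd : ∀ y, HasMFDerivAt (𝓡 2) 𝓘(ℝ, Euc N) (fun y => Vᗮ.starProjection (g y)) y 0 := by
      intro y
      have h1 := ((Vᗮ.starProjection).hasFDerivAt (x := g y)).hasMFDerivAt.comp y
        (hg.mdifferentiableAt y).hasMFDerivAt
      have h3 : (Vᗮ.starProjection).comp (diff 2 g y : Euc 2 →L[ℝ] Euc N) = 0 := ?_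
      · have h4 : HasMFDerivAt (𝓡 2) 𝓘(ℝ, Euc N) (fun y => Vᗮ.starProjection (g y)) y
          ((Vᗮ.starProjection).comp (diff 2 g y : Euc 2 →L[ℝ] Euc N)) := h1
        rw [h3] at h4
        exact h4
      ext1 X
      refine (Submodule.starProjection_apply_eq_zero_iff _).2 ?_
      rw [Submodule.orthogonal_orthogonal, ← hconst y]
      have h2 : tangentImage 2 g y ≤ oscAt 2 g y j := by
        rw [tangentImage_eq_osc (hg.mdifferentiableAt y)]
        exact osc_mono hj
      exact h2 ⟨X, rfl⟩
    exact eq_of_mfderiv_eq_zero (fun y => (hd y).mdifferentiableAt) (fun y => (hd y).mfderiv) x x₀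
  have hA := hs (AffineSubspace.mk' (g x₀) V) (fun x => by
    rw [AffineSubspace.mem_mk', vsub_eq_sub]
    have h1 := hgc x
    rw [← sub_eq_zero, ← map_sub, Submodule.starProjection_apply_eq_zero_iff,
      Submodule.orthogonal_orthogonal] at h1
    exact h1)
  have := congrArg AffineSubspace.direction hA
  rwa [AffineSubspace.direction_mk', AffineSubspace.direction_top] at this

/-- The growth at each order is 0, 1 or 2. Growth 0 means the ambient space is already filled, which
is too early for the given j. Growth 1 yields a relation between the leading terms, hence growth 0
at the next order, so an odd number 2j + 1 would equal 2(m + 3). -/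
theorem IsElliptic.finrank_oscAt [ConnectedSpace L] {m : ℕ} {g : L → Euc (2 * (m + 3))}
    (hg : IsElliptic g) (hs : IsSubstantial g) (hr : IsRegularSurface g) (x : L) (j : ℕ)
    (hj : j ≤ m + 3) : Module.finrank ℝ (oscAt 2 g x j) = 2 * j := by
  obtain ⟨A, B, he⟩ := hg.exists_isEllipticWith x
  have hG := hg.contDiffAt_localRep x
  induction j with
  | zero => rw [oscAt_zero]; simp
  | succ j ih =>
    rcases Nat.eq_zero_or_pos j with rfl | hj0
    · exact hg.finrank_oscAt_one x
    have ih := ih (by omega)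
    have h1 : Module.finrank ℝ (oscAt 2 g x (j + 1)) ≤ Module.finrank ℝ (oscAt 2 g x j) + 2 :=
      finrank_osc_succ_le hG he j
    have h2 : Module.finrank ℝ (oscAt 2 g x j) ≤ Module.finrank ℝ (oscAt 2 g x (j + 1)) :=
      Submodule.finrank_mono (osc_mono (Nat.le_succ j))
    have htop : ∀ k, 1 ≤ k → Module.finrank ℝ (oscAt 2 g x (k + 1)) =
        Module.finrank ℝ (oscAt 2 g x k) → Module.finrank ℝ (oscAt 2 g x k) = 2 * (m + 3) := by
      intro k hk h
      rw [hg.oscAt_eq_top hr hs hk h, finrank_top]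
      simp
    have h3 : Module.finrank ℝ (oscAt 2 g x (j + 1)) ≠ Module.finrank ℝ (oscAt 2 g x j) := by
      intro h
      have := htop j hj0 h
      omega
    have h4 : Module.finrank ℝ (oscAt 2 g x (j + 1)) ≠ Module.finrank ℝ (oscAt 2 g x j) + 1 := by
      intro h
      obtain ⟨p, q, hp, hq, h0, hrel⟩ := exists_relation hG (Nat.le_succ j)
        (by rw [← oscAt, ← h]; exact hg.eventually_finrank hr (j + 1) x x)
        (frame_mem_jetSec hG j 0) (frame_mem_jetSec hG j 1) (osc_succ_eq_frame hG he j)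
      have h5 : oscAt 2 g x (j + 2) = oscAt 2 g x (j + 1) :=
        osc_eq_of_relation hG he hp hq h0 hrel
      have := htop (j + 1) (by omega) (by rw [h5])
      omega
    omega

end Ranks

/-! ### The total space of a bundle as a manifold -/

section TotalSpace

variable {N r n : ℕ} {L : Type*} [TopologicalSpace L] [ChartedSpace (Euc 2) L]
  {V : L → Submodule ℝ (Euc N)}

/-- A basis of V x₀ is projected to V x and then renormalized by the inverse of K, so that the fixed
map C (coordinates of the projection to V x₀) inverts it exactly. U is the set where K is
invertible; elsewhere `inverse` is 0 by convention, which keeps B with values in V at every point.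
-/
theorem exists_local_trivialization
    (hV : ContMDiff (𝓡 2) 𝓘(ℝ, Euc N →L[ℝ] Euc N) ∞ fun x => (V x).starProjection)
    (hr : ∀ x, Module.finrank ℝ (V x) = r) (x₀ : L) :
    ∃ (C : Euc N →L[ℝ] Euc r) (B : L → Euc r →L[ℝ] Euc N) (U : Set L), IsOpen U ∧ x₀ ∈ U ∧
      (∀ x ∈ U, ContMDiffAt (𝓡 2) 𝓘(ℝ, Euc r →L[ℝ] Euc N) ∞ B x) ∧
      (∀ x t, B x t ∈ V x) ∧
      ∀ x ∈ U, (∀ t, C (B x t) = t) ∧ ∀ ξ ∈ V x, B x (C ξ) = ξ := by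
  let b : Euc r ≃L[ℝ] V x₀ := ContinuousLinearEquiv.ofFinrankEq (by rw [hr]; simp)
  let S : Euc r →L[ℝ] Euc N := (V x₀).subtypeL.comp (b : Euc r →L[ℝ] V x₀)
  let C : Euc N →L[ℝ] Euc r :=
    (b.symm : V x₀ →L[ℝ] Euc r).comp (V x₀).orthogonalProjectionOnto
  let P : L → Euc N →L[ℝ] Euc N := fun x => (V x).starProjection
  let K : L → Euc r →L[ℝ] Euc r := fun x => C.comp ((P x).comp S)
  let B : L → Euc r →L[ℝ] Euc N := fun x => (P x).comp (S.comp (K x).inverse)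
  let U : Set L := K ⁻¹' Set.range ((↑) : (Euc r ≃L[ℝ] Euc r) → Euc r →L[ℝ] Euc r)
  have hK : ContMDiff (𝓡 2) 𝓘(ℝ, Euc r →L[ℝ] Euc r) ∞ K := by
    have h1 : ContMDiff 𝓘(ℝ, Euc N →L[ℝ] Euc N) 𝓘(ℝ, Euc r →L[ℝ] Euc r) ∞
        fun A : Euc N →L[ℝ] Euc N => C.comp (A.comp S) :=
      (contDiff_const.clm_comp (contDiff_id.clm_comp contDiff_const)).contMDiff
    exact h1.comp hV
  have hK0 : K x₀ = (ContinuousLinearEquiv.refl ℝ (Euc r) : Euc r →L[ℝ] Euc r) := by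
    ext1 t
    have h1 : P x₀ (S t) = S t := Submodule.starProjection_eq_self_iff.2 (b t).2
    have h2 : K x₀ t = C (S t) := congrArg C h1
    rw [h2]
    change b.symm ((V x₀).orthogonalProjectionOnto (b t : Euc N)) = t
    rw [Submodule.orthogonalProjectionOnto_mem_subspace_eq_self]
    simp
  have hBm : ∀ x t, B x t ∈ V x := fun x t => Submodule.starProjection_apply_mem _ _
  refine ⟨C, B, U, ContinuousLinearEquiv.isOpen.preimage hK.continuous, ⟨_, hK0.symm⟩, ?_, hBm, ?_⟩
  · rintro x ⟨e, he⟩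
    have h1 : ContMDiffAt (𝓡 2) 𝓘(ℝ, Euc r →L[ℝ] Euc r) ∞ (fun y => (K y).inverse) x := by
      have h2 := contDiffAt_map_inverse (𝕜 := ℝ) (n := ∞) e
      have he' : (e : Euc r →L[ℝ] Euc r) = K x := he
      rw [he'] at h2
      exact h2.contMDiffAt.comp x (hK x)
    have h3 : ContDiff ℝ ∞ fun A : (Euc N →L[ℝ] Euc N) × (Euc r →L[ℝ] Euc r) =>
        A.1.comp (S.comp A.2) :=
      contDiff_fst.clm_comp (contDiff_const.clm_comp contDiff_snd)
    exact h3.contMDiff.contMDiffAt.comp x ((hV x).prodMk_space h1)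
  · rintro x ⟨e, he⟩
    have he' : (e : Euc r →L[ℝ] Euc r) = K x := he
    have h1 : ∀ t, C (B x t) = t := by
      intro t
      change K x ((K x).inverse t) = t
      rw [← he', ContinuousLinearMap.inverse_equiv]
      simp
    refine ⟨h1, fun ξ hξ => ?_⟩
    -- `C` makes `B x` injective, and equality of dimensions makes it onto V x; this gives the other
    -- inverse identity.
    let B' : Euc r →ₗ[ℝ] V x := (B x).toLinearMap.codRestrict (V x) (hBm x)
    have hinj : Function.Injective B' := fun s t hst => by
      have := congrArg (fun y : V x => C (y : Euc N)) hst
      change C (B x s) = C (B x t) at this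
      rwa [h1, h1] at this
    have hsurj := (LinearMap.injective_iff_surjective_of_finrank_eq_finrank
      (by rw [hr]; simp)).1 hinj
    obtain ⟨t, ht⟩ := hsurj ⟨ξ, hξ⟩
    have ht' : B x t = ξ := congrArg Subtype.val ht
    rw [← ht', h1]

variable (V) in
/-- Data describing a chart of the total space of `V` in which the projection and the fibres
are linear. -/
structure BundleChart (r n : ℕ) [ChartedSpace (Euc n) {q : L × Euc N // q.2 ∈ V q.1}]
    (q : {q : L × Euc N // q.2 ∈ V q.1}) where
  ι : (Euc 2 × Euc r) ≃L[ℝ] Euc n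
  C : Euc N →L[ℝ] Euc r
  B : L → Euc r →L[ℝ] Euc N
  smooth : ContMDiffAt (𝓡 2) 𝓘(ℝ, Euc r →L[ℝ] Euc N) ∞ B q.1.1
  mem : ∀ x t, B x t ∈ V x
  left_inv : ∀ᶠ x in 𝓝 q.1.1, ∀ t, C (B x t) = t
  right_inv : ∀ᶠ x in 𝓝 q.1.1, ∀ ξ ∈ V x, B x (C ξ) = ξ
  coe_eq : ∀ q' : {q : L × Euc N // q.2 ∈ V q.1}, extChartAt (𝓡 n) q q' =
    ι (extChartAt (𝓡 2) q.1.1 q'.1.1, C q'.1.2)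
  symm_eq : ∀ w, ((extChartAt (𝓡 n) q).symm w).1 =
    ((extChartAt (𝓡 2) q.1.1).symm (ι.symm w).1,
      B ((extChartAt (𝓡 2) q.1.1).symm (ι.symm w).1) (ι.symm w).2)

variable (V) in
/-- The chart of the total space defined by a local trivialization. -/
def trivializationChart (ι : (Euc 2 × Euc r) ≃L[ℝ] Euc n) (x₀ : L) (C : Euc N →L[ℝ] Euc r)
    (B : L → Euc r →L[ℝ] Euc N) (U : Set L) (hU : IsOpen U)
    (hB : ∀ x ∈ U, ContMDiffAt (𝓡 2) 𝓘(ℝ, Euc r →L[ℝ] Euc N) ∞ B x)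
    (hmem : ∀ x t, B x t ∈ V x)
    (hinv : ∀ x ∈ U, (∀ t, C (B x t) = t) ∧ ∀ ξ ∈ V x, B x (C ξ) = ξ) :
    OpenPartialHomeomorph {q : L × Euc N // q.2 ∈ V q.1} (Euc n) where
  toFun q := ι (chartAt (Euc 2) x₀ q.1.1, C q.1.2)
  invFun w := ⟨((chartAt (Euc 2) x₀).symm (ι.symm w).1,
    B ((chartAt (Euc 2) x₀).symm (ι.symm w).1) (ι.symm w).2), hmem _ _⟩
  source := {q | q.1.1 ∈ (chartAt (Euc 2) x₀).source ∩ U}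
  target := {w | (ι.symm w).1 ∈ (chartAt (Euc 2) x₀).target ∩ (chartAt (Euc 2) x₀).symm ⁻¹' U}
  map_source' := by
    rintro q ⟨h1, h2⟩
    simp only [Set.mem_ofPred_eq, ContinuousLinearEquiv.symm_apply_apply]
    refine ⟨(chartAt (Euc 2) x₀).map_source h1, ?_⟩
    simpa [(chartAt (Euc 2) x₀).left_inv h1] using h2
  map_target' := by
    rintro w ⟨h1, h2⟩
    exact ⟨(chartAt (Euc 2) x₀).map_target h1, h2⟩
  left_inv' := by
    rintro ⟨⟨x, ξ⟩, hξ⟩ ⟨h1, h2⟩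
    apply Subtype.ext
    simp only [ContinuousLinearEquiv.symm_apply_apply]
    rw [(chartAt (Euc 2) x₀).left_inv h1]
    exact Prod.ext rfl ((hinv x h2).2 ξ hξ)
  right_inv' := by
    rintro w ⟨h1, h2⟩
    simp only
    rw [(chartAt (Euc 2) x₀).right_inv h1, (hinv _ h2).1]
    simp
  open_source := by
    refine ((chartAt (Euc 2) x₀).open_source.inter hU).preimage ?_
    exact continuous_fst.comp continuous_subtype_val
  open_target := by
    refine ((chartAt (Euc 2) x₀).isOpen_inter_preimage_symm hU).preimage ?_
    exact continuous_fst.comp ι.symm.continuous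
  continuousOn_toFun := by
    refine ι.continuous.comp_continuousOn (ContinuousOn.prodMk ?_ ?_)
    · exact (chartAt (Euc 2) x₀).continuousOn.comp
        (continuous_fst.comp continuous_subtype_val).continuousOn fun q hq => hq.1
    · exact (C.continuous.comp (continuous_snd.comp continuous_subtype_val)).continuousOn
  continuousOn_invFun := by
    refine (Topology.IsInducing.induced
      (Subtype.val : {q : L × Euc N // q.2 ∈ V q.1} → L × Euc N)).continuousOn_iff.2 ?_
    have h1 : ContinuousOn (fun w => (chartAt (Euc 2) x₀).symm (ι.symm w).1)
        {w | (ι.symm w).1 ∈ (chartAt (Euc 2) x₀).target ∩ (chartAt (Euc 2) x₀).symm ⁻¹' U} :=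
      (chartAt (Euc 2) x₀).continuousOn_symm.comp
        (continuous_fst.comp ι.symm.continuous).continuousOn fun w hw => hw.1
    refine h1.prodMk ?_
    have h2 : ContinuousOn B U := fun x hx => (hB x hx).continuousAt.continuousWithinAt
    exact (h2.comp h1 fun w hw => hw.2).clm_apply
      (continuous_snd.comp ι.symm.continuous).continuousOn

/-- The total space of a smooth vector bundle in a trivial bundle is a smooth manifold. -/
theorem exists_chartedSpace [IsManifold (𝓡 2) ∞ L]
    (hV : ContMDiff (𝓡 2) 𝓘(ℝ, Euc N →L[ℝ] Euc N) ∞ fun x => (V x).starProjection)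
    (hr : ∀ x, Module.finrank ℝ (V x) = r) (hn : 2 + r = n) :
    ∃ _ : ChartedSpace (Euc n) {q : L × Euc N // q.2 ∈ V q.1},
      IsManifold (𝓡 n) ∞ {q : L × Euc N // q.2 ∈ V q.1} ∧
      ∀ q, Nonempty (BundleChart V r n q) := by
  choose C B U hU hx hB hmem hinv using exists_local_trivialization hV hr
  let ι : (Euc 2 × Euc r) ≃L[ℝ] Euc n := ContinuousLinearEquiv.ofFinrankEq (by simp [hn])
  let ch : L → OpenPartialHomeomorph {q : L × Euc N // q.2 ∈ V q.1} (Euc n) := fun x =>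
    trivializationChart V ι x (C x) (B x) (U x) (hU x) (hB x) (hmem x) (hinv x)
  let cs : ChartedSpace (Euc n) {q : L × Euc N // q.2 ∈ V q.1} :=
    { atlas := Set.range ch
      chartAt := fun q => ch q.1.1
      mem_chart_source := fun q => ⟨ChartedSpace.mem_chart_source q.1.1, hx q.1.1⟩
      chart_mem_atlas := fun q => ⟨q.1.1, rfl⟩ }
  refine ⟨cs, ?_, ?_⟩
  · refine isManifold_of_contDiffOn _ _ _ ?_
    rintro _ _ ⟨a, rfl⟩ ⟨b, rfl⟩
    rintro w ⟨⟨hw1, hw2⟩, -⟩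
    refine ContDiffAt.contDiffWithinAt ?_
    set u := (ι.symm w).1 with hu
    set x := (chartAt (Euc 2) a).symm u with hxu
    have hua : u ∈ (chartAt (Euc 2) a).target := hw1.1
    have hxa : x ∈ (extChartAt (𝓡 2) a).source := by
      rw [extChartAt_source]; exact (chartAt (Euc 2) a).map_target hua
    have hxb : x ∈ (extChartAt (𝓡 2) b).source := by
      rw [extChartAt_source]; exact hw2.1
    have hxU : x ∈ U a := hw1.2
    have hau : extChartAt (𝓡 2) a x = u := (chartAt (Euc 2) a).right_inv hua
    have hu' : ContDiffAt ℝ ∞ (fun w : Euc n => (ι.symm w).1) w :=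
      (contDiff_fst.comp ι.symm.contDiff).contDiffAt
    have h1 : ContDiffAt ℝ ∞ (extChartAt (𝓡 2) b ∘ (extChartAt (𝓡 2) a).symm) u := by
      have := contDiffAt_coordChange (n := 2) hxa hxb
      rwa [hau] at this
    have h2 : ContDiffAt ℝ ∞ (B a ∘ (extChartAt (𝓡 2) a).symm) u := by
      rw [← contMDiffAt_iff_contDiffAt]
      have h3 : ContMDiffAt 𝓘(ℝ, Euc 2) (𝓡 2) ∞ (extChartAt (𝓡 2) a).symm u :=
        (contMDiffOn_extChartAt_symm (I := 𝓡 2) (n := ∞) a).contMDiffAt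
          ((isOpen_extChartAt_target a).mem_nhds (by rw [← hau]; exact (extChartAt (𝓡 2) a).map_source hxa))
      exact (hB a x hxU).comp u h3
    -- A transition map is a change of charts on the base together with `C b ∘ B a`, linear in the
    -- fibre and smooth in the base point.
    have h3 : ContDiffAt ℝ ∞ (fun w : Euc n =>
        ι ((extChartAt (𝓡 2) b ∘ (extChartAt (𝓡 2) a).symm) (ι.symm w).1,
          C b ((B a ∘ (extChartAt (𝓡 2) a).symm) (ι.symm w).1 (ι.symm w).2))) w := by
      refine ι.contDiff.contDiffAt.comp w ?_
      refine ContDiffAt.prodMk (ContDiffAt.comp (g := extChartAt (𝓡 2) b ∘ (extChartAt (𝓡 2) a).symm) w h1 hu') ?_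
      refine (C b).contDiff.contDiffAt.comp w ?_
      exact (ContDiffAt.comp (g := B a ∘ (extChartAt (𝓡 2) a).symm) w h2 hu').clm_apply (contDiff_snd.comp ι.symm.contDiff).contDiffAt
    exact h3
  · intro q
    refine ⟨⟨ι, C q.1.1, B q.1.1, hB _ _ (hx _), hmem _, ?_, ?_, fun q' => rfl, fun w => rfl⟩⟩
    · filter_upwards [(hU q.1.1).mem_nhds (hx q.1.1)] with x hx'
      exact (hinv _ x hx').1
    · filter_upwards [(hU q.1.1).mem_nhds (hx q.1.1)] with x hx'
      exact (hinv _ x hx').2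

end TotalSpace

theorem tendsto_extChartAt_symm {n : ℕ} {M : Type*} [TopologicalSpace M] [ChartedSpace (Euc n) M]
    (x : M) : Filter.Tendsto (extChartAt (𝓡 n) x).symm (𝓝 (extChartAt (𝓡 n) x x)) (𝓝 x) := by
  have := continuousAt_extChartAt_symm (I := 𝓡 n) x
  rwa [ContinuousAt, extChartAt_to_inv] at this

/-! ### Derivatives of maps affine in the fibre -/

section BundleMapCalculus

variable {E E' F : Type*} [NormedAddCommGroup E] [NormedSpace ℝ E] [NormedAddCommGroup E']
  [NormedSpace ℝ E'] [NormedAddCommGroup F] [NormedSpace ℝ F] {G : E → F} {B : E → E' →L[ℝ] F}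
  {z : E × E'}

theorem hasFDerivAt_bundleMap (hG : DifferentiableAt ℝ G z.1) (hB : DifferentiableAt ℝ B z.1) :
    HasFDerivAt (fun z : E × E' => G z.1 + B z.1 z.2)
      ((fderiv ℝ G z.1).comp (.fst ℝ E E') + ((B z.1).comp (.snd ℝ E E') +
        ((fderiv ℝ B z.1).comp (.fst ℝ E E')).flip z.2)) z :=
  (hG.hasFDerivAt.comp z hasFDerivAt_fst).add
    ((hB.hasFDerivAt.comp z hasFDerivAt_fst).clm_apply hasFDerivAt_snd)

theorem fderiv_bundleMap (hG : DifferentiableAt ℝ G z.1) (hB : DifferentiableAt ℝ B z.1)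
    (X : E × E') :
    fderiv ℝ (fun z : E × E' => G z.1 + B z.1 z.2) z X =
      fderiv ℝ G z.1 X.1 + fderiv ℝ B z.1 X.1 z.2 + B z.1 X.2 := by
  rw [(hasFDerivAt_bundleMap hG hB).fderiv]
  simp only [add_apply, ContinuousLinearMap.comp_apply, ContinuousLinearMap.flip_apply,
    ContinuousLinearMap.coe_fst', ContinuousLinearMap.coe_snd']
  abel

theorem contDiffAt_bundleMap (hG : ContDiffAt ℝ ∞ G z.1) (hB : ContDiffAt ℝ ∞ B z.1) :
    ContDiffAt ℝ ∞ (fun z : E × E' => G z.1 + B z.1 z.2) z :=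
  (hG.comp z contDiffAt_fst).add ((hB.comp z contDiffAt_fst).clm_apply contDiffAt_snd)

/-- The map is affine in the fibre, so there is no purely vertical second derivative: only a
horizontal term, with the fibre coordinate frozen, and two mixed terms. -/
theorem fderiv_fderiv_bundleMap (hG : ContDiffAt ℝ ∞ G z.1) (hB : ContDiffAt ℝ ∞ B z.1)
    (X Y : E × E') :
    fderiv ℝ (fderiv ℝ (fun z : E × E' => G z.1 + B z.1 z.2)) z X Y =
      fderiv ℝ (fun x => fderiv ℝ (fun y => G y + B y z.2) x Y.1) z.1 X.1 +
        fderiv ℝ (fun x => B x Y.2) z.1 X.1 + fderiv ℝ (fun x => B x X.2) z.1 Y.1 := by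
  have h1 : (fun z' => fderiv ℝ (fun z : E × E' => G z.1 + B z.1 z.2) z' Y) =ᶠ[𝓝 z]
      fun z => (fderiv ℝ G z.1 Y.1 + B z.1 Y.2) + fderiv ℝ B z.1 Y.1 z.2 := by
    have hc : Filter.Tendsto (Prod.fst : E × E' → E) (𝓝 z) (𝓝 z.1) := continuous_fst.continuousAt
    filter_upwards [hc.eventually hG.eventually_differentiableAt,
      hc.eventually hB.eventually_differentiableAt] with z' h2 h3
    rw [fderiv_bundleMap h2 h3]
    abel
  have hd : DifferentiableAt ℝ (fderiv ℝ (fun z : E × E' => G z.1 + B z.1 z.2)) z :=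
    (contDiffAt_bundleMap hG hB).fderiv_infty.differentiableAt (by simp)
  have h2 : fderiv ℝ (fun z' => fderiv ℝ (fun z : E × E' => G z.1 + B z.1 z.2) z' Y) z X =
      fderiv ℝ (fderiv ℝ (fun z : E × E' => G z.1 + B z.1 z.2)) z X Y := by
    rw [fderiv_clm_apply hd (differentiableAt_const _)]
    simp
  have dG : DifferentiableAt ℝ (fderiv ℝ G) z.1 := hG.fderiv_infty.differentiableAt (by simp)
  have dB : DifferentiableAt ℝ (fderiv ℝ B) z.1 := hB.fderiv_infty.differentiableAt (by simp)
  have dB' : DifferentiableAt ℝ B z.1 := hB.differentiableAt (by simp)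
  have dBY : DifferentiableAt ℝ (fun x => fderiv ℝ B x Y.1) z.1 :=
    dB.clm_apply (differentiableAt_const _)
  have dGY : DifferentiableAt ℝ (fun x => fderiv ℝ G x Y.1 + B x Y.2) z.1 :=
    (dG.clm_apply (differentiableAt_const _)).add (dB'.clm_apply (differentiableAt_const _))
  rw [← h2, h1.fderiv_eq, fderiv_bundleMap (G := fun x => fderiv ℝ G x Y.1 + B x Y.2)
    (B := fun x => fderiv ℝ B x Y.1) dGY dBY]
  have h3 : (fun x => fderiv ℝ (fun y => G y + B y z.2) x Y.1) =ᶠ[𝓝 z.1]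
      fun x => fderiv ℝ G x Y.1 + fderiv ℝ B x Y.1 z.2 := by
    filter_upwards [hG.eventually_differentiableAt, hB.eventually_differentiableAt] with x h2 h3
    rw [fderiv_fun_add h2 (h3.clm_apply (differentiableAt_const _)),
      fderiv_clm_apply h3 (differentiableAt_const _)]
    simp
  rw [h3.fderiv_eq, fderiv_fun_add (dG.clm_apply (differentiableAt_const _))
      (dB'.clm_apply (differentiableAt_const _)),
    fderiv_fun_add (dG.clm_apply (differentiableAt_const _))
      (dBY.clm_apply (differentiableAt_const _))]
  have h4 : fderiv ℝ (fun x => fderiv ℝ B x Y.1 z.2) z.1 X.1 =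
      fderiv ℝ (fun x => fderiv ℝ B x Y.1) z.1 X.1 z.2 := by
    rw [fderiv_clm_apply dBY (differentiableAt_const _)]
    simp
  have h5 : fderiv ℝ (fun x => B x X.2) z.1 Y.1 = fderiv ℝ B z.1 Y.1 X.2 := by
    rw [fderiv_clm_apply dB' (differentiableAt_const _)]
    simp
  rw [h5]
  simp only [add_apply, h4]
  abel

end BundleMapCalculus

/-! ### The map ξ ↦ g(π(ξ)) + ξ in bundle charts -/

section TotalMap

variable {N r n : ℕ} {L : Type*} [TopologicalSpace L] [ChartedSpace (Euc 2) L]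
  {V : L → Submodule ℝ (Euc N)} {g : L → Euc N}

/-- The map `ξ ↦ g(π(ξ)) + ξ` on the total space of a bundle. -/
def totalMap (V : L → Submodule ℝ (Euc N)) (g : L → Euc N) (q : {q : L × Euc N // q.2 ∈ V q.1}) :
    Euc N :=
  g q.1.1 + q.1.2

omit [ChartedSpace (Euc 2) L] in
theorem continuous_base : Continuous (fun q : {q : L × Euc N // q.2 ∈ V q.1} => q.1.1) :=
  continuous_fst.comp continuous_subtype_val

variable [ChartedSpace (Euc n) {q : L × Euc N // q.2 ∈ V q.1}]
  {q : {q : L × Euc N // q.2 ∈ V q.1}}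

namespace BundleChart

variable (b : BundleChart V r n q)

/-- The base point in coordinates. -/
def base (_ : BundleChart V r n q) : Euc 2 := extChartAt (𝓡 2) q.1.1 q.1.1

/-- The frame in coordinates. -/
def coordFrame : Euc 2 → Euc r →L[ℝ] Euc N := b.B ∘ (extChartAt (𝓡 2) q.1.1).symm

theorem extChartAt_self : extChartAt (𝓡 n) q q = b.ι (b.base, b.C q.1.2) :=
  b.coe_eq q

theorem B_C_self : b.B q.1.1 (b.C q.1.2) = q.1.2 :=
  b.right_inv.self_of_nhds _ q.2

theorem coordFrame_base : b.coordFrame b.base = b.B q.1.1 := by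
  simp [coordFrame, base]

theorem contDiffAt_coordFrame : ContDiffAt ℝ ∞ b.coordFrame b.base :=
  contDiffAt_comp_extChartAt_symm b.smooth

theorem tendsto_symm : Filter.Tendsto (extChartAt (𝓡 2) q.1.1).symm (𝓝 b.base) (𝓝 q.1.1) :=
  tendsto_extChartAt_symm q.1.1

theorem localRep_totalMap (w : Euc n) : localRep n (totalMap V g) q w =
    localRep 2 g q.1.1 (b.ι.symm w).1 + b.coordFrame (b.ι.symm w).1 (b.ι.symm w).2 := by
  have h := b.symm_eq w
  simp only [localRep, totalMap, Function.comp_apply, h]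
  rfl

theorem localRep_totalMap' : localRep n (totalMap V g) q =
    (fun z : Euc 2 × Euc r => localRep 2 g q.1.1 z.1 + b.coordFrame z.1 z.2) ∘ b.ι.symm :=
  funext b.localRep_totalMap

include b in
theorem contMDiffAt_totalMap (hg : ContMDiffAt (𝓡 2) 𝓘(ℝ, Euc N) ∞ g q.1.1) :
    ContMDiffAt (𝓡 n) 𝓘(ℝ, Euc N) ∞ (totalMap V g) q := by
  rw [contMDiffAt_iff]
  refine ⟨?_, ?_⟩
  · exact (hg.continuousAt.comp (f := fun q' : {q : L × Euc N // q.2 ∈ V q.1} => q'.1.1)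
      continuous_base.continuousAt).add (continuous_snd.comp continuous_subtype_val).continuousAt
  · rw [ModelWithCorners.range_eq_univ, contDiffWithinAt_univ, b.extChartAt_self]
    change ContDiffAt ℝ ∞ (localRep n (totalMap V g) q) _
    rw [b.localRep_totalMap']
    refine ContDiffAt.comp _ ?_ b.ι.symm.contDiff.contDiffAt
    rw [b.ι.symm_apply_apply]
    exact contDiffAt_bundleMap (contDiffAt_localRep hg) b.contDiffAt_coordFrame

include b in
theorem contMDiffAt_snd :
    ContMDiffAt (𝓡 n) 𝓘(ℝ, Euc N) ∞ (fun q' : {q : L × Euc N // q.2 ∈ V q.1} => q'.1.2) q := by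
  have h := b.contMDiffAt_totalMap (g := fun _ => 0) contMDiffAt_const
  have e : (totalMap V fun _ => 0) = fun q' : {q : L × Euc N // q.2 ∈ V q.1} => q'.1.2 := by
    ext1 q'
    simp [totalMap]
  rwa [e] at h

theorem hasMFDerivAt_fst :
    HasMFDerivAt (𝓡 n) (𝓡 2) (fun q' : {q : L × Euc N // q.2 ∈ V q.1} => q'.1.1) q
      ((ContinuousLinearMap.fst ℝ (Euc 2) (Euc r)).comp (b.ι.symm : Euc n →L[ℝ] Euc 2 × Euc r)) := by
  refine ⟨continuous_base.continuousAt, ?_⟩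
  refine HasFDerivAt.hasFDerivWithinAt (E := Euc n) (F := Euc 2) ?_
  rw [b.extChartAt_self]
  have h : HasFDerivAt (fun w => (b.ι.symm w).1) ((ContinuousLinearMap.fst ℝ (Euc 2) (Euc r)).comp
      (b.ι.symm : Euc n →L[ℝ] Euc 2 × Euc r)) (b.ι (b.base, b.C q.1.2)) :=
    ((ContinuousLinearMap.fst ℝ (Euc 2) (Euc r)).comp
      (b.ι.symm : Euc n →L[ℝ] Euc 2 × Euc r)).hasFDerivAt
  refine h.congr_of_eventuallyEq ?_
  have hc : Filter.Tendsto (fun w => (b.ι.symm w).1) (𝓝 (b.ι (b.base, b.C q.1.2))) (𝓝 b.base) := by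
    have := h.continuousAt
    rwa [ContinuousAt, b.ι.symm_apply_apply] at this
  filter_upwards [hc.eventually (extChartAt_target_mem_nhds (I := 𝓡 2) q.1.1)] with w hw
  simp only [writtenInExtChartAt, Function.comp_apply, b.symm_eq]
  exact (extChartAt (𝓡 2) q.1.1).right_inv hw

include b in
theorem contMDiffAt_fst :
    ContMDiffAt (𝓡 n) (𝓡 2) ∞ (fun q' : {q : L × Euc N // q.2 ∈ V q.1} => q'.1.1) q := by
  rw [contMDiffAt_iff]
  refine ⟨continuous_base.continuousAt, ?_⟩
  rw [ModelWithCorners.range_eq_univ, contDiffWithinAt_univ, b.extChartAt_self]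
  have h : ContDiffAt ℝ ∞ (fun w => (b.ι.symm w).1) (b.ι (b.base, b.C q.1.2)) :=
    (contDiff_fst.comp b.ι.symm.contDiff).contDiffAt
  refine h.congr_of_eventuallyEq ?_
  have hc : Filter.Tendsto (fun w => (b.ι.symm w).1) (𝓝 (b.ι (b.base, b.C q.1.2))) (𝓝 b.base) := by
    have := h.continuousAt
    rwa [ContinuousAt, b.ι.symm_apply_apply] at this
  filter_upwards [hc.eventually (extChartAt_target_mem_nhds (I := 𝓡 2) q.1.1)] with w hw
  simp only [Function.comp_apply, b.symm_eq]
  exact (extChartAt (𝓡 2) q.1.1).right_inv hw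

/-- The differential of `ξ ↦ g(π(ξ)) + ξ` in coordinates. -/
theorem fderiv_localRep (hg : ContMDiffAt (𝓡 2) 𝓘(ℝ, Euc N) ∞ g q.1.1) (X : Euc n) :
    fderiv ℝ (localRep n (totalMap V g) q) (extChartAt (𝓡 n) q q) X =
      fderiv ℝ (fun u => localRep 2 g q.1.1 u + b.coordFrame u (b.C q.1.2)) b.base
        (b.ι.symm X).1 + b.B q.1.1 (b.ι.symm X).2 := by
  rw [b.localRep_totalMap', b.ι.symm.comp_right_fderiv, b.extChartAt_self, b.ι.symm_apply_apply]
  have dG : DifferentiableAt ℝ (localRep 2 g q.1.1) b.base :=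
    (contDiffAt_localRep hg).differentiableAt (n := ∞) (by simp)
  have dB := b.contDiffAt_coordFrame.differentiableAt (n := ∞) (by simp)
  have h := fderiv_bundleMap (z := (b.base, b.C q.1.2)) dG dB (b.ι.symm X)
  have h2 : fderiv ℝ (fun u => localRep 2 g q.1.1 u + b.coordFrame u (b.C q.1.2)) b.base
        (b.ι.symm X).1 = fderiv ℝ (localRep 2 g q.1.1) b.base (b.ι.symm X).1 +
          fderiv ℝ b.coordFrame b.base (b.ι.symm X).1 (b.C q.1.2) := by
    rw [fderiv_fun_add dG (dB.clm_apply (differentiableAt_const _)),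
      fderiv_clm_apply dB (differentiableAt_const _)]
    simp
  rw [h2, ← b.coordFrame_base]
  exact h

theorem fderiv_fderiv_localRep (hg : ContMDiffAt (𝓡 2) 𝓘(ℝ, Euc N) ∞ g q.1.1) (X Y : Euc n) :
    fderiv ℝ (fderiv ℝ (localRep n (totalMap V g) q)) (extChartAt (𝓡 n) q q) X Y =
      fderiv ℝ (fun x => fderiv ℝ (fun u => localRep 2 g q.1.1 u +
        b.coordFrame u (b.C q.1.2)) x (b.ι.symm Y).1) b.base (b.ι.symm X).1 +
      fderiv ℝ (fun x => b.coordFrame x (b.ι.symm Y).2) b.base (b.ι.symm X).1 +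
      fderiv ℝ (fun x => b.coordFrame x (b.ι.symm X).2) b.base (b.ι.symm Y).1 := by
  have h := fderiv_fderiv_bundleMap (z := (b.base, b.C q.1.2)) (contDiffAt_localRep hg)
    b.contDiffAt_coordFrame (b.ι.symm X) (b.ι.symm Y)
  rw [← h, b.localRep_totalMap']
  set F := (fun z : Euc 2 × Euc r => localRep 2 g q.1.1 z.1 + b.coordFrame z.1 z.2) with hF
  have h1 : fderiv ℝ (F ∘ b.ι.symm) = fun w => (fderiv ℝ F (b.ι.symm w)).comp
      (b.ι.symm : Euc n →L[ℝ] Euc 2 × Euc r) := by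
    ext1 w
    exact b.ι.symm.comp_right_fderiv
  have hFd : DifferentiableAt ℝ (fderiv ℝ F) (b.base, b.C q.1.2) :=
    (contDiffAt_bundleMap (contDiffAt_localRep hg) b.contDiffAt_coordFrame).fderiv_infty.differentiableAt
      (by simp)
  have h2 : HasFDerivAt (fun w => fderiv ℝ F (b.ι.symm w))
      ((fderiv ℝ (fderiv ℝ F) (b.base, b.C q.1.2)).comp
        (b.ι.symm : Euc n →L[ℝ] Euc 2 × Euc r)) (extChartAt (𝓡 n) q q) := by
    refine HasFDerivAt.comp _ ?_ b.ι.symm.hasFDerivAt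
    rw [b.extChartAt_self, b.ι.symm_apply_apply]
    exact hFd.hasFDerivAt
  rw [h1, (h2.clm_comp (hasFDerivAt_const _ _)).fderiv]
  simp

theorem diff_totalMap (hg : ContMDiffAt (𝓡 2) 𝓘(ℝ, Euc N) ∞ g q.1.1) (X : Euc n) :
    diff n (totalMap V g) q X =
      fderiv ℝ (fun u => localRep 2 g q.1.1 u + b.coordFrame u (b.C q.1.2)) b.base
        (b.ι.symm X).1 + b.B q.1.1 (b.ι.symm X).2 := by
  rw [diff_eq_fderiv ((b.contMDiffAt_totalMap hg).mdifferentiableAt (by simp))]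
  exact b.fderiv_localRep hg X

end BundleChart

/-- The inclusion of an affine fibre is smooth. -/
theorem contMDiffAt_fibre (hb : ∀ q, Nonempty (BundleChart V r n q))
    (q : {q : L × Euc N // q.2 ∈ V q.1}) (w : V q.1.1) :
    ContMDiffAt 𝓘(ℝ, V q.1.1) (𝓡 n) ∞ (fun w : V q.1.1 =>
      (⟨(q.1.1, q.1.2 + w), add_mem q.2 w.2⟩ : {q : L × Euc N // q.2 ∈ V q.1})) w := by
  obtain ⟨b⟩ := hb ⟨(q.1.1, q.1.2 + w), add_mem q.2 w.2⟩
  rw [contMDiffAt_iff]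
  refine ⟨?_, ?_⟩
  · have : Continuous fun w : V q.1.1 => (q.1.1, q.1.2 + (w : Euc N)) := by fun_prop
    exact (this.subtype_mk fun w => add_mem q.2 w.2).continuousAt
  · rw [ModelWithCorners.range_eq_univ, contDiffWithinAt_univ]
    have h : ContDiff ℝ ∞ fun w' : V q.1.1 =>
        b.ι (extChartAt (𝓡 2) q.1.1 q.1.1, b.C (q.1.2 + w')) :=
      b.ι.contDiff.comp (contDiff_const.prodMk (b.C.contDiff.comp
        (contDiff_const.add (V q.1.1).subtypeL.contDiff)))
    refine h.contDiffAt.congr_of_eventuallyEq (.of_forall fun w' => ?_)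
    exact b.coe_eq _

omit [ChartedSpace (Euc 2) L] [ChartedSpace (Euc n) {q : L × Euc N // q.2 ∈ V q.1}] in
-- Through each point q passes a continuous section, obtained by projecting the fibre vector of q to
-- the nearby fibres.
theorem isOpenMap_bundleProj (hP : Continuous fun x => (V x).starProjection) :
    IsOpenMap fun q : {q : L × Euc N // q.2 ∈ V q.1} => q.1.1 := by
  rw [isOpenMap_iff_nhds_le]
  intro q
  let σ : L → {q : L × Euc N // q.2 ∈ V q.1} := fun x =>
    ⟨(x, (V x).starProjection q.1.2), Submodule.starProjection_apply_mem _ _⟩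
  have hσ : Continuous σ :=
    (continuous_id.prodMk (hP.clm_apply continuous_const)).subtype_mk _
  have hσq : σ q.1.1 = q := Subtype.ext (Prod.ext rfl (Submodule.starProjection_eq_self_iff.2 q.2))
  have h : Filter.map (fun q : {q : L × Euc N // q.2 ∈ V q.1} => q.1.1)
      (Filter.map σ (𝓝 q.1.1)) = 𝓝 q.1.1 := by
    rw [Filter.map_map]
    exact Filter.map_id
  rw [← h]
  refine Filter.map_mono ?_
  conv_rhs => rw [← hσq]
  exact hσ.continuousAt

end TotalMap

/-! ### Uniqueness of leading terms; normal parts of sections -/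

section LeadingTerms

variable {N : ℕ} {G : Euc 2 → Euc N} {u : Euc 2} {A B : Euc 2 → ℝ} {j : ℕ} {s : Euc 2 → Euc N}
  {p q : Euc 2 → ℝ}

/-- The equations say (X₀ + X₁θ)(p + qθ) = 0 in a field, with nonzero second factor. -/
theorem eq_zero_of_elliptic {a b p q : ℝ} (h : b ^ 2 < 4 * a) (h0 : p ≠ 0 ∨ q ≠ 0) {X : Euc 2}
    (k0 : X 0 * p - X 1 * (a * q) = 0) (k1 : X 0 * q + X 1 * (p - b * q) = 0) : X = 0 := by
  have hdet := elliptic_det_ne_zero h h0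
  have h1 : X 0 = 0 := (mul_eq_zero.1 (show X 0 * (p * (p - b * q) + a * q ^ 2) = 0 by
    linear_combination (p - b * q) * k0 + a * q * k1)).resolve_right hdet
  have h2 : X 1 = 0 := (mul_eq_zero.1 (show X 1 * (p * (p - b * q) + a * q ^ 2) = 0 by
    linear_combination p * k1 - q * k0)).resolve_right hdet
  rw [euc_two_eq X, h1, h2]
  simp

theorem Lead.sub_mem_osc (h : Lead G u j s p q) :
    s u - (p u • frame G j 0 u + q u • frame G j 1 u) ∈ osc G u j :=
  mem_osc_of_mem_jetSec h.2.2

/-- When the osculating space grows by two, the two leading terms are independent modulo the lower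
order, so the leading coefficients at `u` are determined by the value at `u`. -/
theorem Lead.eq_zero (hG : ContDiffAt ℝ ∞ G u) (he : IsEllipticWith G u A B)
    (hr : Module.finrank ℝ (osc G u (j + 1)) = Module.finrank ℝ (osc G u j) + 2)
    (h : Lead G u j s p q) (hs : s u ∈ osc G u j) : p u = 0 ∧ q u = 0 := by
  have h1 : p u • frame G j 0 u + q u • frame G j 1 u ∈ osc G u j := by
    have := sub_mem hs h.sub_mem_osc
    rwa [sub_sub_cancel] at this
  have key : ∀ v w : Euc N, osc G u (j + 1) = osc G u j ⊔ Submodule.span ℝ {v, w} →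
      v ∉ osc G u j ⊔ Submodule.span ℝ {w} := by
    intro v w hvw hv
    have h2 : osc G u (j + 1) ≤ osc G u j ⊔ Submodule.span ℝ {w} := by
      rw [hvw]
      refine sup_le le_sup_left ?_
      rw [Submodule.span_le]
      rintro z (rfl | rfl)
      · exact hv
      · exact Submodule.mem_sup_right (Submodule.mem_span_singleton_self _)
    have h3 := Submodule.finrank_mono h2
    have h4 := Submodule.finrank_add_le_finrank_add_finrank (osc G u j) (Submodule.span ℝ {w})
    have h5 : Module.finrank ℝ (Submodule.span ℝ {w}) ≤ 1 := by
      simpa using finrank_span_le_card (R := ℝ) ({w} : Set (Euc N))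
    omega
  have hf := osc_succ_eq_frame hG he j
  constructor
  · by_contra hp
    refine key _ _ hf ((Submodule.smul_mem_iff _ hp).1 ?_)
    have h2 : q u • frame G j 1 u ∈ osc G u j ⊔ Submodule.span ℝ {frame G j 1 u} :=
      Submodule.mem_sup_right (Submodule.smul_mem _ _ (Submodule.mem_span_singleton_self _))
    have := sub_mem (Submodule.mem_sup_left h1) h2
    rwa [add_sub_cancel_right] at this
  · by_contra hq
    refine key (frame G j 1 u) (frame G j 0 u) (by rw [hf, Set.pair_comm]) ((Submodule.smul_mem_iff _ hq).1 ?_)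
    have h2 : p u • frame G j 0 u ∈ osc G u j ⊔ Submodule.span ℝ {frame G j 0 u} :=
      Submodule.mem_sup_right (Submodule.smul_mem _ _ (Submodule.mem_span_singleton_self _))
    have := sub_mem (Submodule.mem_sup_left h1) h2
    rwa [add_sub_cancel_left] at this

theorem inner_fderiv_eq_neg {E F : Type*} [NormedAddCommGroup E] [NormedSpace ℝ E]
    [NormedAddCommGroup F] [InnerProductSpace ℝ F] {s t : E → F} {u : E}
    (hs : DifferentiableAt ℝ s u) (ht : DifferentiableAt ℝ t u)
    (h : ∀ᶠ x in 𝓝 u, inner ℝ (s x) (t x) = 0) (X : E) :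
    inner ℝ (fderiv ℝ s u X) (t u) = - inner ℝ (s u) (fderiv ℝ t u X) := by
  have h1 : fderiv ℝ (fun x => inner ℝ (s x) (t x)) u = 0 := by
    have : (fun x => inner ℝ (s x) (t x)) =ᶠ[𝓝 u] fun _ => (0 : ℝ) := h
    rw [this.fderiv_eq]
    simp
  have h2 := fderiv_inner_apply ℝ hs ht X
  rw [h1] at h2
  simp only [zero_apply] at h2
  linarith

/-- The component of a section orthogonal to the tangent planes of `G`. -/
def normalPart (G : Euc 2 → Euc N) (s : Euc 2 → Euc N) (x : Euc 2) : Euc N :=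
  s x - (osc G x 1).starProjection (s x)

theorem starProjection_osc_one_mem_jetSec (hG : ContDiffAt ℝ ∞ G u)
    (hi : Function.Injective (fderiv ℝ G u)) (hs : ContDiffAt ℝ ∞ s u) :
    (fun x => (osc G x 1).starProjection (s x)) ∈ jetSec G u 1 := by
  have h := tangentProj_mem_jetSec hG hi hs
  simp_rw [← starProjection_congr osc_one] at h
  exact h

theorem normalPart_mem_orthogonal (x : Euc 2) : normalPart G s x ∈ (osc G x 1)ᗮ :=
  Submodule.sub_starProjection_mem_orthogonal _

theorem normalPart_mem_jetSec (hG : ContDiffAt ℝ ∞ G u)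
    (hi : Function.Injective (fderiv ℝ G u)) (hs : s ∈ jetSec G u (j + 1)) :
    normalPart G s ∈ jetSec G u (j + 1) :=
  sub_mem hs (jetSec_mono (by omega)
    (starProjection_osc_one_mem_jetSec hG hi (contDiffAt_of_mem_jetSec hG hs)))

/-- The discarded tangential part is a section of order 1, so its derivative has order at most 2. -/
theorem fderiv_normalPart_sub_mem (hG : ContDiffAt ℝ ∞ G u)
    (hi : Function.Injective (fderiv ℝ G u)) (hs : ContDiffAt ℝ ∞ s u) (X : Euc 2) :
    fderiv ℝ (normalPart G s) u X - fderiv ℝ s u X ∈ osc G u 2 := by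
  have h := starProjection_osc_one_mem_jetSec hG hi hs
  have h1 := mem_osc_of_mem_jetSec (fderiv_mem_jetSec hG h X)
  have h2 : fderiv ℝ (normalPart G s) u X =
      fderiv ℝ s u X - fderiv ℝ (fun x => (osc G x 1).starProjection (s x)) u X := by
    unfold normalPart
    rw [fderiv_fun_sub (hs.differentiableAt (by simp))
      ((contDiffAt_of_mem_jetSec hG h).differentiableAt (by simp))]
    rfl
  rw [h2, sub_sub_cancel_left]
  exact neg_mem h1

end LeadingTerms

/-! ### Frames of the normal sums and their derivatives -/

section NormalFrame

variable {N r k : ℕ} {G : Euc 2 → Euc N} {u : Euc 2} {A B : Euc 2 → ℝ}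
  {E : Euc 2 → Euc r →L[ℝ] Euc N} {C : Euc N →L[ℝ] Euc r}

/-- `E` is a smooth frame near `u` of the bundle of vectors in the `(k+1)`-st osculating space of
`G` that are orthogonal to the tangent plane, and `C` gives the coordinates in that frame. -/
structure IsNormalFrame (G : Euc 2 → Euc N) (u : Euc 2) (k : ℕ) (E : Euc 2 → Euc r →L[ℝ] Euc N)
    (C : Euc N →L[ℝ] Euc r) : Prop where
  smooth : ContDiffAt ℝ ∞ E u
  mem : ∀ᶠ x in 𝓝 u, ∀ t, E x t ∈ osc G x (k + 1) ⊓ (osc G x 1)ᗮ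
  left_inv : ∀ᶠ x in 𝓝 u, ∀ t, C (E x t) = t
  right_inv : ∀ᶠ x in 𝓝 u, ∀ ξ ∈ osc G x (k + 1) ⊓ (osc G x 1)ᗮ, E x (C ξ) = ξ

/-- The span of the frame and of its first derivatives. -/
def mixedSpan (E : Euc 2 → Euc r →L[ℝ] Euc N) (u : Euc 2) : Submodule ℝ (Euc N) :=
  LinearMap.range (E u).toLinearMap ⊔
    Submodule.span ℝ (Set.range fun p : Euc 2 × Euc r => fderiv ℝ (fun x => E x p.2) u p.1)

namespace IsNormalFrame

variable (hE : IsNormalFrame G u k E C)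
include hE

theorem range_eq : LinearMap.range (E u).toLinearMap = osc G u (k + 1) ⊓ (osc G u 1)ᗮ := by
  apply le_antisymm
  · rintro _ ⟨t, rfl⟩
    exact hE.mem.self_of_nhds t
  · intro ξ hξ
    exact ⟨C ξ, hE.right_inv.self_of_nhds ξ hξ⟩

theorem injective : Function.Injective (E u) :=
  Function.LeftInverse.injective hE.left_inv.self_of_nhds

theorem contDiffAt_apply (t : Euc r) : ContDiffAt ℝ ∞ (fun x => E x t) u :=
  hE.smooth.clm_apply contDiffAt_const

theorem mem_jetSec (hG : ContDiffAt ℝ ∞ G u)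
    (hr : ∀ᶠ x in 𝓝 u, Module.finrank ℝ (osc G x (k + 1)) = Module.finrank ℝ (osc G u (k + 1)))
    (t : Euc r) : (fun x => E x t) ∈ jetSec G u (k + 1) :=
  mem_jetSec_of_eventually_mem_osc hG hr (hE.contDiffAt_apply t)
    (hE.mem.mono fun _ hx => (hx t).1)

/-- Write s = E(C s) near `u`: the product rule gives a value of E plus a derivative of E with
constant coordinates. -/
theorem fderiv_section_mem {s : Euc 2 → Euc N} (hs : ContDiffAt ℝ ∞ s u)
    (hm : ∀ᶠ x in 𝓝 u, s x ∈ osc G x (k + 1) ⊓ (osc G x 1)ᗮ) (X : Euc 2) :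
    fderiv ℝ s u X ∈ mixedSpan E u := by
  have h1 : s =ᶠ[𝓝 u] fun x => E x (C (s x)) := by
    filter_upwards [hm, hE.right_inv] with x h2 h3
    exact (h3 _ h2).symm
  have hEd : DifferentiableAt ℝ E u := hE.smooth.differentiableAt (by simp)
  have hsd : DifferentiableAt ℝ s u := hs.differentiableAt (by simp)
  have h2 : fderiv ℝ (fun x => E x (C (s u))) u X = fderiv ℝ E u X (C (s u)) := by
    rw [fderiv_clm_apply hEd (differentiableAt_const _)]
    simp
  have hCs : HasFDerivAt (fun x => C (s x)) (C.comp (fderiv ℝ s u)) u :=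
    C.hasFDerivAt.comp u hsd.hasFDerivAt
  have h3 : fderiv ℝ s u X = E u (C (fderiv ℝ s u X)) + fderiv ℝ E u X (C (s u)) := by
    conv_lhs => rw [h1.fderiv_eq, fderiv_clm_apply hEd hCs.differentiableAt, hCs.fderiv]
    simp
  rw [h3, ← h2]
  exact add_mem (Submodule.mem_sup_left ⟨_, rfl⟩)
    (Submodule.mem_sup_right (Submodule.subset_span ⟨(X, C (s u)), rfl⟩))

theorem fderiv_normalPart_mem (hG : ContDiffAt ℝ ∞ G u) (hi : Function.Injective (fderiv ℝ G u))
    {j : ℕ} (hj : j ≤ k) {s : Euc 2 → Euc N} (hs : s ∈ jetSec G u (j + 1)) (X : Euc 2) :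
    fderiv ℝ (normalPart G s) u X ∈ mixedSpan E u := by
  have h := jetSec_mono (Nat.succ_le_succ hj) (normalPart_mem_jetSec hG hi hs)
  refine hE.fderiv_section_mem (contDiffAt_of_mem_jetSec hG h) ?_ X
  filter_upwards [eventually_mem_osc h] with x hx
  exact ⟨hx, normalPart_mem_orthogonal x⟩

/-- The frame contains N_1, so only the tangent plane has to be recovered. It appears in the
derivatives of normal sections: ⟨∂_X S, ∂_d G⟩ = −⟨S, ∂_X ∂_d G⟩, a shape operator. Taking for S the
normal parts S₀, S₁ of ∂₀∂₀G, ∂₀∂₁G, two combinations of their derivatives stay in the second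
osculating space and have independent tangential parts. -/
theorem osc_two_le (hG : ContDiffAt ℝ ∞ G u) (he : IsEllipticWith G u A B)
    (hi : Function.Injective (fderiv ℝ G u)) (hk : 1 ≤ k)
    (hr : Module.finrank ℝ (osc G u 2) = Module.finrank ℝ (osc G u 1) + 2) :
    osc G u 2 ≤ mixedSpan E u := by
  set W := mixedSpan E u with hW
  set S : Fin 2 → Euc 2 → Euc N := fun c => normalPart G (frame G 1 c) with hS
  have hf0 : ∀ d, DifferentiableAt ℝ (frame G 0 d) u := fun d =>
    (contDiffAt_frame hG 0 d).differentiableAt (by simp)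
  have hSj : ∀ c, S c ∈ jetSec G u 2 := fun c =>
    normalPart_mem_jetSec hG hi (frame_mem_jetSec hG 1 c)
  have hSd : ∀ c, DifferentiableAt ℝ (S c) u := fun c =>
    (contDiffAt_of_mem_jetSec hG (hSj c)).differentiableAt (by simp)
  have hSW : ∀ c X, fderiv ℝ (S c) u X ∈ W := fun c X =>
    hE.fderiv_normalPart_mem hG hi hk (frame_mem_jetSec hG 1 c) X
  have hSo : ∀ c, ∀ w ∈ osc G u 1, inner ℝ (S c u) w = 0 := fun c w hw =>
    Submodule.inner_left_of_mem_orthogonal hw (normalPart_mem_orthogonal u)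
  have hSD : ∀ c X, fderiv ℝ (S c) u X - fderiv ℝ (frame G 1 c) u X ∈ osc G u 2 := fun c X =>
    fderiv_normalPart_sub_mem hG hi (contDiffAt_frame hG 1 c) X
  have hpair : ∀ c d X, inner ℝ (fderiv ℝ (S c) u X) (frame G 0 d u) =
      - inner ℝ (S c u) (fderiv ℝ (frame G 0 d) u X) := by
    intro c d X
    refine inner_fderiv_eq_neg (hSd c) (hf0 d) ?_ X
    filter_upwards [eventually_mem_osc (frame_mem_jetSec hG 0 d)] with x hx
    exact Submodule.inner_left_of_mem_orthogonal hx (normalPart_mem_orthogonal x)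
  have hI : ∀ c d, inner ℝ (S c u) (frame G 1 d u) = inner ℝ (S c u) (S d u) := by
    intro c d
    have h1 : frame G 1 d u = S d u + (osc G u 1).starProjection (frame G 1 d u) :=
      (sub_add_cancel _ _).symm
    rw [h1, inner_add_right, hSo c _ (Submodule.starProjection_apply_mem _ _), add_zero]
  have d00 : fderiv ℝ (frame G 0 0) u e₀ = frame G 1 0 u := rfl
  have d01 : fderiv ℝ (frame G 0 1) u e₀ = frame G 1 1 u := rfl
  have d10 : fderiv ℝ (frame G 0 0) u e₁ = frame G 1 1 u := (fderiv_frame_zero hG 0).self_of_nhds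
  have d11 : fderiv ℝ (frame G 0 1) u e₁ + A u • frame G 1 0 u + B u • frame G 1 1 u ∈
      osc G u 1 := mem_osc_of_mem_jetSec (fderiv_frame_one hG he 0)
  -- Q = |(B/2)S₀ + S₁|² + (A − B²/4)|S₀|², which vanishes only if S₀ = 0; that would make ∂₀∂₀G
  -- tangent, against the growth of rank.
  set Q : ℝ := A u * inner ℝ (S 0 u) (S 0 u) + B u * inner ℝ (S 0 u) (S 1 u) +
    inner ℝ (S 1 u) (S 1 u) with hQ
  have hQ0 : Q ≠ 0 := by
    intro hQ0
    have hAB := he.2.2.1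
    have hn : Q = A u * ‖S 0 u‖ ^ 2 + B u * inner ℝ (S 0 u) (S 1 u) + ‖S 1 u‖ ^ 2 := by
      rw [hQ, real_inner_self_eq_norm_sq, real_inner_self_eq_norm_sq]
    have h1 : ‖(B u / 2) • S 0 u + S 1 u‖ ^ 2 =
        B u ^ 2 / 4 * ‖S 0 u‖ ^ 2 + B u * inner ℝ (S 0 u) (S 1 u) + ‖S 1 u‖ ^ 2 := by
      rw [norm_add_sq_real, norm_smul, inner_smul_left, mul_pow]
      simp only [Real.norm_eq_abs, sq_abs, conj_trivial]
      ring
    have h2 : ‖S 0 u‖ ^ 2 = 0 := by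
      nlinarith [sq_nonneg ‖(B u / 2) • S 0 u + S 1 u‖, sq_nonneg ‖S 0 u‖]
    have h3 : frame G 1 0 u ∈ osc G u 1 := by
      have h4 : S 0 u = 0 := by simpa using h2
      rw [show frame G 1 0 u = (osc G u 1).starProjection (frame G 1 0 u) from sub_eq_zero.1 h4]
      exact Submodule.starProjection_apply_mem _ _
    have hL : Lead G u 1 (frame G 1 0) (fun _ => 1) fun _ => 0 :=
      ⟨contDiffAt_const, contDiffAt_const, by simp⟩
    exact one_ne_zero (hL.eq_zero hG he hr h3).1
  -- The third order terms cancel in `y` by the elliptic equation and in `y'` by symmetry of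
  -- derivatives. Paired with ∂₀G and ∂₁G, `y'` gives (0, Q), and `y` gives −Q in the first place,
  -- so the pairing is triangular and the second entry of `y` is not needed.
  set y : Euc N := fderiv ℝ (S 1) u e₁ + A u • fderiv ℝ (S 0) u e₀ + B u • fderiv ℝ (S 1) u e₀
    with hy
  set y' : Euc N := fderiv ℝ (S 0) u e₁ - fderiv ℝ (S 1) u e₀ with hy'
  have hyW : y ∈ W :=
    add_mem (add_mem (hSW _ _) (Submodule.smul_mem _ _ (hSW _ _))) (Submodule.smul_mem _ _ (hSW _ _))
  have hyW' : y' ∈ W := sub_mem (hSW _ _) (hSW _ _)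
  have hy2 : y ∈ osc G u 2 := by
    have h1 : fderiv ℝ (frame G 1 1) u e₁ + A u • fderiv ℝ (frame G 1 0) u e₀ +
        B u • fderiv ℝ (frame G 1 1) u e₀ ∈ osc G u 2 :=
      mem_osc_of_mem_jetSec (fderiv_frame_one hG he 1)
    have h2 := add_mem (add_mem (hSD 1 e₁) (Submodule.smul_mem _ (A u) (hSD 0 e₀)))
      (Submodule.smul_mem _ (B u) (hSD 1 e₀))
    convert add_mem h1 h2 using 1
    rw [hy]
    module
  have hy2' : y' ∈ osc G u 2 := by
    have h1 : fderiv ℝ (frame G 1 0) u e₁ = fderiv ℝ (frame G 1 1) u e₀ :=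
      (fderiv_frame_zero hG 1).self_of_nhds
    have h2 := sub_mem (hSD 0 e₁) (hSD 1 e₀)
    rw [h1, sub_sub_sub_cancel_right] at h2
    exact h2
  have i11 : ∀ c, inner ℝ (S c u) (fderiv ℝ (frame G 0 1) u e₁) =
      - (A u * inner ℝ (S c u) (S 0 u) + B u * inner ℝ (S c u) (S 1 u)) := by
    intro c
    have h1 := hSo c _ d11
    rw [inner_add_right, inner_add_right, inner_smul_right, inner_smul_right, hI, hI] at h1
    linarith
  have hc : inner ℝ (S 1 u) (S 0 u) = inner ℝ (S 0 u) (S 1 u) := real_inner_comm _ _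
  have p0' : inner ℝ y' (frame G 0 0 u) = 0 := by
    rw [hy', inner_sub_left, hpair, hpair, d10, d00, hI, hI, hc]
    ring
  have p1' : inner ℝ y' (frame G 0 1 u) = Q := by
    rw [hy', inner_sub_left, hpair, hpair, d01, i11, hI, hQ]
    ring
  have p0 : inner ℝ y (frame G 0 0 u) = -Q := by
    rw [hy, inner_add_left, inner_add_left, inner_smul_left, inner_smul_left, hpair, hpair, hpair,
      d10, d00, hI, hI, hI, hQ, hc]
    simp only [conj_trivial]
    ring
  have hV : osc G u 2 ⊓ (osc G u 1)ᗮ ≤ W := by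
    refine le_trans ?_ (le_sup_left : LinearMap.range (E u).toLinearMap ≤ W)
    rw [hE.range_eq]
    exact inf_le_inf_right _ (osc_mono (by omega))
  -- Let z in the second osculating space be orthogonal to its part in W. The component of z in N_1
  -- vanishes because N_1 lies in W, and then the pairings with `y'` and `y` kill both tangential
  -- coordinates.
  have hbot : osc G u 2 ⊓ (osc G u 2 ⊓ W)ᗮ = ⊥ := by
    rw [eq_bot_iff]
    rintro z ⟨hz, hzW⟩
    have hort : ∀ w ∈ osc G u 2, w ∈ W → inner ℝ w z = 0 := fun w h1 h2 =>
      Submodule.inner_right_of_mem_orthogonal (K := osc G u 2 ⊓ W) ⟨h1, h2⟩ hzW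
    have hsplit := sup_inf_orthogonal (osc_mono (G := G) (u := u) (show 1 ≤ 2 by norm_num))
    have hz' := hz
    rw [← hsplit] at hz'
    obtain ⟨a, ha, b, hb, rfl⟩ := Submodule.mem_sup.1 hz'
    have hb0 : b = 0 := by
      have h1 := hort b hb.1 (hV hb)
      rw [inner_add_right, Submodule.inner_left_of_mem_orthogonal ha hb.2, zero_add] at h1
      exact inner_self_eq_zero.1 h1
    subst hb0
    rw [add_zero] at hort ⊢
    have ha' := ha
    rw [osc_succ_eq_frame hG he 0, osc_zero, bot_sup_eq, Submodule.mem_span_pair] at ha'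
    obtain ⟨α, β, rfl⟩ := ha'
    have h1 := hort y' hy2' hyW'
    have h2 := hort y hy2 hyW
    rw [inner_add_right, inner_smul_right, inner_smul_right, p0', p1', mul_zero, zero_add] at h1
    have hβ : β = 0 := (mul_eq_zero.1 h1).resolve_right hQ0
    rw [hβ, inner_add_right, inner_smul_right, p0, zero_smul, inner_zero_right, add_zero] at h2
    have hα : α = 0 := (mul_eq_zero.1 h2).resolve_right (neg_ne_zero.2 hQ0)
    simp [hα, hβ]
  have h1 := sup_inf_orthogonal (inf_le_left : osc G u 2 ⊓ W ≤ osc G u 2)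
  rw [hbot, sup_bot_eq] at h1
  exact inf_eq_left.1 h1

/-- The span of the frame and of its derivatives is the next osculating space. -/
theorem mixedSpan_eq (hG : ContDiffAt ℝ ∞ G u) (he : IsEllipticWith G u A B)
    (hi : Function.Injective (fderiv ℝ G u)) (hk : 1 ≤ k)
    (h2 : Module.finrank ℝ (osc G u 2) = Module.finrank ℝ (osc G u 1) + 2)
    (hr : ∀ᶠ x in 𝓝 u, Module.finrank ℝ (osc G x (k + 1)) = Module.finrank ℝ (osc G u (k + 1))) :
    mixedSpan E u = osc G u (k + 2) := by
  have h2W := hE.osc_two_le hG he hi hk h2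
  apply le_antisymm
  · refine sup_le ?_ (Submodule.span_le.2 ?_)
    · rw [hE.range_eq]
      exact inf_le_left.trans (osc_mono (by omega))
    · rintro _ ⟨⟨X, t⟩, rfl⟩
      exact mem_osc_of_mem_jetSec (fderiv_mem_jetSec hG (hE.mem_jetSec hG hr t) X)
  · have h1 : osc G u (k + 1) ≤ mixedSpan E u := by
      rw [← sup_inf_orthogonal (osc_mono (G := G) (u := u) (show 1 ≤ k + 1 by omega)),
        ← hE.range_eq]
      exact sup_le ((osc_mono (by norm_num)).trans h2W) le_sup_left
    rw [osc_succ_eq_frame hG he (k + 1)]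
    refine sup_le h1 ?_
    -- The normal part of ∂₀ᵏ∂_cG is a section of the frame bundle, and its derivative differs from
    -- ∂₀ᵏ⁺¹∂_cG by second order terms, which are already available.
    have h3 : ∀ c, frame G (k + 1) c u ∈ mixedSpan E u := by
      intro c
      have h4 := hE.fderiv_normalPart_mem hG hi le_rfl (frame_mem_jetSec hG k c) e₀
      have h5 := h2W (fderiv_normalPart_sub_mem hG hi (contDiffAt_frame hG k c) e₀)
      have := sub_mem h4 h5
      rwa [sub_sub_cancel] at this
    rw [Submodule.span_le]
    rintro w (rfl | rfl)
    exacts [h3 0, h3 1]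

end IsNormalFrame

end NormalFrame

/-! ### First and second derivatives of G + E t -/

namespace IsNormalFrame

variable {N r k : ℕ} {G : Euc 2 → Euc N} {u : Euc 2} {A B : Euc 2 → ℝ}
  {E : Euc 2 → Euc r →L[ℝ] Euc N} {C : Euc N →L[ℝ] Euc r} {t : Euc r} {p q : Euc 2 → ℝ}

variable (hE : IsNormalFrame G u k E C)
include hE

theorem exists_lead (hG : ContDiffAt ℝ ∞ G u) (he : IsEllipticWith G u A B)
    (hr : ∀ᶠ x in 𝓝 u, Module.finrank ℝ (osc G x (k + 1)) = Module.finrank ℝ (osc G u (k + 1)))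
    (ht : E u t ∉ osc G u k) :
    ∃ p q, Lead G u k (fun x => E x t) p q ∧ (p u ≠ 0 ∨ q u ≠ 0) := by
  obtain ⟨p, q, h⟩ := RuledImmersion.exists_lead hG he (hE.mem_jetSec hG hr t)
  refine ⟨p, q, h, ?_⟩
  by_contra! h0
  have := h.sub_mem_osc
  rw [h0.1, h0.2] at this
  simp only [zero_smul, add_zero, sub_zero] at this
  exact ht this

theorem lead_fderiv (hG : ContDiffAt ℝ ∞ G u) (he : IsEllipticWith G u A B)
    (h : Lead G u k (fun x => E x t) p q) (X : Euc 2) :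
    Lead G u (k + 1) (fun x => fderiv ℝ (fun y => G y + E y t) x X)
      (fun x => X 0 * p x - X 1 * (A x * q x))
      (fun x => X 0 * q x + X 1 * (p x - B x * q x)) := by
  have h1 := (h.fderiv hG he X).add_jetSec
    (jetSec_mono (show 1 ≤ k + 1 by omega) (fderiv_self_mem_jetSec (G := G) X))
  refine h1.congr ?_
  filter_upwards [hG.eventually_differentiableAt,
    (hE.contDiffAt_apply t).eventually_differentiableAt] with x hx hx'
  rw [fderiv_fun_add hx hx']
  simp [add_comm]

/-- The vertical part `E u v` has order at most k + 1, whereas the horizontal part has leading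
number (X₀ + X₁θ)ζ at order k + 2 with ζ ≠ 0. Hence X = 0, and then v = 0 by injectivity of the
frame. -/
theorem fderiv_add_eq_zero (hG : ContDiffAt ℝ ∞ G u) (he : IsEllipticWith G u A B)
    (hr : ∀ᶠ x in 𝓝 u, Module.finrank ℝ (osc G x (k + 1)) = Module.finrank ℝ (osc G u (k + 1)))
    (hr2 : Module.finrank ℝ (osc G u (k + 2)) = Module.finrank ℝ (osc G u (k + 1)) + 2)
    (ht : E u t ∉ osc G u k) {X : Euc 2} {v : Euc r}
    (h : fderiv ℝ (fun y => G y + E y t) u X + E u v = 0) : X = 0 ∧ v = 0 := by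
  obtain ⟨p, q, hl, h0⟩ := hE.exists_lead hG he hr ht
  have h1 : fderiv ℝ (fun y => G y + E y t) u X ∈ osc G u (k + 1) := by
    rw [eq_neg_of_add_eq_zero_left h]
    exact neg_mem (hE.mem.self_of_nhds v).1
  obtain ⟨h2, h3⟩ := (hE.lead_fderiv hG he hl X).eq_zero hG he hr2 h1
  have hX : X = 0 := eq_zero_of_elliptic he.2.2.1 h0 h2 h3
  refine ⟨hX, hE.injective ?_⟩
  rw [hX, map_zero, zero_add] at h
  rw [h, map_zero]

/-- On the zero section the horizontal part is tangent to `G` and the vertical part is normal to it,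
so they cannot cancel. -/
theorem fderiv_add_eq_zero_of_zero (hi : Function.Injective (fderiv ℝ G u)) {X : Euc 2}
    {v : Euc r} (h : fderiv ℝ (fun y => G y + E y 0) u X + E u v = 0) : X = 0 ∧ v = 0 := by
  simp only [map_zero, add_zero] at h
  have h1 : fderiv ℝ G u X ∈ osc G u 1 := by
    rw [osc_one]
    exact ⟨X, rfl⟩
  have h2 := (hE.mem.self_of_nhds v).2
  have h3 : E u v = - fderiv ℝ G u X := eq_neg_of_add_eq_zero_right h
  have h4 : fderiv ℝ G u X = 0 := by
    have h5 := Submodule.inner_right_of_mem_orthogonal h1 h2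
    rw [h3, inner_neg_right, neg_eq_zero] at h5
    exact inner_self_eq_zero.1 h5
  constructor
  · exact hi (by rw [h4, map_zero])
  · refine hE.injective ?_
    rw [h3, h4, neg_zero, map_zero]

/-- Already ∂₀∂₀ and ∂₁∂₀ suffice: their leading numbers ζ and θζ form a real basis, so both leading
terms of order k + 3 are obtained modulo lower order. -/
theorem osc_le_of_second_fderiv (hG : ContDiffAt ℝ ∞ G u) (he : IsEllipticWith G u A B)
    (hr : ∀ᶠ x in 𝓝 u, Module.finrank ℝ (osc G x (k + 1)) = Module.finrank ℝ (osc G u (k + 1)))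
    (ht : E u t ∉ osc G u k) {S : Submodule ℝ (Euc N)} (hS : osc G u (k + 2) ≤ S)
    (h : ∀ X Y, fderiv ℝ (fun x => fderiv ℝ (fun y => G y + E y t) x Y) u X ∈ S) :
    osc G u (k + 3) ≤ S := by
  obtain ⟨p, q, hl, h0⟩ := hE.exists_lead hG he hr ht
  have h1 := fun X Y => sub_mem (h X Y)
    (hS ((hE.lead_fderiv hG he hl Y).fderiv hG he X).sub_mem_osc)
  simp only [sub_sub_cancel] at h1
  have k0 := h1 e₀ e₀
  have k1 := h1 e₁ e₀
  simp only [PiLp.single_apply] at k0 k1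
  simp only [if_true, one_mul, zero_mul, sub_zero, add_zero, zero_sub, zero_add, zero_ne_one,
    one_ne_zero, if_false] at k0 k1
  have h2 := mem_of_elliptic he.2.2.1 h0 k0 k1
  rw [osc_succ_eq_frame hG he (k + 2)]
  refine sup_le hS ?_
  rw [Submodule.span_le]
  rintro w (rfl | rfl)
  exacts [h2.1, h2.2]

theorem second_fderiv_mem (hG : ContDiffAt ℝ ∞ G u)
    (hr : ∀ᶠ x in 𝓝 u, Module.finrank ℝ (osc G x (k + 1)) = Module.finrank ℝ (osc G u (k + 1)))
    (X Y : Euc 2) :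
    fderiv ℝ (fun x => fderiv ℝ (fun y => G y + E y t) x Y) u X ∈ osc G u (k + 3) := by
  have h1 : (fun x => fderiv ℝ (fun y => G y + E y t) x Y) ∈ jetSec G u (k + 2) := by
    have h2 := add_mem (jetSec_mono (show 1 ≤ k + 2 by omega) (fderiv_self_mem_jetSec (G := G) Y))
      (fderiv_mem_jetSec hG (hE.mem_jetSec hG hr t) Y)
    refine jetSec_congr h2 ?_
    filter_upwards [hG.eventually_differentiableAt,
      (hE.contDiffAt_apply t).eventually_differentiableAt] with x hx hx'
    rw [fderiv_fun_add hx hx']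
    rfl
  exact mem_osc_of_mem_jetSec (fderiv_mem_jetSec hG h1 X)

theorem fderiv_mem (hG : ContDiffAt ℝ ∞ G u)
    (hr : ∀ᶠ x in 𝓝 u, Module.finrank ℝ (osc G x (k + 1)) = Module.finrank ℝ (osc G u (k + 1)))
    (X : Euc 2) : fderiv ℝ (fun y => G y + E y t) u X ∈ osc G u (k + 2) := by
  rw [fderiv_fun_add (hG.differentiableAt (by simp))
    ((hE.contDiffAt_apply t).differentiableAt (by simp))]
  exact add_mem (mem_osc_of_mem_jetSec (jetSec_mono (show 1 ≤ k + 2 by omega)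
    (fderiv_self_mem_jetSec (G := G) X)))
    (mem_osc_of_mem_jetSec (fderiv_mem_jetSec hG (hE.mem_jetSec hG hr t) X))

/-- It is enough to test with Y = e₀: the leading number (X₀ + X₁θ)ζ at order k + 3 must vanish, and
ζ ≠ 0. -/
theorem eq_zero_of_second_fderiv_mem (hG : ContDiffAt ℝ ∞ G u) (he : IsEllipticWith G u A B)
    (hr : ∀ᶠ x in 𝓝 u, Module.finrank ℝ (osc G x (k + 1)) = Module.finrank ℝ (osc G u (k + 1)))
    (hr3 : Module.finrank ℝ (osc G u (k + 3)) = Module.finrank ℝ (osc G u (k + 2)) + 2)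
    (ht : E u t ∉ osc G u k) {X : Euc 2}
    (h : ∀ Y, fderiv ℝ (fun x => fderiv ℝ (fun y => G y + E y t) x Y) u X ∈ osc G u (k + 2)) :
    X = 0 := by
  obtain ⟨p, q, hl, h0⟩ := hE.exists_lead hG he hr ht
  obtain ⟨h1, h2⟩ := ((hE.lead_fderiv hG he hl e₀).fderiv hG he X).eq_zero hG he hr3 (h e₀)
  simp only [PiLp.single_apply] at h1 h2
  simp only [if_true, one_mul, zero_mul, sub_zero, add_zero, one_ne_zero, if_false] at h1 h2
  exact eq_zero_of_elliptic he.2.2.1 h0 h1 h2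

end IsNormalFrame

/-! ### Tangent and first normal spaces of the ruled map -/

section PointwiseGeometry

variable {N r n k : ℕ} {L : Type*} [TopologicalSpace L] [ChartedSpace (Euc 2) L]
  [IsManifold (𝓡 2) ∞ L] {g : L → Euc N}

theorem IsElliptic.normalSum_eq (hg : IsElliptic g) (x : L) (k : ℕ) :
    normalSum 2 g x k = oscAt 2 g x (k + 1) ⊓ (oscAt 2 g x 1)ᗮ :=
  RuledImmersion.normalSum_eq (hg.contMDiffAt x) (hg.injective x) k

theorem IsElliptic.normalSpace_succ_eq (hg : IsElliptic g) (x : L) (k : ℕ) :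
    normalSpace 2 g x (k + 1) = oscAt 2 g x (k + 2) ⊓ (oscAt 2 g x (k + 1))ᗮ :=
  RuledImmersion.normalSpace_succ_eq (hg.contMDiffAt x) (hg.injective x) k

/-- The osculating spaces of `g` of order up to `k` have the largest possible dimension. -/
def HasFullOsculation (g : L → Euc N) (k : ℕ) : Prop :=
  ∀ x, ∀ j ≤ k, Module.finrank ℝ (oscAt 2 g x j) = 2 * j

omit [IsManifold (𝓡 2) ∞ L] in
theorem oscAt_mono (g : L → Euc N) (x : L) {i j : ℕ} (h : i ≤ j) :
    oscAt 2 g x i ≤ oscAt 2 g x j :=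
  osc_mono h

variable [ChartedSpace (Euc n) (NormalTotal g k)] {q : NormalTotal g k}
  (b : BundleChart (fun x => normalSum 2 g x k) r n q)

namespace BundleChart

theorem isNormalFrame (hg : IsElliptic g) :
    IsNormalFrame (localRep 2 g q.1.1) b.base k b.coordFrame b.C where
  smooth := b.contDiffAt_coordFrame
  mem := by
    filter_upwards [hg.osc_localRep q.1.1] with u hu t
    rw [hu, hu, ← hg.normalSum_eq]
    exact b.mem _ t
  left_inv := b.tendsto_symm.eventually b.left_inv
  right_inv := by
    filter_upwards [hg.osc_localRep q.1.1, b.tendsto_symm.eventually b.right_inv] with u hu h ξ hξ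
    rw [hu, hu, ← hg.normalSum_eq] at hξ
    exact h ξ hξ

omit [IsManifold (𝓡 2) ∞ L] in
theorem finrank_osc (hfull : HasFullOsculation g (k + 4)) {j : ℕ} (hj : j ≤ k + 4) :
    Module.finrank ℝ (osc (localRep 2 g q.1.1) b.base j) = 2 * j :=
  hfull q.1.1 j hj

theorem eventually_finrank_osc (hg : IsElliptic g) (hfull : HasFullOsculation g (k + 4)) {j : ℕ}
    (hj : j ≤ k + 4) :
    ∀ᶠ u in 𝓝 b.base, Module.finrank ℝ (osc (localRep 2 g q.1.1) u j) =
      Module.finrank ℝ (osc (localRep 2 g q.1.1) b.base j) := by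
  rw [b.finrank_osc hfull hj]
  filter_upwards [hg.osc_localRep q.1.1] with u hu
  rw [hu, hfull _ j hj]

/-- The frame and its derivatives span the osculating space of order `k+2`. -/
theorem mixedSpan_eq (hg : IsElliptic g) (hfull : HasFullOsculation g (k + 4)) (hk : 1 ≤ k) :
    mixedSpan b.coordFrame b.base = oscAt 2 g q.1.1 (k + 2) := by
  obtain ⟨A, B, he⟩ := hg.exists_isEllipticWith q.1.1
  refine (b.isNormalFrame hg).mixedSpan_eq (hg.contDiffAt_localRep q.1.1) he
    (hg.injective_fderiv q.1.1) hk ?_ (b.eventually_finrank_osc hg hfull (by omega))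
  rw [b.finrank_osc hfull (by omega), b.finrank_osc hfull (by omega)]

omit [IsManifold (𝓡 2) ∞ L] in
theorem coordFrame_eq : b.coordFrame b.base (b.C q.1.2) = q.1.2 := by
  rw [b.coordFrame_base, b.B_C_self]

omit [IsManifold (𝓡 2) ∞ L] in
theorem range_B : LinearMap.range (b.B q.1.1).toLinearMap = normalSum 2 g q.1.1 k := by
  apply le_antisymm
  · rintro _ ⟨t, rfl⟩
    exact b.mem _ t
  · intro ξ hξ
    exact ⟨b.C ξ, b.right_inv.self_of_nhds ξ hξ⟩

theorem mixed_mem (hg : IsElliptic g) (hfull : HasFullOsculation g (k + 4)) (hk : 1 ≤ k)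
    (X : Euc 2) (t : Euc r) :
    fderiv ℝ (fun x => b.coordFrame x t) b.base X ∈ oscAt 2 g q.1.1 (k + 2) := by
  rw [← b.mixedSpan_eq hg hfull hk]
  exact Submodule.mem_sup_right (Submodule.subset_span ⟨(X, t), rfl⟩)

include b in
theorem contMDiffAt_ruledMap (hg : IsElliptic g) :
    ContMDiffAt (𝓡 n) 𝓘(ℝ, Euc N) ∞ (ruledMap g k) q :=
  b.contMDiffAt_totalMap (hg.contMDiffAt q.1.1)

theorem diff_ruledMap (hg : IsElliptic g) (X : Euc n) :
    diff n (ruledMap g k) q X =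
      fderiv ℝ (fun u => localRep 2 g q.1.1 u + b.coordFrame u (b.C q.1.2)) b.base
        (b.ι.symm X).1 + b.B q.1.1 (b.ι.symm X).2 :=
  b.diff_totalMap (hg.contMDiffAt q.1.1) X

theorem fderiv_fderiv_ruledMap (hg : IsElliptic g) (X Y : Euc n) :
    fderiv ℝ (fderiv ℝ (localRep n (ruledMap g k) q)) (extChartAt (𝓡 n) q q) X Y =
      fderiv ℝ (fun x => fderiv ℝ (fun u => localRep 2 g q.1.1 u +
        b.coordFrame u (b.C q.1.2)) x (b.ι.symm Y).1) b.base (b.ι.symm X).1 +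
      fderiv ℝ (fun x => b.coordFrame x (b.ι.symm Y).2) b.base (b.ι.symm X).1 +
      fderiv ℝ (fun x => b.coordFrame x (b.ι.symm X).2) b.base (b.ι.symm Y).1 :=
  b.fderiv_fderiv_localRep (hg.contMDiffAt q.1.1) X Y

include b in
theorem injective_diff (hg : IsElliptic g) (hfull : HasFullOsculation g (k + 4))
    (hq : q.1.2 ∉ oscAt 2 g q.1.1 k) : Function.Injective (diff n (ruledMap g k) q) := by
  rw [injective_iff_map_eq_zero]
  intro X hX
  obtain ⟨A, B, he⟩ := hg.exists_isEllipticWith q.1.1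
  have h := b.diff_ruledMap hg X
  rw [hX, ← b.coordFrame_base] at h
  have h1 := (b.isNormalFrame hg).fderiv_add_eq_zero (hg.contDiffAt_localRep q.1.1) he
    (b.eventually_finrank_osc hg hfull (by omega))
    (by rw [b.finrank_osc hfull (by omega), b.finrank_osc hfull (by omega)]; ring)
    (by rw [b.coordFrame_eq]; exact hq) h.symm
  have h2 : b.ι.symm X = 0 := Prod.ext h1.1 h1.2
  exact (map_eq_zero_iff _ b.ι.symm.injective).1 h2

include b in
theorem injective_diff_of_zero (hg : IsElliptic g) (hq : q.1.2 = 0) :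
    Function.Injective (diff n (ruledMap g k) q) := by
  rw [injective_iff_map_eq_zero]
  intro X hX
  have h := b.diff_ruledMap hg X
  rw [hX, ← b.coordFrame_base, hq, map_zero] at h
  have h1 := (b.isNormalFrame hg).fderiv_add_eq_zero_of_zero (hg.injective_fderiv q.1.1) h.symm
  have h2 : b.ι.symm X = 0 := Prod.ext h1.1 h1.2
  exact (map_eq_zero_iff _ b.ι.symm.injective).1 h2

include b in
theorem tangentImage_le (hg : IsElliptic g) (hfull : HasFullOsculation g (k + 4)) :
    tangentImage n (ruledMap g k) q ≤ oscAt 2 g q.1.1 (k + 2) := by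
  rintro _ ⟨X, rfl⟩
  change diff n (ruledMap g k) q X ∈ _
  rw [b.diff_ruledMap hg X]
  refine add_mem ((b.isNormalFrame hg).fderiv_mem (hg.contDiffAt_localRep q.1.1)
    (b.eventually_finrank_osc hg hfull (by omega)) _) ?_
  have h := b.mem q.1.1 (b.ι.symm X).2
  rw [hg.normalSum_eq] at h
  exact oscAt_mono g q.1.1 (by omega) h.1

include b in
theorem normalSum_le_tangentImage (hg : IsElliptic g) :
    normalSum 2 g q.1.1 k ≤ tangentImage n (ruledMap g k) q := by
  rw [← b.range_B]
  rintro _ ⟨t, rfl⟩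
  refine ⟨b.ι (0, t), ?_⟩
  change diff n (ruledMap g k) q (b.ι (0, t)) = _
  rw [b.diff_ruledMap hg]
  simp

include b in
/-- The tangent spaces of `f` together with its first normal spaces. -/
theorem tangentImage_sup_firstNormalSpace (hg : IsElliptic g)
    (hfull : HasFullOsculation g (k + 4)) (hk : 1 ≤ k) (hq : q.1.2 ∉ oscAt 2 g q.1.1 k) :
    tangentImage n (ruledMap g k) q ⊔ firstNormalSpace n (ruledMap g k) q =
      oscAt 2 g q.1.1 (k + 3) := by
  rw [RuledImmersion.tangentImage_sup_firstNormalSpace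
    ((b.contMDiffAt_ruledMap hg).mdifferentiableAt (by simp))]
  obtain ⟨A, B, he⟩ := hg.exists_isEllipticWith q.1.1
  have hG := hg.contDiffAt_localRep q.1.1
  have hr := b.eventually_finrank_osc hg hfull (show k + 1 ≤ k + 4 by omega)
  apply le_antisymm
  · refine sup_le ((b.tangentImage_le hg hfull).trans (oscAt_mono g q.1.1 (by omega)))
      (Submodule.span_le.2 ?_)
    rintro _ ⟨⟨X, Y⟩, rfl⟩
    change fderiv ℝ (fderiv ℝ (localRep n (ruledMap g k) q)) (extChartAt (𝓡 n) q q) X Y ∈ _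
    rw [b.fderiv_fderiv_ruledMap hg]
    exact add_mem (add_mem ((b.isNormalFrame hg).second_fderiv_mem hG hr _ _)
      (oscAt_mono g q.1.1 (by omega) (b.mixed_mem hg hfull hk _ _)))
      (oscAt_mono g q.1.1 (by omega) (b.mixed_mem hg hfull hk _ _))
  · set S := tangentImage n (ruledMap g k) q ⊔ Submodule.span ℝ (Set.range fun X : Euc n × Euc n =>
        fderiv ℝ (fderiv ℝ (localRep n (ruledMap g k) q)) (extChartAt (𝓡 n) q q) X.1 X.2) with hS
    have hS2 : ∀ X Y, fderiv ℝ (fderiv ℝ (localRep n (ruledMap g k) q))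
        (extChartAt (𝓡 n) q q) X Y ∈ S := fun X Y =>
      Submodule.mem_sup_right (Submodule.subset_span ⟨(X, Y), rfl⟩)
    -- Mixed second derivatives of `f` are the derivatives of the frame, and the frame itself is
    -- tangent to `f`; by `mixedSpan_eq` they exhaust the order k + 2.
    have h1 : osc (localRep 2 g q.1.1) b.base (k + 2) ≤ S := by
      refine (b.mixedSpan_eq hg hfull hk).ge.trans (sup_le ?_ (Submodule.span_le.2 ?_))
      · rw [b.coordFrame_base, b.range_B]
        exact (b.normalSum_le_tangentImage hg).trans le_sup_left
      · rintro _ ⟨⟨X, t⟩, rfl⟩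
        have h2 := hS2 (b.ι (X, 0)) (b.ι (0, t))
        rw [b.fderiv_fderiv_ruledMap hg] at h2
        simpa using h2
    -- The remaining order k + 3 comes from the purely horizontal second derivatives.
    refine (b.isNormalFrame hg).osc_le_of_second_fderiv hG he hr
      (by rw [b.coordFrame_eq]; exact hq) h1 fun X Y => ?_
    have h2 := hS2 (b.ι (X, 0)) (b.ι (Y, 0))
    rw [b.fderiv_fderiv_ruledMap hg] at h2
    simpa using h2

end BundleChart

end PointwiseGeometry

theorem starProjection_inf_orthogonal_eq_zero_iff {F : Type*} [NormedAddCommGroup F]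
    [InnerProductSpace ℝ F] [FiniteDimensional ℝ F] {U V : Submodule ℝ F} (h : U ≤ V) {z : F}
    (hz : z ∈ V) : (V ⊓ Uᗮ).starProjection z = 0 ↔ z ∈ U := by
  rw [starProjection_inf_orthogonal h, sub_apply, Submodule.starProjection_eq_self_iff.2 hz,
    sub_eq_zero, eq_comm, Submodule.starProjection_eq_self_iff]

theorem starProjection_eq_zero_of_mem_orthogonal {F : Type*} [NormedAddCommGroup F]
    [InnerProductSpace ℝ F] [FiniteDimensional ℝ F] {U : Submodule ℝ F} {z : F}
    (hz : z ∈ Uᗮ) : U.starProjection z = 0 := by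
  exact (Submodule.starProjection_apply_eq_zero_iff U).2 hz

/-! ### The nonparallel part, its nullity and the relative nullity -/

section PointwiseGeometry

variable {N r n k : ℕ} {L : Type*} [TopologicalSpace L] [ChartedSpace (Euc 2) L]
  [IsManifold (𝓡 2) ∞ L] {g : L → Euc N}

/-- N_k is the complement of the k-th osculating space in the next one, which contains ξ; so the
N_k-component of ξ vanishes exactly when ξ already has order k. -/
theorem IsElliptic.mem_regularPart_iff (hg : IsElliptic g) (hk : 1 ≤ k) (q : NormalTotal g k) :
    q ∈ regularPart g k ↔ q.1.2 ∉ oscAt 2 g q.1.1 k := by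
  obtain ⟨j, rfl⟩ : ∃ j, k = j + 1 := ⟨k - 1, by omega⟩
  have hq : q.1.2 ∈ oscAt 2 g q.1.1 (j + 2) := by
    have := q.2
    rw [hg.normalSum_eq] at this
    exact this.1
  have h := starProjection_inf_orthogonal_eq_zero_iff
    (oscAt_mono g q.1.1 (show j + 1 ≤ j + 2 by omega)) hq
  rw [← h, ← starProjection_congr (hg.normalSpace_succ_eq q.1.1 j)]
  rfl

variable [ChartedSpace (Euc n) (NormalTotal g k)] {q : NormalTotal g k}

omit [IsManifold (𝓡 2) ∞ L] in
theorem firstNormalSpace_eq {M : Type*} [TopologicalSpace M] [ChartedSpace (Euc n) M]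
    {f : M → Euc N} {x : M} {U : Submodule ℝ (Euc N)}
    (hf : MDifferentiableAt (𝓡 n) 𝓘(ℝ, Euc N) f x)
    (h : tangentImage n f x ⊔ firstNormalSpace n f x = U) :
    firstNormalSpace n f x = U ⊓ (tangentImage n f x)ᗮ :=
  eq_inf_orthogonal h (firstNormalSpace_le_orthogonal hf)

namespace BundleChart

variable (b : BundleChart (fun x => normalSum 2 g x k) r n q)

/-- The field μ lives on the total space and s on the base; s is pulled back by π, so only the
horizontal part of X acts on it when ⟨μ, s∘π⟩ = 0 is differentiated. -/
theorem inner_diff_eq_neg (hg : IsElliptic g) {μ : NormalTotal g k → Euc N} {j : ℕ}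
    (hμ : ContMDiffAt (𝓡 n) 𝓘(ℝ, Euc N) ∞ μ q)
    (h : ∀ᶠ y in 𝓝 q, μ y ∈ (oscAt 2 g y.1.1 j)ᗮ) {s : Euc 2 → Euc N}
    (hs : s ∈ jetSec (localRep 2 g q.1.1) b.base j) (X : Euc n) :
    inner ℝ (diff n μ q X) (s b.base) =
      - inner ℝ (μ q) (fderiv ℝ s b.base (b.ι.symm X).1) := by
  have hbase : (b.ι.symm (extChartAt (𝓡 n) q q)).1 = b.base := by
    rw [b.extChartAt_self, b.ι.symm_apply_apply]
  have hsd : DifferentiableAt ℝ s b.base :=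
    (contDiffAt_of_mem_jetSec (hg.contDiffAt_localRep q.1.1) hs).differentiableAt (by simp)
  have hl : HasFDerivAt (fun v : Euc n => (b.ι.symm v).1)
      ((ContinuousLinearMap.fst ℝ (Euc 2) (Euc r)).comp (b.ι.symm : Euc n →L[ℝ] Euc 2 × Euc r))
      (extChartAt (𝓡 n) q q) :=
    ((ContinuousLinearMap.fst ℝ (Euc 2) (Euc r)).comp
      (b.ι.symm : Euc n →L[ℝ] Euc 2 × Euc r)).hasFDerivAt
  have hsl : HasFDerivAt (fun v : Euc n => s (b.ι.symm v).1)
      ((fderiv ℝ s b.base).comp ((ContinuousLinearMap.fst ℝ (Euc 2) (Euc r)).comp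
        (b.ι.symm : Euc n →L[ℝ] Euc 2 × Euc r))) (extChartAt (𝓡 n) q q) := by
    refine HasFDerivAt.comp _ ?_ hl
    rw [hbase]
    exact hsd.hasFDerivAt
  have hc : Filter.Tendsto (fun v : Euc n => (b.ι.symm v).1) (𝓝 (extChartAt (𝓡 n) q q))
      (𝓝 b.base) := by
    have := hl.continuousAt
    rwa [ContinuousAt, hbase] at this
  have hsymm := tendsto_extChartAt_symm (n := n) q
  have h1 := inner_fderiv_eq_neg (s := localRep n μ q)
    ((contDiffAt_localRep hμ).differentiableAt (by simp)) hsl.differentiableAt (by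
      filter_upwards [hsymm.eventually h, hc.eventually (eventually_mem_osc hs),
        hc.eventually (hg.osc_localRep q.1.1)] with v h1 h2 h3
      rw [h3] at h2
      have h4 : ((extChartAt (𝓡 n) q).symm v).1.1 =
          (extChartAt (𝓡 2) q.1.1).symm (b.ι.symm v).1 := congrArg Prod.fst (b.symm_eq v)
      rw [h4] at h1
      exact Submodule.inner_left_of_mem_orthogonal h2 h1) X
  rw [hsl.fderiv, hbase] at h1
  have h2 : diff n μ q = fderiv ℝ (localRep n μ q) (extChartAt (𝓡 n) q q) :=
    diff_eq_fderiv (hμ.mdifferentiableAt (by simp))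
  have h3 : localRep n μ q (extChartAt (𝓡 n) q q) = μ q := by simp [localRep]
  rw [h3] at h1
  rw [h2]
  exact h1

include b in
-- Dual to the rule that derivatives raise the osculating order by one: derivatives of fields
-- orthogonal to order j + 1 remain orthogonal to order j.
theorem diff_mem_orthogonal (hg : IsElliptic g) {μ : NormalTotal g k → Euc N} {j : ℕ}
    (hμ : ContMDiffAt (𝓡 n) 𝓘(ℝ, Euc N) ∞ μ q)
    (h : ∀ᶠ y in 𝓝 q, μ y ∈ (oscAt 2 g y.1.1 (j + 1))ᗮ) (X : Euc n) :
    diff n μ q X ∈ (oscAt 2 g q.1.1 j)ᗮ := by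
  rw [Submodule.mem_orthogonal']
  intro w hw
  obtain ⟨s, hs, hsw⟩ : ∃ s ∈ jetSec (localRep 2 g q.1.1) b.base j, s b.base = w :=
    exists_mem_jetSec hw
  have h1 := b.inner_diff_eq_neg hg hμ h (jetSec_mono (show j ≤ j + 1 by omega) hs) X
  have h2 : fderiv ℝ s b.base (b.ι.symm X).1 ∈ oscAt 2 g q.1.1 (j + 1) :=
    mem_osc_of_mem_jetSec (fderiv_mem_jetSec (hg.contDiffAt_localRep q.1.1) hs _)
  rw [← hsw, h1, Submodule.inner_left_of_mem_orthogonal h2 h.self_of_nhds, neg_zero]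

/-- A vector all of whose extensions to sections of an osculating bundle have derivatives in that
bundle lies in the preceding osculating space. -/
theorem mem_osc_of_fderiv_mem (hg : IsElliptic g) (hfull : HasFullOsculation g (k + 4))
    {s : Euc 2 → Euc N} (hs : s ∈ jetSec (localRep 2 g q.1.1) b.base (k + 3))
    (h : fderiv ℝ s b.base e₀ ∈ osc (localRep 2 g q.1.1) b.base (k + 3)) :
    s b.base ∈ osc (localRep 2 g q.1.1) b.base (k + 2) := by
  have hG := hg.contDiffAt_localRep q.1.1
  obtain ⟨A, B, he⟩ := hg.exists_isEllipticWith q.1.1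
  obtain ⟨p, p', hl⟩ := RuledImmersion.exists_lead hG he hs
  have h4 := b.finrank_osc hfull (show k + 4 ≤ k + 4 by omega)
  have h3 := b.finrank_osc hfull (show k + 3 ≤ k + 4 by omega)
  have h5 : Module.finrank ℝ (osc (localRep 2 g q.1.1) b.base (k + 2 + 1 + 1)) =
      Module.finrank ℝ (osc (localRep 2 g q.1.1) b.base (k + 2 + 1)) + 2 := by
    change Module.finrank ℝ (osc (localRep 2 g q.1.1) b.base (k + 4)) =
      Module.finrank ℝ (osc (localRep 2 g q.1.1) b.base (k + 3)) + 2
    omega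
  obtain ⟨h1, h2⟩ := (hl.fderiv hG he e₀).eq_zero hG he h5 h
  simp only [PiLp.single_apply] at h1 h2
  simp only [if_true, one_mul, zero_mul, sub_zero, add_zero, one_ne_zero, if_false] at h1 h2
  have h6 : s b.base - (p b.base • frame (localRep 2 g q.1.1) (k + 2) 0 b.base +
      p' b.base • frame (localRep 2 g q.1.1) (k + 2) 1 b.base) ∈
        osc (localRep 2 g q.1.1) b.base (k + 2) := hl.sub_mem_osc
  have h1' : p b.base = 0 := h1
  have h2' : p' b.base = 0 := h2
  rwa [h1', h2', zero_smul, zero_smul, add_zero, sub_zero] at h6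

include b in
-- The tangent space of `f` lies in the osculating space of order k + 2, to which z is orthogonal;
-- so both sides equal the projection of z to the osculating space of order k + 3.
theorem starProjection_firstNormalSpace (hg : IsElliptic g)
    (hfull : HasFullOsculation g (k + 4)) (hk : 1 ≤ k) (hq : q.1.2 ∉ oscAt 2 g q.1.1 k)
    {z : Euc N} (hz : z ∈ (oscAt 2 g q.1.1 (k + 2))ᗮ) :
    (firstNormalSpace n (ruledMap g k) q).starProjection
      ((tangentImage n (ruledMap g k) q)ᗮ.starProjection z) =
        (normalSpace 2 g q.1.1 (k + 2)).starProjection z := by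
  have hT := b.tangentImage_le hg hfull
  have hT' : z ∈ (tangentImage n (ruledMap g k) q)ᗮ := Submodule.orthogonal_le hT hz
  have h1 := b.tangentImage_sup_firstNormalSpace hg hfull hk hq
  rw [Submodule.starProjection_eq_self_iff.2 hT', starProjection_congr (firstNormalSpace_eq
    ((b.contMDiffAt_ruledMap hg).mdifferentiableAt (by simp)) h1),
    starProjection_congr (hg.normalSpace_succ_eq q.1.1 (k + 1)),
    starProjection_inf_orthogonal (hT.trans (oscAt_mono g q.1.1 (by omega))),
    starProjection_inf_orthogonal (oscAt_mono g q.1.1 (by omega)), sub_apply, sub_apply,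
    starProjection_eq_zero_of_mem_orthogonal hT', starProjection_eq_zero_of_mem_orthogonal hz]

include b in
/-- The nonparallel part of the first normal space of `f`. -/
theorem nonparallelSpace_eq (hg : IsElliptic g) (hr : IsRegularSurface g)
    (hfull : HasFullOsculation g (k + 4)) (hk : 1 ≤ k)
    (hb : ∀ q, Nonempty (BundleChart (fun x => normalSum 2 g x k) r n q))
    (hq : ∀ᶠ y in 𝓝 q, y.1.2 ∉ oscAt 2 g y.1.1 k) :
    nonparallelSpace n (ruledMap g k) q = normalSpace 2 g q.1.1 (k + 2) := by
  have hG := hg.contDiffAt_localRep q.1.1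
  -- The complement of N_1 of `f` in its normal bundle is thus pulled back from the base.
  have hN : ∀ᶠ y in 𝓝 q, (tangentImage n (ruledMap g k) y)ᗮ ⊓
      (firstNormalSpace n (ruledMap g k) y)ᗮ = (oscAt 2 g y.1.1 (k + 3))ᗮ := by
    filter_upwards [hq] with y hy
    obtain ⟨b'⟩ := hb y
    rw [Submodule.inf_orthogonal, b'.tangentImage_sup_firstNormalSpace hg hfull hk hy]
  have hO : ∀ μ : NormalTotal g k → Euc N, ContMDiffAt (𝓡 n) 𝓘(ℝ, Euc N) ∞ μ q →
      (∀ᶠ y in 𝓝 q, μ y ∈ (oscAt 2 g y.1.1 (k + 3))ᗮ) → ∀ X : Euc n,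
      diff n μ q X ∈ (oscAt 2 g q.1.1 (k + 2))ᗮ := fun μ hμ h X =>
    b.diff_mem_orthogonal hg hμ h X
  have hP : ∀ z ∈ (oscAt 2 g q.1.1 (k + 2))ᗮ,
      (firstNormalSpace n (ruledMap g k) q).starProjection
        ((tangentImage n (ruledMap g k) q)ᗮ.starProjection z) =
          (normalSpace 2 g q.1.1 (k + 2)).starProjection z := fun z hz =>
    b.starProjection_firstNormalSpace hg hfull hk hq.self_of_nhds hz
  have hle : nonparallelSpace n (ruledMap g k) q ≤ normalSpace 2 g q.1.1 (k + 2) := by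
    refine Submodule.span_le.2 ?_
    rintro _ ⟨μ, X, hμ, h, rfl⟩
    rw [SetLike.mem_coe, hP _ (hO μ hμ (by
      filter_upwards [h, hN] with y h1 h2
      rwa [h2] at h1) X)]
    exact Submodule.starProjection_apply_mem _ _
  -- Equality by duality: a vector η of N_{k+2} orthogonal to 𝒮 is extended to a section s of order
  -- k + 3. Its derivative ∂₀s turns out orthogonal to all admissible μ, hence still of order k + 3,
  -- which forces η to have order k + 2, so η = 0.
  have hbot : normalSpace 2 g q.1.1 (k + 2) ⊓ (nonparallelSpace n (ruledMap g k) q)ᗮ = ⊥ := by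
    rw [eq_bot_iff]
    rintro η ⟨hη, hη'⟩
    have hη2 := hη
    rw [hg.normalSpace_succ_eq] at hη2
    obtain ⟨s, hs, hsη⟩ := exists_mem_jetSec hη2.1
    have key : ∀ μ₀ : Euc N, inner ℝ (μ₀ - (oscAt 2 g q.1.1 (k + 3)).starProjection μ₀)
        (fderiv ℝ s b.base e₀) = 0 := by
      intro μ₀
      -- It suffices to test with projections of constant vectors, which are smooth because the
      -- ranks are constant.
      let μ : NormalTotal g k → Euc N := fun y =>
        μ₀ - (oscAt 2 g y.1.1 (k + 3)).starProjection μ₀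
      have hμ : ContMDiffAt (𝓡 n) 𝓘(ℝ, Euc N) ∞ μ q := by
        have h1 := (hg.contMDiff_starProjection hr (k + 3)).contMDiffAt.comp q b.contMDiffAt_fst
        exact contMDiffAt_const.sub (h1.clm_apply contMDiffAt_const)
      have hμo : ∀ y, μ y ∈ (oscAt 2 g y.1.1 (k + 3))ᗮ := fun y =>
        Submodule.sub_starProjection_mem_orthogonal _
      have hmem : (normalSpace 2 g q.1.1 (k + 2)).starProjection (diff n μ q (b.ι (e₀, 0))) ∈
          nonparallelSpace n (ruledMap g k) q := by
        rw [← hP _ (hO μ hμ (.of_forall hμo) _)]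
        refine Submodule.subset_span ⟨μ, b.ι (e₀, 0), hμ, ?_, rfl⟩
        filter_upwards [hN] with y hy
        rw [hy]
        exact hμo y
      have h1 := Submodule.inner_right_of_mem_orthogonal hmem hη'
      rw [Submodule.inner_starProjection_left_eq_right,
        Submodule.starProjection_eq_self_iff.2 hη, ← hsη] at h1
      have h2 := b.inner_diff_eq_neg hg hμ (.of_forall hμo) hs (b.ι (e₀, 0))
      have h3 : inner ℝ (diff n μ q (b.ι (e₀, 0))) (s b.base) = 0 := h1
      rw [h3, b.ι.symm_apply_apply] at h2
      exact neg_eq_zero.1 h2.symm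
    -- Choosing the constant vector to be z itself shows that the part of z orthogonal to the
    -- osculating space of order k + 3 has length zero.
    set z := fderiv ℝ s b.base e₀ with hz
    have hz3 : z ∈ osc (localRep 2 g q.1.1) b.base (k + 3) := by
      have h1 := key z
      have h2 : inner ℝ (z - (oscAt 2 g q.1.1 (k + 3)).starProjection z)
          ((oscAt 2 g q.1.1 (k + 3)).starProjection z) = 0 :=
        Submodule.inner_left_of_mem_orthogonal (Submodule.starProjection_apply_mem _ _)
          (Submodule.sub_starProjection_mem_orthogonal _)
      have h3 : inner ℝ (z - (oscAt 2 g q.1.1 (k + 3)).starProjection z)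
          (z - (oscAt 2 g q.1.1 (k + 3)).starProjection z) = 0 := by
        rw [inner_sub_right, h1, h2, sub_zero]
      exact Submodule.starProjection_eq_self_iff.1 (sub_eq_zero.1 (inner_self_eq_zero.1 h3)).symm
    have h4 : η ∈ oscAt 2 g q.1.1 (k + 2) := hsη ▸ b.mem_osc_of_fderiv_mem hg hfull hs hz3
    exact (Submodule.mem_bot ℝ).2 (inner_self_eq_zero.1
      (Submodule.inner_right_of_mem_orthogonal h4 hη2.2))
  have h := sup_inf_orthogonal hle
  rwa [hbot, sup_bot_eq] at h

omit [IsManifold (𝓡 2) ∞ L] in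
theorem mem_verticalSpace_iff (X : Euc n) :
    X ∈ verticalSpace g k q ↔ (b.ι.symm X).1 = 0 := by
  have h : mfderiv (𝓡 n) (𝓡 2) (bundleProj g k) q = _ := b.hasMFDerivAt_fst.mfderiv
  unfold verticalSpace
  rw [h]
  rfl

include b in
theorem map_verticalSpace (hg : IsElliptic g) :
    (verticalSpace g k q).map (diff n (ruledMap g k) q).toLinearMap =
      normalSum 2 g q.1.1 k := by
  rw [← b.range_B]
  apply le_antisymm
  · rintro _ ⟨X, hX, rfl⟩
    have h1 := (b.mem_verticalSpace_iff X).1 hX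
    refine ⟨(b.ι.symm X).2, ?_⟩
    have h2 := b.diff_ruledMap hg X
    rw [h1, map_zero, zero_add] at h2
    exact h2.symm
  · rintro _ ⟨t, rfl⟩
    refine ⟨b.ι (0, t), (b.mem_verticalSpace_iff _).2 (by simp), ?_⟩
    have h2 := b.diff_ruledMap hg (b.ι (0, t))
    rw [b.ι.symm_apply_apply, map_zero, zero_add] at h2
    exact h2

/-- The component of the second fundamental form of `f` in the nonparallel part. -/
theorem starProjection_secondForm_eq_zero_iff (hg : IsElliptic g)
    (hfull : HasFullOsculation g (k + 4)) (hk : 1 ≤ k) (X Y : Euc n) :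
    (normalSpace 2 g q.1.1 (k + 2)).starProjection (secondForm n (ruledMap g k) q X Y) = 0 ↔
      fderiv ℝ (fun x => fderiv ℝ (fun u => localRep 2 g q.1.1 u +
        b.coordFrame u (b.C q.1.2)) x (b.ι.symm Y).1) b.base (b.ι.symm X).1 ∈
          osc (localRep 2 g q.1.1) b.base (k + 2) := by
  have hfd : MDifferentiableAt (𝓡 n) 𝓘(ℝ, Euc N) (ruledMap g k) q :=
    (b.contMDiffAt_ruledMap hg).mdifferentiableAt (by simp)
  have hT : LinearMap.range (fderiv ℝ (localRep n (ruledMap g k) q)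
      (extChartAt (𝓡 n) q q)).toLinearMap ≤ oscAt 2 g q.1.1 (k + 2) := by
    refine le_trans (le_of_eq ?_) (b.tangentImage_le hg hfull)
    rw [tangentImage_eq_osc hfd, oscAt, osc_one]
  have h23 : oscAt 2 g q.1.1 (k + 2) ≤ oscAt 2 g q.1.1 (k + 3) := oscAt_mono g q.1.1 (by omega)
  rw [starProjection_congr (hg.normalSpace_succ_eq q.1.1 (k + 1))]
  -- The difference consists of the two mixed terms and a tangential correction, all of order k + 2
  -- and so invisible to 𝒮.
  have h1 : secondForm n (ruledMap g k) q X Y - fderiv ℝ (fun x => fderiv ℝ (fun u =>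
      localRep 2 g q.1.1 u + b.coordFrame u (b.C q.1.2)) x (b.ι.symm Y).1) b.base
        (b.ι.symm X).1 ∈ oscAt 2 g q.1.1 (k + 2) := by
    unfold secondForm coordSecondForm
    rw [coordNormalProj_apply]
    have h2 := b.fderiv_fderiv_ruledMap hg X Y
    have h3 := hT (Submodule.starProjection_apply_mem (LinearMap.range (fderiv ℝ (localRep n
      (ruledMap g k) q) (extChartAt (𝓡 n) q q)).toLinearMap) (fderiv ℝ (fderiv ℝ (localRep n
        (ruledMap g k) q)) (extChartAt (𝓡 n) q q) X Y))
    have h4 := sub_mem (add_mem (b.mixed_mem hg hfull hk (b.ι.symm X).1 (b.ι.symm Y).2)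
      (b.mixed_mem hg hfull hk (b.ι.symm Y).1 (b.ι.symm X).2)) h3
    convert h4 using 1
    have h5 : ∀ a b c d e : Euc N, a = b + c + d → a - e - b = c + d - e := by
      rintro a b c d e rfl
      abel
    exact h5 _ _ _ _ _ h2
  have h2 := (b.isNormalFrame hg).second_fderiv_mem (t := b.C q.1.2)
    (hg.contDiffAt_localRep q.1.1) (b.eventually_finrank_osc hg hfull (by omega))
    (b.ι.symm X).1 (b.ι.symm Y).1
  have h3 : secondForm n (ruledMap g k) q X Y ∈ oscAt 2 g q.1.1 (k + 3) := by
    have := add_mem (h23 h1) h2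
    rwa [sub_add_cancel] at this
  rw [starProjection_inf_orthogonal_eq_zero_iff h23 h3]
  refine ⟨fun h => ?_, fun h => ?_⟩
  · have := sub_mem h h1
    rwa [sub_sub_cancel] at this
  · have := add_mem h1 h
    rwa [sub_add_cancel] at this

include b in
-- Modulo order k + 2 the form is the product XYζ of the horizontal parts with ζ ≠ 0; it vanishes
-- for every Y exactly when the horizontal part of X is zero.
theorem nullity_eq (hg : IsElliptic g) (hfull : HasFullOsculation g (k + 4)) (hk : 1 ≤ k)
    (hq : q.1.2 ∉ oscAt 2 g q.1.1 k) :
    nullity n (ruledMap g k) q (normalSpace 2 g q.1.1 (k + 2)) = verticalSpace g k q := by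
  ext X
  rw [mem_nullity_iff]
  refine Iff.trans ?_ (b.mem_verticalSpace_iff X).symm
  have h1 := fun Y : Euc n => b.starProjection_secondForm_eq_zero_iff hg hfull hk X Y
  constructor
  · intro h
    obtain ⟨A, B, he⟩ := hg.exists_isEllipticWith q.1.1
    refine (b.isNormalFrame hg).eq_zero_of_second_fderiv_mem (t := b.C q.1.2)
      (hg.contDiffAt_localRep q.1.1) he (b.eventually_finrank_osc hg hfull (by omega))
      (by rw [b.finrank_osc hfull (by omega), b.finrank_osc hfull (by omega)]; ring)
      (by rw [b.coordFrame_eq]; exact hq) fun Y => ?_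
    have h2 := (h1 (b.ι (Y, 0))).1 (h (b.ι (Y, 0)))
    rwa [b.ι.symm_apply_apply] at h2
  · intro h Y
    refine (h1 Y).2 ?_
    rw [h, map_zero]
    exact zero_mem _

include b in
theorem finrank_tangentImage (hg : IsElliptic g) (hfull : HasFullOsculation g (k + 4))
    (hq : q.1.2 ∉ oscAt 2 g q.1.1 k) :
    Module.finrank ℝ (tangentImage n (ruledMap g k) q) = n := by
  have h := LinearMap.finrank_range_of_inj (f := (diff n (ruledMap g k) q).toLinearMap)
    (b.injective_diff hg hfull hq)
  have h2 : Module.finrank ℝ (TangentSpace (𝓡 n) q) = n := finrank_euclideanSpace_fin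
  exact h.trans h2

include b in
theorem finrank_firstNormalSpace (hg : IsElliptic g) (hfull : HasFullOsculation g (k + 4))
    (hk : 1 ≤ k) (hn : n = 2 * k + 2) (hq : q.1.2 ∉ oscAt 2 g q.1.1 k) :
    Module.finrank ℝ (firstNormalSpace n (ruledMap g k) q) = 4 := by
  have h := b.tangentImage_sup_firstNormalSpace hg hfull hk hq
  have h1 := firstNormalSpace_eq ((b.contMDiffAt_ruledMap hg).mdifferentiableAt (by simp)) h
  have hT : tangentImage n (ruledMap g k) q ≤ oscAt 2 g q.1.1 (k + 3) := h ▸ le_sup_left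
  have h2 := Submodule.finrank_add_inf_finrank_orthogonal hT
  rw [inf_comm, ← h1, b.finrank_tangentImage hg hfull hq, hfull q.1.1 (k + 3) (by omega)] at h2
  omega

include b in
-- If vertical vectors were relative nullity, the derivatives of the frame would all be tangent to
-- `f`. Then the osculating space of order k + 2, of dimension 2k + 4, would fit in a tangent space
-- of dimension 2k + 2.
theorem not_verticalSpace_le (hg : IsElliptic g) (hfull : HasFullOsculation g (k + 4))
    (hk : 1 ≤ k) (hn : n = 2 * k + 2) (hq : q.1.2 ∉ oscAt 2 g q.1.1 k) :
    ¬ verticalSpace g k q ≤ relativeNullity n (ruledMap g k) q := by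
  intro hle
  have hfd : MDifferentiableAt (𝓡 n) 𝓘(ℝ, Euc N) (ruledMap g k) q :=
    (b.contMDiffAt_ruledMap hg).mdifferentiableAt (by simp)
  have h0 : ∀ (t : Euc r) (X : Euc 2), fderiv ℝ (fun x => b.coordFrame x t) b.base X ∈
      tangentImage n (ruledMap g k) q := by
    intro t X
    have h1 : (b.ι (0, t) : Euc n) ∈ relativeNullity n (ruledMap g k) q :=
      hle ((b.mem_verticalSpace_iff _).2 (by simp))
    have h2 := h1 (b.ι (X, 0))
    have h3 : secondForm n (ruledMap g k) q (b.ι (0, t) : Euc n) (b.ι (X, 0) : Euc n) ∈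
        firstNormalSpace n (ruledMap g k) q := Submodule.subset_span ⟨_, _, rfl⟩
    have h4 : secondForm n (ruledMap g k) q (b.ι (0, t) : Euc n) (b.ι (X, 0) : Euc n) = 0 := by
      rw [← Submodule.starProjection_eq_self_iff.2 h3]
      exact h2
    unfold secondForm coordSecondForm at h4
    rw [coordNormalProj_apply] at h4
    have h5 := b.fderiv_fderiv_ruledMap hg (b.ι (0, t)) (b.ι (X, 0))
    simp only [b.ι.symm_apply_apply, map_zero, zero_add] at h5
    have h6 : fderiv ℝ (fun x => b.coordFrame x 0) b.base (0 : Euc 2) = 0 := map_zero _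
    have h7 : fderiv ℝ (fderiv ℝ (localRep n (ruledMap g k) q)) (extChartAt (𝓡 n) q q)
        (b.ι (0, t)) (b.ι (X, 0)) = fderiv ℝ (fun x => b.coordFrame x t) b.base X := by
      rw [h5]
    rw [tangentImage_eq_osc hfd, oscAt, osc_one, ← h7]
    exact (sub_eq_zero.1 h4) ▸ Submodule.starProjection_apply_mem _ _
  have h1 : oscAt 2 g q.1.1 (k + 2) ≤ tangentImage n (ruledMap g k) q := by
    rw [← b.mixedSpan_eq hg hfull hk]
    refine sup_le ?_ (Submodule.span_le.2 ?_)
    · rw [b.coordFrame_base, b.range_B]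
      exact b.normalSum_le_tangentImage hg
    · rintro _ ⟨⟨X, t⟩, rfl⟩
      exact h0 t X
  have h2 := Submodule.finrank_mono h1
  rw [hfull q.1.1 (k + 2) (by omega), b.finrank_tangentImage hg hfull hq] at h2
  omega

end BundleChart

end PointwiseGeometry

/-! ### Local constancy, closed subspaces and openness of the immersion locus -/

theorem eventually_eq_of_mfderiv_eq_zero' {n : ℕ} {M : Type*} [TopologicalSpace M]
    [ChartedSpace (Euc n) M] [IsManifold (𝓡 n) ∞ M] {V : Type*} [NormedAddCommGroup V]
    [NormedSpace ℝ V] {h : V → M} {v : V}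
    (hh : ∀ᶠ w in 𝓝 v, MDifferentiableAt 𝓘(ℝ, V) (𝓡 n) h w ∧ mfderiv 𝓘(ℝ, V) (𝓡 n) h w = 0) :
    ∀ᶠ w in 𝓝 v, h w = h v := by
  set φ := extChartAt (𝓡 n) (h v) with hφ
  have hs : ∀ᶠ w in 𝓝 v, h w ∈ φ.source :=
    hh.self_of_nhds.1.continuousAt.eventually_mem (extChartAt_source_mem_nhds (I := 𝓡 n) (h v))
  obtain ⟨ε, hε, hball⟩ := Metric.mem_nhds_iff.1 (hh.and hs)
  have key : ∀ w ∈ Metric.ball v ε, HasFDerivAt (φ ∘ h) (0 : V →L[ℝ] Euc n) w := by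
    intro w hw
    obtain ⟨⟨h1, h2⟩, h3⟩ := hball hw
    have h4 : MDifferentiableAt (𝓡 n) 𝓘(ℝ, Euc n) φ (h w) :=
      (contMDiffAt_extChartAt' (n := ∞) (by rwa [hφ, extChartAt_source] at h3)).mdifferentiableAt
        (by simp)
    have h5 := h4.hasMFDerivAt.comp w h1.hasMFDerivAt
    rw [h2, ContinuousLinearMap.comp_zero] at h5
    exact h5.hasFDerivAt
  filter_upwards [Metric.ball_mem_nhds v hε] with w hw
  have h3 : (φ ∘ h) w = (φ ∘ h) v := by
    refine (convex_ball v ε).is_const_of_fderivWithin_eq_zero (𝕜 := ℝ)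
      (fun v hv => (key v hv).differentiableAt.differentiableWithinAt) (fun v hv => ?_) hw
      (Metric.mem_ball_self hε)
    rw [fderivWithin_of_isOpen Metric.isOpen_ball hv]
    exact (key v hv).fderiv
  exact φ.injOn (hball hw).2 (mem_extChartAt_source (h v)) h3

theorem fderiv_mem_of_eventually_mem {E F : Type*} [NormedAddCommGroup E] [NormedSpace ℝ E]
    [NormedAddCommGroup F] [InnerProductSpace ℝ F] [FiniteDimensional ℝ F] {D : Submodule ℝ F}
    {s : E → F} {u : E} (hs : DifferentiableAt ℝ s u) (h : ∀ᶠ x in 𝓝 u, s x ∈ D) (X : E) :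
    fderiv ℝ s u X ∈ D := by
  rw [← Submodule.orthogonal_orthogonal D, Submodule.mem_orthogonal']
  intro w hw
  have h1 := inner_fderiv_eq_neg hs (differentiableAt_const w)
    (h.mono fun x hx => Submodule.inner_right_of_mem_orthogonal hx hw) X
  simpa using h1

theorem isOpen_injective_diff {n N : ℕ} {M : Type*} [TopologicalSpace M] [ChartedSpace (Euc n) M]
    [IsManifold (𝓡 n) ∞ M] {f : M → Euc N} (hf : ContMDiff (𝓡 n) 𝓘(ℝ, Euc N) ∞ f) :
    IsOpen {q | Function.Injective (diff n f q)} := by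
  rw [isOpen_iff_mem_nhds]
  intro q hq
  have hq' : Function.Injective (diff n f q) := hq
  have hF := contDiffAt_localRep (hf q)
  have h1 : ∀ᶠ w in 𝓝 (extChartAt (𝓡 n) q q), Function.Injective (fderiv ℝ (localRep n f q) w) := by
    refine hF.fderiv_infty.continuousAt.eventually_mem
      (ContinuousLinearMap.isOpen_injective.mem_nhds ?_)
    have h2 : diff n f q = fderiv ℝ (localRep n f q) (extChartAt (𝓡 n) q q) :=
      diff_eq_fderiv ((hf q).mdifferentiableAt (by simp))
    change Function.Injective (fderiv ℝ (localRep n f q) (extChartAt (𝓡 n) q q))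
    rw [← h2]
    exact hq'
  have h2 := (continuousAt_extChartAt (I := 𝓡 n) q).eventually
    (h1.and hF.eventually_differentiableAt)
  have h3 : ∀ᶠ y in 𝓝 q, y ∈ (extChartAt (𝓡 n) q).source :=
    extChartAt_source_mem_nhds (I := 𝓡 n) q
  filter_upwards [h2, h3.eventually_nhds] with y hy hys
  have hy0 := hys.self_of_nhds
  have h4 : f =ᶠ[𝓝 y] localRep n f q ∘ extChartAt (𝓡 n) q := by
    filter_upwards [hys] with z hz
    exact congrArg f ((extChartAt (𝓡 n) q).left_inv hz).symm
  have h5 : MDifferentiableAt (𝓡 n) 𝓘(ℝ, Euc n) (extChartAt (𝓡 n) q) y :=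
    (contMDiffAt_extChartAt' (n := ∞) (by rwa [extChartAt_source] at hy0)).mdifferentiableAt
      (by simp)
  have h6 : HasMFDerivAt 𝓘(ℝ, Euc n) 𝓘(ℝ, Euc N) (localRep n f q) (extChartAt (𝓡 n) q y)
      (fderiv ℝ (localRep n f q) (extChartAt (𝓡 n) q y)) := hy.2.hasFDerivAt.hasMFDerivAt
  have h7 : diff n f y = (fderiv ℝ (localRep n f q) (extChartAt (𝓡 n) q y)).comp
      (mfderiv (𝓡 n) 𝓘(ℝ, Euc n) (extChartAt (𝓡 n) q) y) :=
    ((h6.comp y h5.hasMFDerivAt).congr_of_eventuallyEq h4).mfderiv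
  have : IsManifold (𝓡 n) 1 M := .of_le (n := ∞) (by simp)
  obtain ⟨e, he⟩ := isInvertible_mfderiv_extChartAt (I := 𝓡 n) hy0
  change Function.Injective (diff n f y)
  rw [h7]
  intro a c hac
  have h8 := hy.1 hac
  rw [← he] at h8
  exact e.injective h8

/-! ### Topology of the regular part -/

section Global

variable {N r n k : ℕ} {L : Type*} [TopologicalSpace L] [ChartedSpace (Euc 2) L]
  [IsManifold (𝓡 2) ∞ L] {g : L → Euc N}

theorem IsElliptic.contMDiff_starProjection_normalSum (hg : IsElliptic g)
    (hr : IsRegularSurface g) (k : ℕ) :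
    ContMDiff (𝓡 2) 𝓘(ℝ, Euc N →L[ℝ] Euc N) ∞ fun x => (normalSum 2 g x k).starProjection := by
  have h : (fun x => (normalSum 2 g x k).starProjection) = fun x =>
      (oscAt 2 g x (k + 1)).starProjection - (oscAt 2 g x 1).starProjection := by
    ext1 x
    rw [← starProjection_inf_orthogonal (oscAt_mono g x (by omega))]
    ext1 y
    exact starProjection_congr (hg.normalSum_eq x k) y
  rw [h]
  exact (hg.contMDiff_starProjection hr (k + 1)).sub (hg.contMDiff_starProjection hr 1)

theorem IsElliptic.finrank_normalSpace_succ (hg : IsElliptic g) {l j : ℕ}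
    (hfull : HasFullOsculation g l) (x : L) (hj : j + 2 ≤ l) :
    Module.finrank ℝ (normalSpace 2 g x (j + 1)) = 2 := by
  have h := Submodule.finrank_add_inf_finrank_orthogonal
    (oscAt_mono g x (show j + 1 ≤ j + 2 by omega))
  rw [inf_comm, ← hg.normalSpace_succ_eq, hfull x _ hj, hfull x _ (by omega)] at h
  omega

theorem IsElliptic.finrank_normalSum (hg : IsElliptic g) {l : ℕ}
    (hfull : HasFullOsculation g l) (x : L) (hk : k + 1 ≤ l) :
    Module.finrank ℝ (normalSum 2 g x k) = 2 * k := by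
  have h := Submodule.finrank_add_inf_finrank_orthogonal
    (oscAt_mono g x (show 1 ≤ k + 1 by omega))
  rw [inf_comm, ← hg.normalSum_eq, hfull x _ hk, hfull x _ (by omega)] at h
  omega

theorem IsElliptic.isOrtho_normalSpace (hg : IsElliptic g) (x : L) {i j : ℕ} (hij : i ≠ j) :
    normalSpace 2 g x i ⟂ normalSpace 2 g x j := by
  wlog h : i < j generalizing i j
  · exact (this hij.symm (by omega)).symm
  obtain ⟨j, rfl⟩ : ∃ j', j = j' + 1 := ⟨j - 1, by omega⟩
  cases i with
  | zero => exact Submodule.isOrtho_bot_left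
  | succ i =>
    rw [hg.normalSpace_succ_eq, hg.normalSpace_succ_eq]
    have h1 : oscAt 2 g x (i + 2) ⟂ (oscAt 2 g x (j + 1))ᗮ :=
      (Submodule.isOrtho_orthogonal_right _).mono_left (oscAt_mono g x (by omega))
    exact h1.mono inf_le_left inf_le_right

theorem IsElliptic.isOpen_regularPart (hg : IsElliptic g) (hr : IsRegularSurface g)
    (hk : 1 ≤ k) : IsOpen (regularPart g k) := by
  have hP := (hg.contMDiff_starProjection hr k).continuous
  have h : regularPart g k = {q | (oscAt 2 g q.1.1 k).starProjection q.1.2 ≠ q.1.2} := by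
    ext q
    rw [hg.mem_regularPart_iff hk]
    exact not_congr Submodule.starProjection_eq_self_iff.symm
  rw [h]
  exact isOpen_ne_fun ((hP.comp (continuous_base (V := fun x => normalSum 2 g x k))).clm_apply
    (continuous_snd.comp continuous_subtype_val)) (continuous_snd.comp continuous_subtype_val)

theorem IsElliptic.exists_mem_normalSum_notMem (hg : IsElliptic g)
    (hfull : HasFullOsculation g (k + 4)) (hk : 1 ≤ k) (x : L) :
    ∃ v ∈ normalSum 2 g x k, v ∉ oscAt 2 g x k := by
  obtain ⟨j, rfl⟩ : ∃ j, k = j + 1 := ⟨k - 1, by omega⟩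
  have h1 := hg.finrank_normalSpace_succ hfull x (show j + 2 ≤ j + 1 + 4 by omega)
  have h2 : normalSpace 2 g x (j + 1) ≠ ⊥ := by
    intro h
    rw [h, finrank_bot] at h1
    omega
  obtain ⟨v, hv, hv0⟩ := Submodule.exists_mem_ne_zero_of_ne_bot h2
  rw [hg.normalSpace_succ_eq] at hv
  refine ⟨v, ?_, fun h => hv0 (inner_self_eq_zero.1
    (Submodule.inner_right_of_mem_orthogonal (𝕜 := ℝ) h hv.2))⟩
  rw [hg.normalSum_eq]
  exact ⟨hv.1, Submodule.orthogonal_le (oscAt_mono g x (by omega)) hv.2⟩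

theorem IsElliptic.dense_regularPart (hg : IsElliptic g)
    (hfull : HasFullOsculation g (k + 4)) (hk : 1 ≤ k) : Dense (regularPart g k) := by
  intro q
  by_cases hq : q ∈ regularPart g k
  · exact subset_closure hq
  rw [hg.mem_regularPart_iff hk, not_not] at hq
  obtain ⟨v, hv, hv'⟩ := hg.exists_mem_normalSum_notMem hfull hk q.1.1
  -- An exceptional point is approached along its fibre in the direction v, which has a nonzero
  -- component in N_k.
  let c : ℝ → NormalTotal g k := fun ε =>
    ⟨(q.1.1, q.1.2 + ε • v), add_mem q.2 (Submodule.smul_mem _ _ hv)⟩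
  have hc : Continuous c := by
    refine Continuous.subtype_mk ?_ _
    fun_prop
  have hc0 : c 0 = q := by simp [c]
  have hlim : Filter.Tendsto c (𝓝[≠] 0) (𝓝 q) := by
    have := hc.tendsto 0
    rw [hc0] at this
    exact this.mono_left nhdsWithin_le_nhds
  refine mem_closure_of_tendsto hlim ?_
  filter_upwards [self_mem_nhdsWithin] with ε hε
  rw [hg.mem_regularPart_iff hk]
  intro h
  have h1 := sub_mem h hq
  simp only [c, add_sub_cancel_left] at h1
  exact hv' ((Submodule.smul_mem_iff _ hε).1 h1)

/-- The vectors to be removed lie in the complement of the tangent plane in the k-th osculating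
space, of dimension 2k − 2 inside a fibre of dimension 2k. Real codimension at least two leaves the
fibre connected. -/
theorem IsElliptic.isConnected_compl_comap (hg : IsElliptic g)
    (hfull : HasFullOsculation g (k + 4)) (hk : 1 ≤ k) (x : L) :
    IsConnected (((oscAt 2 g x k).comap (normalSum 2 g x k).subtype :
      Set (normalSum 2 g x k))ᶜ) := by
  refine (isPathConnected_compl_of_one_lt_codim ?_).isConnected
  set E : Submodule ℝ (normalSum 2 g x k) :=
    (oscAt 2 g x k).comap (normalSum 2 g x k).subtype with hE
  have h1 := Submodule.finrank_quotient_add_finrank E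
  have h2 : Module.finrank ℝ E + 2 ≤ 2 * k := by
    have h3 : E.map (normalSum 2 g x k).subtype ≤ oscAt 2 g x k ⊓ (oscAt 2 g x 1)ᗮ := by
      rintro _ ⟨v, hv, rfl⟩
      exact ⟨hv, ((hg.normalSum_eq x k).le v.2).2⟩
    have h4 := Submodule.finrank_mono h3
    rw [Submodule.finrank_map_subtype_eq] at h4
    have h5 := Submodule.finrank_add_inf_finrank_orthogonal (oscAt_mono g x hk)
    rw [inf_comm, hfull x _ (by omega), hfull x _ (by omega)] at h5
    omega
  rw [hg.finrank_normalSum hfull x (by omega)] at h1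
  rw [← Module.finrank_eq_rank]
  have : 1 < Module.finrank ℝ (normalSum 2 g x k ⧸ E) := by omega
  exact_mod_cast this

theorem IsElliptic.isConnected_fibre (hg : IsElliptic g)
    (hfull : HasFullOsculation g (k + 4)) (hk : 1 ≤ k) (x : L) :
    IsConnected ((fun q : regularPart g k => q.1.1.1) ⁻¹' {x}) := by
  set S : Set (normalSum 2 g x k) := ((oscAt 2 g x k).comap (normalSum 2 g x k).subtype :
      Set (normalSum 2 g x k))ᶜ with hS
  have : ConnectedSpace S :=
    isConnected_iff_connectedSpace.1 (hg.isConnected_compl_comap hfull hk x)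
  let c : S → regularPart g k := fun w =>
    ⟨⟨(x, (w : normalSum 2 g x k)), w.1.2⟩, (hg.mem_regularPart_iff hk _).2 w.2⟩
  have hc : Continuous c := by
    refine Continuous.subtype_mk (Continuous.subtype_mk ?_ _) _
    fun_prop
  have himg : (fun q : regularPart g k => q.1.1.1) ⁻¹' {x} = Set.range c := by
    apply Set.Subset.antisymm
    · rintro ⟨⟨⟨y, ξ⟩, hξ⟩, hreg⟩ hy
      have hy' : y = x := hy
      subst hy'
      have h1 : ξ ∉ oscAt 2 g y k := (hg.mem_regularPart_iff hk ⟨(y, ξ), hξ⟩).1 hreg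
      have h2 : (⟨ξ, hξ⟩ : normalSum 2 g y k) ∈ S := h1
      exact ⟨⟨⟨ξ, hξ⟩, h2⟩, Subtype.ext rfl⟩
    · rintro _ ⟨w, rfl⟩
      rfl
  rw [himg]
  exact isConnected_range hc

/-- The projection to the connected base is open, surjective and has connected fibres; a quotient
map of this kind lifts connectedness. -/
theorem IsElliptic.isConnected_regularPart [ConnectedSpace L] (hg : IsElliptic g)
    (hr : IsRegularSurface g) (hfull : HasFullOsculation g (k + 4)) (hk : 1 ≤ k) :
    IsConnected (regularPart g k) := by
  rw [isConnected_iff_connectedSpace]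
  let ρ : regularPart g k → L := fun q => q.1.1.1
  have hopen : IsOpenMap ρ := (isOpenMap_bundleProj (V := fun x => normalSum 2 g x k)
    (hg.contMDiff_starProjection_normalSum hr k).continuous).comp
      (hg.isOpen_regularPart hr hk).isOpenMap_subtype_val
  have hcont : Continuous ρ :=
    (continuous_base (V := fun x => normalSum 2 g x k)).comp continuous_subtype_val
  have hfib : ∀ x, IsConnected (ρ ⁻¹' {x}) := hg.isConnected_fibre hfull hk
  have hsurj : Function.Surjective ρ := fun x => (hfib x).nonempty
  have h := (hopen.isQuotientMap hcont hsurj).isCoinducing.isConnected_preimage_of_isClosed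
    hfib isClosed_univ isConnected_univ
  rw [Set.preimage_univ] at h
  exact connectedSpace_iff_univ.2 h

end Global

/-! ### Substantiality and the ruled structure -/

section RuledManifold

variable {N r n k : ℕ} {L : Type*} [TopologicalSpace L] [ChartedSpace (Euc 2) L]
  [IsManifold (𝓡 2) ∞ L] {g : L → Euc N}
  [ChartedSpace (Euc n) (NormalTotal g k)]

theorem tangentImage_le_direction {M : Type*} [TopologicalSpace M] [ChartedSpace (Euc n) M]
    {f : M → Euc N} {x : M} (hf : ContMDiffAt (𝓡 n) 𝓘(ℝ, Euc N) ∞ f x)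
    {D : AffineSubspace ℝ (Euc N)} (h : ∀ᶠ y in 𝓝 x, f y ∈ D) :
    tangentImage n f x ⊔ firstNormalSpace n f x ≤ D.direction := by
  have hfd : MDifferentiableAt (𝓡 n) 𝓘(ℝ, Euc N) f x := hf.mdifferentiableAt (by simp)
  have hsymm := tendsto_extChartAt_symm (n := n) x
  have hF := contDiffAt_localRep hf
  have h0 : ∀ᶠ v in 𝓝 (extChartAt (𝓡 n) x x), localRep n f x v - f x ∈ D.direction := by
    filter_upwards [hsymm.eventually h] with v hv
    exact D.vsub_mem_direction hv h.self_of_nhds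
  have h1 : ∀ᶠ v in 𝓝 (extChartAt (𝓡 n) x x), ∀ X, fderiv ℝ (localRep n f x) v X ∈ D.direction := by
    filter_upwards [h0.eventually_nhds, hF.eventually_differentiableAt] with v hv hv' X
    have := fderiv_mem_of_eventually_mem (hv'.sub_const (f x)) hv X
    rwa [fderiv_sub_const] at this
  rw [tangentImage_sup_firstNormalSpace hfd]
  refine sup_le ?_ (Submodule.span_le.2 ?_)
  · rw [tangentImage_eq_osc hfd, oscAt, osc_one]
    rintro _ ⟨X, rfl⟩
    exact h1.self_of_nhds X
  · rintro _ ⟨⟨X, Y⟩, rfl⟩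
    have h2 : DifferentiableAt ℝ (fderiv ℝ (localRep n f x)) (extChartAt (𝓡 n) x x) :=
      hF.fderiv_infty.differentiableAt (by simp)
    have h3 := fderiv_mem_of_eventually_mem (h2.clm_apply (differentiableAt_const Y))
      (h1.mono fun v hv => hv Y) X
    rw [fderiv_clm_apply h2 (differentiableAt_const _)] at h3
    simpa using h3

/-- If an open piece lies in an affine subspace, its direction contains tangent and first normal
spaces, that is, the osculating spaces of `g` of order k + 3 over an open set of base points. One
more derivative along the base gives order k + 4, which is the whole space. -/
theorem IsElliptic.isLocallySubstantialOn (hg : IsElliptic g) (hr : IsRegularSurface g)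
    (hfull : HasFullOsculation g (k + 4)) (hk : 1 ≤ k) (hN : N = 2 * (k + 4))
    (hb : ∀ q, Nonempty (BundleChart (fun x => normalSum 2 g x k) r n q)) :
    IsLocallySubstantialOn (ruledMap g k) (regularPart g k) := by
  rintro V hV ⟨q, hq⟩ hVR D hD
  have h1 : ∀ y ∈ V, oscAt 2 g y.1.1 (k + 3) ≤ D.direction := by
    intro y hy
    obtain ⟨b⟩ := hb y
    rw [← b.tangentImage_sup_firstNormalSpace hg hfull hk
      ((hg.mem_regularPart_iff hk y).1 (hVR hy))]
    refine tangentImage_le_direction (b.contMDiffAt_ruledMap hg) ?_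
    filter_upwards [hV.mem_nhds hy] with z hz
    exact hD z hz
  have hopen : IsOpenMap fun q : NormalTotal g k => q.1.1 :=
    isOpenMap_bundleProj (V := fun x => normalSum 2 g x k)
      (hg.contMDiff_starProjection_normalSum hr k).continuous
  have h2 : ∀ᶠ x in 𝓝 q.1.1, oscAt 2 g x (k + 3) ≤ D.direction := by
    filter_upwards [hopen.image_mem_nhds (hV.mem_nhds hq)]
    rintro _ ⟨y, hy, rfl⟩
    exact h1 y hy
  obtain ⟨b⟩ := hb q
  have hG := hg.contDiffAt_localRep q.1.1
  have h3 : ∀ᶠ u in 𝓝 b.base, osc (localRep 2 g q.1.1) u (k + 3) ≤ D.direction := by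
    filter_upwards [b.tendsto_symm.eventually h2, hg.osc_localRep q.1.1] with u hu hu'
    rwa [hu']
  obtain ⟨A, B, he⟩ := hg.exists_isEllipticWith q.1.1
  have h4 : osc (localRep 2 g q.1.1) b.base (k + 4) ≤ D.direction := by
    have h5 := osc_succ_eq_frame hG he (k + 3)
    refine h5.le.trans (sup_le h3.self_of_nhds ?_)
    rw [Submodule.span_le]
    have h6 : ∀ c, frame (localRep 2 g q.1.1) (k + 3) c b.base ∈ D.direction := fun c =>
      fderiv_mem_of_eventually_mem
        ((contDiffAt_frame hG (k + 2) c).differentiableAt (by simp)) (by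
          filter_upwards [h3, eventually_mem_osc (frame_mem_jetSec hG (k + 2) c)] with u h7 h8
          exact h7 h8) e₀
    rintro w (rfl | rfl)
    exacts [h6 0, h6 1]
  have h5 : osc (localRep 2 g q.1.1) b.base (k + 4) = ⊤ := by
    apply Submodule.eq_top_of_finrank_eq
    rw [b.finrank_osc hfull le_rfl, finrank_euclideanSpace_fin, hN]
  rw [h5, top_le_iff] at h4
  exact (AffineSubspace.direction_eq_top_iff_of_nonempty ⟨_, hD q hq⟩).1 h4

theorem IsElliptic.nonparallelSpace_eq (hg : IsElliptic g) (hr : IsRegularSurface g)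
    (hfull : HasFullOsculation g (k + 4)) (hk : 1 ≤ k)
    (hb : ∀ q, Nonempty (BundleChart (fun x => normalSum 2 g x k) r n q)) {q : NormalTotal g k}
    (hq : q ∈ regularPart g k) :
    nonparallelSpace n (ruledMap g k) q = normalSpace 2 g q.1.1 (k + 2) := by
  obtain ⟨b⟩ := hb q
  refine b.nonparallelSpace_eq hg hr hfull hk hb ?_
  filter_upwards [(hg.isOpen_regularPart hr hk).mem_nhds hq] with y hy
  exact (hg.mem_regularPart_iff hk y).1 hy

theorem IsElliptic.nullity_eq (hg : IsElliptic g) (hr : IsRegularSurface g)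
    (hfull : HasFullOsculation g (k + 4)) (hk : 1 ≤ k)
    (hb : ∀ q, Nonempty (BundleChart (fun x => normalSum 2 g x k) r n q)) {q : NormalTotal g k}
    (hq : q ∈ regularPart g k) :
    nullity n (ruledMap g k) q (nonparallelSpace n (ruledMap g k) q) = verticalSpace g k q := by
  obtain ⟨b⟩ := hb q
  rw [hg.nonparallelSpace_eq hr hfull hk hb hq]
  exact b.nullity_eq hg hfull hk ((hg.mem_regularPart_iff hk q).1 hq)

/-- The affine fibres parametrize the leaves of the vertical distribution. -/
theorem IsElliptic.isRulingPatch (hg : IsElliptic g) (hr : IsRegularSurface g)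
    (hfull : HasFullOsculation g (k + 4)) (hk : 1 ≤ k)
    (hb : ∀ q, Nonempty (BundleChart (fun x => normalSum 2 g x k) r n q)) {q : NormalTotal g k}
    (hq : q ∈ regularPart g k) :
    IsRulingPatch n (ruledMap g k)
      (fun y => nullity n (ruledMap g k) y (nonparallelSpace n (ruledMap g k) y))
      (regularPart g k) q (normalSum 2 g q.1.1 k)
      (fun w => ⟨(q.1.1, q.1.2 + w), add_mem q.2 w.2⟩) := by
  set σ : normalSum 2 g q.1.1 k → NormalTotal g k := fun w =>
    ⟨(q.1.1, q.1.2 + w), add_mem q.2 w.2⟩ with hσ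
  have hsm : ∀ w, ContMDiffAt 𝓘(ℝ, normalSum 2 g q.1.1 k) (𝓡 n) ∞ σ w := fun w =>
    contMDiffAt_fibre (V := fun x => normalSum 2 g x k) hb q w
  have h0 : σ 0 = q := by simp [hσ]
  refine ⟨h0, ?_⟩
  have h1 : ∀ᶠ w in 𝓝 0, σ w ∈ regularPart g k :=
    (hsm 0).continuousAt.eventually_mem (by
      rw [h0]
      exact (hg.isOpen_regularPart hr hk).mem_nhds hq)
  filter_upwards [h1] with w hw
  have hf : ∀ w, ruledMap g k (σ w) = ruledMap g k q + w := fun w => (add_assoc _ _ _).symm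
  refine ⟨hw, hsm w, hf w, ?_⟩
  obtain ⟨b⟩ := hb (σ w)
  have hw' : (σ w).1.2 ∉ oscAt 2 g (σ w).1.1 k := (hg.mem_regularPart_iff hk _).1 hw
  change _ = nullity n (ruledMap g k) (σ w) (nonparallelSpace n (ruledMap g k) (σ w))
  rw [hg.nullity_eq hr hfull hk hb hw]
  -- Since the differential of `f` is injective, the images in ℝᴺ may be compared, and there `f ∘ σ`
  -- is a translation of the fibre, with differential the inclusion.
  refine Submodule.map_injective_of_injective (b.injective_diff hg hfull hw') ?_
  have e1 := b.map_verticalSpace hg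
  refine Eq.trans ?_ e1.symm
  have h2 := ((b.contMDiffAt_ruledMap hg).mdifferentiableAt (by simp)).hasMFDerivAt.comp w
    ((hsm w).mdifferentiableAt (by simp)).hasMFDerivAt
  have h3 : HasFDerivAt (fun w : normalSum 2 g q.1.1 k => ruledMap g k q + (w : Euc N))
      (normalSum 2 g q.1.1 k).subtypeL w :=
    HasFDerivAt.const_add (f := fun w : normalSum 2 g q.1.1 k => (w : Euc N)) _
      (normalSum 2 g q.1.1 k).subtypeL.hasFDerivAt
  let T : normalSum 2 g q.1.1 k →L[ℝ] Euc N := (diff n (ruledMap g k) (σ w)).comp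
    (mfderiv 𝓘(ℝ, normalSum 2 g q.1.1 k) (𝓡 n) σ w)
  have h4 : HasFDerivAt (ruledMap g k ∘ σ) T w := h2.hasFDerivAt
  have h5 : T = (normalSum 2 g q.1.1 k).subtypeL :=
    h4.unique (h3.congr_of_eventuallyEq (.of_forall hf))
  apply le_antisymm
  · rintro _ ⟨_, ⟨v, rfl⟩, rfl⟩
    have h6 : ∀ v : normalSum 2 g q.1.1 k, (diff n (ruledMap g k) (σ w))
        ((mfderiv 𝓘(ℝ, normalSum 2 g q.1.1 k) (𝓡 n) σ w) v) ∈ normalSum 2 g q.1.1 k := fun v => by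
      have h7 : (diff n (ruledMap g k) (σ w)) ((mfderiv 𝓘(ℝ, normalSum 2 g q.1.1 k) (𝓡 n) σ w) v) =
        (v : Euc N) := congrArg (fun A : normalSum 2 g q.1.1 k →L[ℝ] Euc N => A v) h5
      exact h7 ▸ v.2
    exact h6 v
  · intro v hv
    refine ⟨mfderiv 𝓘(ℝ, normalSum 2 g q.1.1 k) (𝓡 n) σ w ⟨v, hv⟩, ⟨_, rfl⟩, ?_⟩
    exact congrArg (fun A : normalSum 2 g q.1.1 k →L[ℝ] Euc N => A ⟨v, hv⟩) h5

theorem IsElliptic.isRuledOn (hg : IsElliptic g) (hr : IsRegularSurface g)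
    (hfull : HasFullOsculation g (k + 4)) (hk : 1 ≤ k) (hrk : r = 2 * k)
    (hb : ∀ q, Nonempty (BundleChart (fun x => normalSum 2 g x k) r n q)) :
    IsRuledOn n (ruledMap g k)
      (fun y => nullity n (ruledMap g k) y (nonparallelSpace n (ruledMap g k) y)) r
      (regularPart g k) := by
  intro q hq
  obtain ⟨b⟩ := hb q
  refine ⟨?_, ?_, _, _, hg.isRulingPatch hr hfull hk hb hq⟩
  · change Module.finrank ℝ
      (nullity n (ruledMap g k) q (nonparallelSpace n (ruledMap g k) q)) = r
    rw [hg.nullity_eq hr hfull hk hb hq]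
    have h1 := (Submodule.equivMapOfInjective (diff n (ruledMap g k) q).toLinearMap
      (b.injective_diff hg hfull ((hg.mem_regularPart_iff hk q).1 hq))
      (verticalSpace g k q)).finrank_eq
    rw [b.map_verticalSpace hg, hg.finrank_normalSum hfull _ (by omega)] at h1
    exact h1.trans hrk.symm
  · refine ⟨fun i y => b.B y.1.1 (EuclideanSpace.basisFun (Fin r) ℝ i), fun i => ?_, ?_⟩
    · exact (b.smooth.comp q b.contMDiffAt_fst).clm_apply contMDiffAt_const
    · have hc := (continuous_base (V := fun x => normalSum 2 g x k)).continuousAt (x := q)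
      filter_upwards [(hg.isOpen_regularPart hr hk).mem_nhds hq,
        hc.eventually b.right_inv] with y hy h2
      obtain ⟨b'⟩ := hb y
      rw [hg.nullity_eq hr hfull hk hb hy, b'.map_verticalSpace hg, ← range_fderiv_eq_span]
      apply le_antisymm
      · rintro _ ⟨t, rfl⟩
        exact b.mem _ t
      · intro ξ hξ
        exact ⟨b.C ξ, h2 ξ hξ⟩

/-- The claim concerns every ruling patch, not only the affine fibres. A patch is tangent to the
vertical distribution, so its projection to the base is locally constant, and 𝒮 = N_{k+2} depends
only on the base point. -/
theorem IsElliptic.isConstantAlongRulingsOn (hg : IsElliptic g) (hr : IsRegularSurface g)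
    (hfull : HasFullOsculation g (k + 4)) (hk : 1 ≤ k)
    (hb : ∀ q, Nonempty (BundleChart (fun x => normalSum 2 g x k) r n q)) :
    IsConstantAlongRulingsOn n (ruledMap g k)
      (fun y => nullity n (ruledMap g k) y (nonparallelSpace n (ruledMap g k) y))
      (nonparallelSpace n (ruledMap g k)) (regularPart g k) := by
  rintro q hq W σ ⟨h0, hσ⟩
  have h1 : ∀ᶠ w in 𝓝 (0 : W), bundleProj g k (σ w) = bundleProj g k (σ 0) := by
    refine eventually_eq_of_mfderiv_eq_zero' (n := 2) (M := L) (h := fun w => bundleProj g k (σ w)) ?_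
    filter_upwards [hσ] with w hw
    obtain ⟨hw1, hw2, -, hw4⟩ := hw
    obtain ⟨b⟩ := hb (σ w)
    have hw4' : LinearMap.range (mfderiv 𝓘(ℝ, W) (𝓡 n) σ w).toLinearMap =
      verticalSpace g k (σ w) := hw4.trans (hg.nullity_eq hr hfull hk hb hw1)
    have h2 : MDifferentiableAt (𝓡 n) (𝓡 2) (bundleProj g k) (σ w) :=
      b.contMDiffAt_fst.mdifferentiableAt (by simp)
    have h3 : MDifferentiableAt 𝓘(ℝ, W) (𝓡 n) σ w := hw2.mdifferentiableAt (by simp)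
    have h4 := h2.hasMFDerivAt.comp w h3.hasMFDerivAt
    refine ⟨h4.mdifferentiableAt, h4.mfderiv.trans ?_⟩
    ext1 v
    have h5 : mfderiv 𝓘(ℝ, W) (𝓡 n) σ w v ∈ verticalSpace g k (σ w) := hw4' ▸ ⟨v, rfl⟩
    exact h5
  filter_upwards [h1, hσ] with w hw hw'
  rw [hg.nonparallelSpace_eq hr hfull hk hb hw'.1, hg.nonparallelSpace_eq hr hfull hk hb hq]
  rw [h0] at hw
  exact congrArg (fun x => normalSpace 2 g x (k + 2)) hw

omit [IsManifold (𝓡 2) ∞ L] in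
theorem isSubmanifoldStructure (hm : IsManifold (𝓡 n) ∞ (NormalTotal g k))
    (hb : ∀ q, Nonempty (BundleChart (fun x => normalSum 2 g x k) r n q)) :
    IsSubmanifoldStructure n g k := by
  refine ⟨hm, fun q => ?_, fun q => ?_, fun q X hX hX' => ?_⟩
  · obtain ⟨b⟩ := hb q
    exact b.contMDiffAt_fst
  · obtain ⟨b⟩ := hb q
    exact b.contMDiffAt_snd
  · obtain ⟨b⟩ := hb q
    have h1 : (b.ι.symm X).1 = 0 := (b.mem_verticalSpace_iff X).1 hX
    have h2 := b.diff_totalMap (g := fun _ => 0) contMDiffAt_const X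
    have e : (totalMap (fun x => normalSum 2 g x k) fun _ => 0) = fibreVec g k := by
      ext1 q'
      simp [totalMap, fibreVec]
    rw [h1, map_zero, zero_add, e, hX'] at h2
    have h3 : (b.ι.symm X).2 = 0 := by
      have h4 := b.left_inv.self_of_nhds (b.ι.symm X).2
      rw [← h2, map_zero] at h4
      exact h4.symm
    have h5 : b.ι.symm X = 0 := Prod.ext h1 h3
    exact (map_eq_zero_iff _ b.ι.symm.injective).1 h5

theorem IsElliptic.isNonparallelRuledOn [ConnectedSpace L] (hg : IsElliptic g)
    (hr : IsRegularSurface g)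
    (hfull : HasFullOsculation g (k + 4)) (hk : 1 ≤ k) (hN : N = 2 * (k + 4)) (hrk : r = 2 * k)
    (hn : n = 2 * k + 2)
    (hb : ∀ q, Nonempty (BundleChart (fun x => normalSum 2 g x k) r n q)) :
    IsNonparallelRuledOn n (ruledMap g k) (regularPart g k) 4 2 r where
  isOpen := hg.isOpen_regularPart hr hk
  isConnected := hg.isConnected_regularPart hr hfull hk
  immersion := by
    refine ⟨fun q _ => ?_, fun q hq => ?_⟩
    · obtain ⟨b⟩ := hb q
      exact (b.contMDiffAt_ruledMap hg).contMDiffWithinAt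
    · obtain ⟨b⟩ := hb q
      exact b.injective_diff hg hfull ((hg.mem_regularPart_iff hk q).1 hq)
  locallySubstantial := hg.isLocallySubstantialOn hr hfull hk hN hb
  rank_firstNormal := fun q hq => by
    obtain ⟨b⟩ := hb q
    exact b.finrank_firstNormalSpace hg hfull hk hn ((hg.mem_regularPart_iff hk q).1 hq)
  rank_nonparallel := fun q hq => by
    rw [hg.nonparallelSpace_eq hr hfull hk hb hq]
    exact hg.finrank_normalSpace_succ hfull q.1.1 (j := k + 1) (by omega)
  one_lt := one_lt_two
  lt_rank := by norm_num
  ruled := hg.isRuledOn hr hfull hk hrk hb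
  constant := hg.isConstantAlongRulingsOn hr hfull hk hb

end RuledManifold

/-! ### Osculating dimensions under symmetries -/

section Homogeneous

variable {E F : Type*} [NormedAddCommGroup E] [NormedSpace ℝ E] [NormedAddCommGroup F]
  [NormedSpace ℝ F] {G : E → F}

/-- Linear equivalences that intertwine translations preserve the dimensions of osculating
spaces. -/
theorem finrank_osc_add (hG : ContDiff ℝ ∞ G) (T : F ≃L[ℝ] F) {w : E}
    (h : ∀ x, G (x + w) = T (G x)) (u : E) (j : ℕ) :
    Module.finrank ℝ (osc G (u + w) j) = Module.finrank ℝ (osc G u j) := by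
  have h1 : osc G (u + w) j = (osc G u j).map (T.toLinearEquiv : F →ₗ[ℝ] F) := by
    have h2 : ∀ i, ∀ v : Fin i → E, iteratedFDeriv ℝ i G (u + w) v =
        T (iteratedFDeriv ℝ i G u v) := by
      intro i v
      have h3 := iteratedFDeriv_comp_add_right (𝕜 := ℝ) (f := G) i w u
      have h4 : (fun z => G (z + w)) = (T : F →L[ℝ] F) ∘ G := funext h
      rw [← h3, h4, ContinuousLinearMap.iteratedFDeriv_comp_left _ hG.contDiffAt
        (by exact_mod_cast le_top)]
      rfl
    unfold osc
    rw [Submodule.map_span]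
    congr 1
    ext z
    constructor
    · rintro ⟨i, hi, hij, v, rfl⟩
      exact ⟨_, ⟨i, hi, hij, v, rfl⟩, (h2 i v).symm⟩
    · rintro ⟨_, ⟨i, hi, hij, v, rfl⟩, rfl⟩
      exact ⟨i, hi, hij, v, (h2 i v).symm⟩
  rw [h1, LinearEquiv.finrank_map_eq]

end Homogeneous

/-! ### The exponential surface -/

section Existence

/-- The identification of `ℝ²` with `ℂ`. -/
def planeToComplex : Euc 2 ≃L[ℝ] ℂ :=
  Complex.orthonormalBasisOneI.repr.symm.toContinuousLinearEquiv

theorem planeToComplex_e₀ : planeToComplex e₀ = 1 := by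
  have h := Complex.orthonormalBasisOneI.repr_symm_single 0
  rw [Complex.coe_orthonormalBasisOneI] at h
  exact h

theorem planeToComplex_e₁ : planeToComplex e₁ = Complex.I := by
  have h := Complex.orthonormalBasisOneI.repr_symm_single 1
  rw [Complex.coe_orthonormalBasisOneI] at h
  exact h

/-- Multiplication by `i` on the plane. -/
def planeJ : Euc 2 →L[ℝ] Euc 2 :=
  (planeToComplex.symm : ℂ →L[ℝ] Euc 2).comp
    ((Complex.I • ContinuousLinearMap.id ℝ ℂ).comp (planeToComplex : Euc 2 →L[ℝ] ℂ))

theorem planeToComplex_planeJ (X : Euc 2) :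
    planeToComplex (planeJ X) = Complex.I * planeToComplex X := by
  simp [planeJ]

theorem planeJ_planeJ (X : Euc 2) : planeJ (planeJ X) = -X := by
  apply planeToComplex.injective
  rw [planeToComplex_planeJ, planeToComplex_planeJ, ← mul_assoc, Complex.I_mul_I, map_neg]
  ring

/-- The identification of `ℂᵖ` with `ℝ²ᵖ`. -/
def complexToEuc (p : ℕ) : (Fin p → ℂ) ≃L[ℝ] Euc (2 * p) :=
  ContinuousLinearEquiv.ofFinrankEq (by
    rw [Module.finrank_pi_fintype]
    simp [Complex.finrank_real_complex, mul_comm])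

/-- The surface `z ↦ (a λⱼˡ exp (λⱼ z))ⱼ` with `λⱼ = j + 1`. -/
def expSurface (p l : ℕ) (a : ℂ) (x : Euc 2) : Euc (2 * p) :=
  complexToEuc p fun j => a * ((j : ℂ) + 1) ^ l * Complex.exp (((j : ℂ) + 1) * planeToComplex x)

variable {p l : ℕ} {a : ℂ}

theorem contDiff_expSurface : ContDiff ℝ ∞ (expSurface p l a) := by
  refine (complexToEuc p).contDiff.comp (contDiff_pi.2 fun j => ?_)
  exact contDiff_const.mul (contDiff_const.mul planeToComplex.contDiff).cexp

/-- The parameters `l` and `a` make the family closed under differentiation: each derivative brings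
down one factor λ_j and one complex number X. -/
theorem fderiv_expSurface (x X : Euc 2) :
    fderiv ℝ (expSurface p l a) x X = expSurface p (l + 1) (a * planeToComplex X) x := by
  have h1 : ∀ j : Fin p, HasFDerivAt (fun x => a * ((j : ℂ) + 1) ^ l *
      Complex.exp (((j : ℂ) + 1) * planeToComplex x))
      ((a * ((j : ℂ) + 1) ^ l) • Complex.exp (((j : ℂ) + 1) * planeToComplex x) •
        ((j : ℂ) + 1) • (planeToComplex : Euc 2 →L[ℝ] ℂ)) x := fun j =>
    ((planeToComplex.hasFDerivAt.const_mul ((j : ℂ) + 1)).cexp).const_mul _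
  have h2 := (complexToEuc p).hasFDerivAt.comp x (hasFDerivAt_pi.2 h1)
  have h3 : fderiv ℝ (expSurface p l a) x = _ := h2.fderiv
  rw [h3]
  change complexToEuc p _ = complexToEuc p _
  congr 1
  ext j
  change (a * ((j : ℂ) + 1) ^ l) * (Complex.exp (((j : ℂ) + 1) * planeToComplex x) *
    (((j : ℂ) + 1) * planeToComplex X)) = _
  ring

theorem fderiv_fderiv_expSurface (x X Y : Euc 2) :
    fderiv ℝ (fderiv ℝ (expSurface p l a)) x X Y =
      expSurface p (l + 2) (a * planeToComplex Y * planeToComplex X) x := by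
  have hd : DifferentiableAt ℝ (fderiv ℝ (expSurface p l a)) x :=
    contDiff_expSurface.contDiffAt.fderiv_infty.differentiableAt (by simp)
  have h1 : fderiv ℝ (fun x => fderiv ℝ (expSurface p l a) x Y) x X =
      fderiv ℝ (fderiv ℝ (expSurface p l a)) x X Y := by
    rw [fderiv_clm_apply hd (differentiableAt_const _)]
    simp
  rw [← h1]
  simp_rw [fderiv_expSurface]

theorem expSurface_add_coeff (b : ℂ) (x : Euc 2) :
    expSurface p l a x + expSurface p l b x = expSurface p l (a + b) x := by
  unfold expSurface
  rw [← map_add]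
  congr 1
  ext j
  simp only [Pi.add_apply]
  ring

theorem expSurface_zero_coeff (x : Euc 2) : expSurface p l 0 x = 0 := by
  have h : (fun j : Fin p => (0 : ℂ) * ((j : ℂ) + 1) ^ l *
      Complex.exp (((j : ℂ) + 1) * planeToComplex x)) = 0 := by
    ext j
    simp
  unfold expSurface
  rw [h, map_zero]

theorem frame_expSurface (i : ℕ) (c : Fin 2) :
    frame (expSurface p 0 1) i c = expSurface p (i + 1) (planeToComplex (EuclideanSpace.single c 1)) := by
  induction i with
  | zero =>
    ext1 x
    change fderiv ℝ (expSurface p 0 1) x _ = _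
    rw [fderiv_expSurface, one_mul]
  | succ i ih =>
    ext1 x
    change fderiv ℝ (frame (expSurface p 0 1) i c) x e₀ = _
    rw [ih, fderiv_expSurface, planeToComplex_e₀, mul_one]

theorem injective_fderiv_expSurface (hp : 0 < p) (x : Euc 2) :
    Function.Injective (fderiv ℝ (expSurface p 0 1) x) := by
  rw [injective_iff_map_eq_zero]
  intro X hX
  rw [fderiv_expSurface, one_mul] at hX
  have h := congrFun ((map_eq_zero_iff _ (complexToEuc p).injective).1 hX) ⟨0, hp⟩
  simp only [Pi.zero_apply, mul_eq_zero, Complex.exp_ne_zero, or_false] at h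
  have h2 : planeToComplex X = 0 := by simpa using h
  exact (map_eq_zero_iff _ planeToComplex.injective).1 h2

theorem localRep_model (g : Euc 2 → Euc l) (x : Euc 2) : localRep 2 g x = g := by
  ext1 u
  simp [localRep, chartAt_self_eq]

theorem oscAt_model (g : Euc 2 → Euc l) (x : Euc 2) (j : ℕ) : oscAt 2 g x j = osc g x j := by
  unfold oscAt
  rw [localRep_model]
  simp [chartAt_self_eq]

/-- The map is holomorphic up to the identification of ℂᵖ with ℝ²ᵖ, so its second derivative is
complex bilinear and (iZ)² = −Z². -/
theorem isElliptic_expSurface (hp : 0 < p) : IsElliptic (expSurface p 0 1) := by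
  have hc : ContMDiff (𝓡 2) 𝓘(ℝ, Euc (2 * p)) ∞ (expSurface p 0 1) :=
    contDiff_expSurface.contMDiff
  refine ⟨⟨hc.contMDiffOn, fun x _ => ?_⟩, fun _ => planeJ, ⟨fun x Z => planeJ_planeJ Z, ?_⟩, ?_⟩
  · rw [diff_eq_fderiv ((hc x).mdifferentiableAt (by simp)), localRep_model]
    exact injective_fderiv_expSurface hp _
  · intro x₀
    have h : inTangentCoordinates (𝓡 2) (𝓡 2) id id (fun _ => planeJ) x₀ = fun _ => planeJ :=
      inTangentCoordinates_model_space _ _ _ _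
    rw [h]
    exact contMDiffAt_const
  · intro x Z
    unfold secondForm coordSecondForm
    rw [← map_add, localRep_model]
    have h : ∀ u Z : Euc 2, fderiv ℝ (fderiv ℝ (expSurface p 0 1)) u Z Z +
        fderiv ℝ (fderiv ℝ (expSurface p 0 1)) u (planeJ Z) (planeJ Z) = 0 := by
      intro u Z
      rw [fderiv_fderiv_expSurface, fderiv_fderiv_expSurface, expSurface_add_coeff,
        planeToComplex_planeJ]
      have h0 : (1 * planeToComplex Z * planeToComplex Z + 1 * (Complex.I * planeToComplex Z) *
          (Complex.I * planeToComplex Z)) = 0 := by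
        linear_combination (planeToComplex Z) ^ 2 * Complex.I_mul_I
      rw [h0, expSurface_zero_coeff]
    exact (congrArg _ (h _ Z)).trans (map_zero _)

/-- Diagonal multiplication, which realizes the translations of the exponential surface. -/
def expTranslate (p : ℕ) (w : ℂ) : Euc (2 * p) ≃L[ℝ] Euc (2 * p) :=
  ((complexToEuc p).symm.trans (ContinuousLinearEquiv.piCongrRight fun j : Fin p =>
    (ContinuousLinearEquiv.smulLeft (Units.mk0 (Complex.exp (((j : ℂ) + 1) * w))
      (Complex.exp_ne_zero _)) : ℂ ≃L[ℝ] ℂ))).trans (complexToEuc p)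

theorem expSurface_add (x w : Euc 2) :
    expSurface p 0 1 (x + w) = expTranslate p (planeToComplex w) (expSurface p 0 1 x) := by
  unfold expSurface expTranslate
  simp only [ContinuousLinearEquiv.trans_apply, ContinuousLinearEquiv.symm_apply_apply]
  congr 1
  ext j
  simp only [map_add, mul_add, Complex.exp_add]
  change _ = Complex.exp _ * _
  ring

/-- Translations of the plane act on the surface by invertible diagonal maps, so the osculating
dimensions are the same at all points. -/
theorem isRegularSurface_expSurface (hp : 0 < p) : IsRegularSurface (expSurface p 0 1) := by
  have hg := isElliptic_expSurface hp
  have h : ∀ (j : ℕ) (x y : Euc 2), Module.finrank ℝ (oscAt 2 (expSurface p 0 1) x j) =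
      Module.finrank ℝ (oscAt 2 (expSurface p 0 1) y j) := by
    intro j x y
    rw [oscAt_model, oscAt_model]
    have := finrank_osc_add contDiff_expSurface (expTranslate p (planeToComplex (x - y)))
      (fun z => expSurface_add (p := p) z (x - y)) y j
    rwa [add_sub_cancel] at this
  intro k x y
  cases k with
  | zero => rfl
  | succ k =>
    have h1 := hg.finrank_oscAt_succ x k
    have h2 := hg.finrank_oscAt_succ y k
    rw [h _ x y, h (k + 1) x y] at h1
    omega

/-- The direction of an affine subspace containing the surface contains all derivatives at 0, that
is, all vectors (b λ_jⁱ⁺¹)_j with b complex. As the λ_j are distinct and nonzero, polynomial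
interpolation produces every vector from them. -/
theorem isSubstantial_expSurface : IsSubstantial (expSurface p 0 1) := by
  intro D hD
  refine (AffineSubspace.direction_eq_top_iff_of_nonempty ⟨_, hD 0⟩).1 ?_
  have h1 : ∀ i c x, frame (expSurface p 0 1) i c x ∈ D.direction := by
    intro i
    induction i with
    | zero =>
      intro c x
      have h2 := fderiv_mem_of_eventually_mem (s := fun y => expSurface p 0 1 y - expSurface p 0 1 0)
        (D := D.direction) (u := x)
        ((contDiff_expSurface.differentiable (by simp) x).sub_const _)
        (.of_forall fun y => D.vsub_mem_direction (hD y) (hD 0)) (EuclideanSpace.single c 1)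
      rwa [fderiv_sub_const] at h2
    | succ i ih =>
      intro c x
      refine fderiv_mem_of_eventually_mem ?_ (.of_forall (ih c)) e₀
      exact (contDiffAt_frame contDiff_expSurface.contDiffAt i c).differentiableAt (by simp)
  have h2 : ∀ (i : ℕ) (b : ℂ), expSurface p (i + 1) b 0 ∈ D.direction := by
    intro i b
    have h3 := h1 i 0 0
    have h4 := h1 i 1 0
    rw [frame_expSurface] at h3 h4
    have h3' : expSurface p (i + 1) 1 0 ∈ D.direction := by rwa [← planeToComplex_e₀]
    have h4' : expSurface p (i + 1) Complex.I 0 ∈ D.direction := by rwa [← planeToComplex_e₁]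
    have h5 : expSurface p (i + 1) b 0 =
        b.re • expSurface p (i + 1) 1 0 + b.im • expSurface p (i + 1) Complex.I 0 := by
      unfold expSurface
      rw [← map_smul, ← map_smul, ← map_add]
      congr 1
      ext j
      simp only [Pi.add_apply, Pi.smul_apply, Complex.real_smul]
      conv_lhs => rw [← Complex.re_add_im b]
      ring
    rw [h5]
    exact add_mem (Submodule.smul_mem _ _ h3') (Submodule.smul_mem _ _ h4')
  rw [eq_top_iff]
  rintro w -
  obtain ⟨y, rfl⟩ := (complexToEuc p).surjective w
  -- The values are divided by λ_j because derivatives start at order one: the vectors available are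
  -- λ_j q(λ_j), not q(λ_j).
  let q : Polynomial ℂ := Lagrange.interpolate Finset.univ (fun j : Fin p => (j : ℂ) + 1)
    fun j => y j / ((j : ℂ) + 1)
  have hq : ∀ j : Fin p, q.eval ((j : ℂ) + 1) = y j / ((j : ℂ) + 1) := by
    intro j
    refine Lagrange.eval_interpolate_at_node (v := fun j : Fin p => (j : ℂ) + 1) _ ?_
      (Finset.mem_univ j)
    intro a _ b _ hab
    have : ((a : ℕ) : ℂ) = ((b : ℕ) : ℂ) := add_right_cancel hab
    exact Fin.ext (by exact_mod_cast this)
  have h3 : complexToEuc p y =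
      ∑ i ∈ Finset.range (q.natDegree + 1), expSurface p (i + 1) (q.coeff i) 0 := by
    unfold expSurface
    rw [← map_sum]
    congr 1
    ext j
    have h4 := hq j
    have hj : (j : ℂ) + 1 ≠ 0 := Nat.cast_add_one_ne_zero _
    rw [Polynomial.eval_eq_sum_range, eq_div_iff hj, Finset.sum_mul] at h4
    rw [Finset.sum_apply, ← h4]
    refine Finset.sum_congr rfl fun i _ => ?_
    simp only [map_zero, mul_zero, Complex.exp_zero, mul_one]
    ring
  rw [h3]
  exact sum_mem fun i _ => h2 i _

end Existence

/-! ### Assembly for k = m − 1 -/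

section Construction

variable {m : ℕ} {L : Type*} [TopologicalSpace L] [ConnectedSpace L] [ChartedSpace (Euc 2) L]
  [IsManifold (𝓡 2) ∞ L] {g : L → Euc (2 * (m + 3))}

/-- For k = m − 1 the order k + 4 is m + 3, the one at which the osculating space fills ℝ^{2(m+3)}.
-/
theorem IsElliptic.hasFullOsculation (hg : IsElliptic g) (hs : IsSubstantial g)
    (hr : IsRegularSurface g) (hm : 2 ≤ m) : HasFullOsculation g (m - 1 + 4) :=
  fun x j hj => hg.finrank_oscAt hs hr x j (by omega)

theorem IsElliptic.exists_bundleCharts (hg : IsElliptic g) (hs : IsSubstantial g)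
    (hr : IsRegularSurface g) (hm : 2 ≤ m) :
    ∃ _ : ChartedSpace (Euc (2 * m)) (NormalTotal g (m - 1)),
      IsManifold (𝓡 (2 * m)) ∞ (NormalTotal g (m - 1)) ∧
      ∀ q, Nonempty (BundleChart (fun x => normalSum 2 g x (m - 1)) (2 * m - 2) (2 * m) q) :=
  exists_chartedSpace (hg.contMDiff_starProjection_normalSum hr (m - 1))
    (fun x => by
      rw [hg.finrank_normalSum (hg.hasFullOsculation hs hr hm) x (by omega)]
      omega) (by omega)

theorem IsElliptic.normalBundle_decomposition (hg : IsElliptic g) (hs : IsSubstantial g)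
    (hr : IsRegularSurface g) (hm : 2 ≤ m) (x : L) :
    (∀ k, 1 ≤ k → k ≤ m + 2 → Module.finrank ℝ (normalSpace 2 g x k) = 2) ∧
      (∀ j k, j ≠ k → normalSpace 2 g x j ⟂ normalSpace 2 g x k) ∧
      (tangentImage 2 g x)ᗮ = normalSum 2 g x (m + 2) := by
  have hfull := hg.hasFullOsculation hs hr hm
  refine ⟨fun k h1 h2 => ?_, fun j k hjk => hg.isOrtho_normalSpace x hjk, ?_⟩
  · obtain ⟨j, rfl⟩ : ∃ j, k = j + 1 := ⟨k - 1, by omega⟩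
    exact hg.finrank_normalSpace_succ hfull x (by omega)
  · have h : oscAt 2 g x (m + 3) = ⊤ := by
      apply Submodule.eq_top_of_finrank_eq
      rw [hg.finrank_oscAt hs hr x _ le_rfl, finrank_euclideanSpace_fin]
    rw [hg.normalSum_eq, h, top_inf_eq, tangentImage_eq_osc (hg.mdifferentiableAt x)]

end Construction

end RuledImmersion

end

/-! ### The main theorem -/

theorem mainTheorem6 (m : ℕ) (hm : 2 ≤ m) :
    -- the construction, for every substantial elliptic surface with normal spaces of constant rank
    (∀ (L : Type*) [TopologicalSpace L] [T2Space L] [SecondCountableTopology L]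
        [ConnectedSpace L] [ChartedSpace (Euc 2) L] [IsManifold (𝓡 2) ∞ L]
        (g : L → Euc (2 * (m + 3))),
        IsElliptic g → IsSubstantial g → IsRegularSurface g →
        -- the normal bundle is the orthogonal sum of the planes `N_1^g, …, N_{m+2}^g`
        (∀ x : L, (∀ k, 1 ≤ k → k ≤ m + 2 → Module.finrank ℝ (normalSpace 2 g x k) = 2) ∧
          (∀ j k, j ≠ k → normalSpace 2 g x j ⟂ normalSpace 2 g x k) ∧
          (tangentImage 2 g x)ᗮ = normalSum 2 g x (m + 2)) ∧
        -- the total space of `N_1^g ⊕ ⋯ ⊕ N_{m-1}^g` is a manifold of dimension `2m`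
        ∃ _ : ChartedSpace (Euc (2 * m)) (NormalTotal g (m - 1)),
          IsSubmanifoldStructure (2 * m) g (m - 1) ∧
          -- `f` is smooth, and an immersion on an open set that contains the zero section
          -- and the points with nonzero component in `N_{m-1}^g`
          ContMDiff (𝓡 (2 * m)) 𝓘(ℝ, Euc (2 * (m + 3))) ∞ (ruledMap g (m - 1)) ∧
          (∃ M : Set (NormalTotal g (m - 1)), IsOpen M ∧
            IsImmersionOn (2 * m) (ruledMap g (m - 1)) M ∧
            (∀ q, fibreVec g (m - 1) q = 0 → q ∈ M) ∧ regularPart g (m - 1) ⊆ M) ∧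
          Dense (regularPart g (m - 1)) ∧
          -- there `f` is ruled, with `p = 4`, `s = 2` and rulings of dimension `2m - 2 = n - s`
          IsNonparallelRuledOn (2 * m) (ruledMap g (m - 1)) (regularPart g (m - 1))
            4 2 (2 * m - 2) ∧
          ∀ q ∈ regularPart g (m - 1),
            tangentImage (2 * m) (ruledMap g (m - 1)) q ⊔
                firstNormalSpace (2 * m) (ruledMap g (m - 1)) q =
              tangentImage 2 g (bundleProj g (m - 1) q) ⊔
                normalSum 2 g (bundleProj g (m - 1) q) (m + 1) ∧
            nonparallelSpace (2 * m) (ruledMap g (m - 1)) q =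
              normalSpace 2 g (bundleProj g (m - 1) q) (m + 1) ∧
            nullity (2 * m) (ruledMap g (m - 1)) q
                (nonparallelSpace (2 * m) (ruledMap g (m - 1)) q) =
              verticalSpace g (m - 1) q ∧
            (verticalSpace g (m - 1) q).map (diff (2 * m) (ruledMap g (m - 1)) q).toLinearMap =
              normalSum 2 g (bundleProj g (m - 1) q) (m - 1) ∧
            ¬ verticalSpace g (m - 1) q ≤
              relativeNullity (2 * m) (ruledMap g (m - 1)) q) ∧
    -- such surfaces exist
    (∃ g : Euc 2 → Euc (2 * (m + 3)), IsElliptic g ∧ IsSubstantial g ∧ IsRegularSurface g) ∧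
    -- the bound `d ≥ n - s` is attained, with rulings not in the relative nullity
    (∃ (M : Type) (_ : TopologicalSpace M) (_ : ChartedSpace (Euc (2 * m)) M)
        (f : M → Euc (2 * (m + 3))) (U : Set M) (s d : ℕ),
        T2Space M ∧ SecondCountableTopology M ∧ IsManifold (𝓡 (2 * m)) ∞ M ∧
        s = 2 ∧ d + s = 2 * m ∧ IsNonparallelRuledOn (2 * m) f U 4 s d ∧
        ∀ x ∈ U, ¬ nullity (2 * m) f x (nonparallelSpace (2 * m) f x) ≤
          relativeNullity (2 * m) f x) := by
  refine ⟨?_, ⟨expSurface (m + 3) 0 1, isElliptic_expSurface (by omega), isSubstantial_expSurface,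
    isRegularSurface_expSurface (by omega)⟩, ?_⟩
  · intro L _ _ _ _ _ _ g hg hs hr
    have hfull := hg.hasFullOsculation hs hr hm
    have hk : 1 ≤ m - 1 := by omega
    refine ⟨hg.normalBundle_decomposition hs hr hm, ?_⟩
    obtain ⟨cs, hcs, hb⟩ := hg.exists_bundleCharts hs hr hm
    have hf : ContMDiff (𝓡 (2 * m)) 𝓘(ℝ, Euc (2 * (m + 3))) ∞ (ruledMap g (m - 1)) := by
      intro q
      obtain ⟨b⟩ := hb q
      exact b.contMDiffAt_ruledMap hg
    refine ⟨cs, isSubmanifoldStructure hcs hb, hf,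
      -- The open set is the whole locus where the differential is injective; it contains the zero
      -- section and the regular part for two different reasons, orthogonality and nonvanishing
      -- leading terms.
      ⟨{q | Function.Injective (diff (2 * m) (ruledMap g (m - 1)) q)},
        isOpen_injective_diff hf, ⟨hf.contMDiffOn, fun q hq => hq⟩, fun q hq => ?_, fun q hq => ?_⟩,
      hg.dense_regularPart hfull hk,
      hg.isNonparallelRuledOn hr hfull hk (by omega) (by omega) (by omega) hb, fun q hq => ?_⟩
    · obtain ⟨b⟩ := hb q
      exact b.injective_diff_of_zero hg hq
    · obtain ⟨b⟩ := hb q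
      exact b.injective_diff hg hfull ((hg.mem_regularPart_iff hk q).1 hq)
    · obtain ⟨b⟩ := hb q
      have hq' := (hg.mem_regularPart_iff hk q).1 hq
      refine ⟨?_, ?_, hg.nullity_eq hr hfull hk hb hq, b.map_verticalSpace hg,
        b.not_verticalSpace_le hg hfull hk (by omega) hq'⟩
      · rw [b.tangentImage_sup_firstNormalSpace hg hfull hk hq',
          tangentImage_sup_normalSum (hg.contMDiffAt _) (hg.injective _),
          show m - 1 + 3 = m + 1 + 1 by omega]
        rfl
      · rw [hg.nonparallelSpace_eq hr hfull hk hb hq, show m - 1 + 2 = m + 1 by omega]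
        rfl
  -- The last assertion is the construction applied to the exponential surface with p = m + 3.
  · have hg := isElliptic_expSurface (p := m + 3) (by omega)
    have hs := isSubstantial_expSurface (p := m + 3)
    have hr := isRegularSurface_expSurface (p := m + 3) (by omega)
    have hfull := hg.hasFullOsculation hs hr hm
    have hk : 1 ≤ m - 1 := by omega
    obtain ⟨cs, hcs, hb⟩ := hg.exists_bundleCharts hs hr hm
    refine ⟨NormalTotal (expSurface (m + 3) 0 1) (m - 1), inferInstance, cs,
      ruledMap (expSurface (m + 3) 0 1) (m - 1), regularPart (expSurface (m + 3) 0 1) (m - 1),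
      2, 2 * m - 2, inferInstance, inferInstance, hcs, rfl, by omega,
      hg.isNonparallelRuledOn hr hfull hk (by omega) (by omega) (by omega) hb, fun q hq => ?_⟩
    obtain ⟨b⟩ := hb q
    rw [hg.nullity_eq hr hfull hk hb hq]
    exact b.not_verticalSpace_le hg hfull hk (by omega) ((hg.mem_regularPart_iff hk q).1 hq)
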